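/- Fix $T>0$ and $\alpha>0$. Let $\mathbb T=\mathbb R/\mathbb Z$ with Lebesgue measure $\mathcal L_{\mathbb T}$, $\Omega_1=\mathbb T\times\{-1,1\}$, $\iota(x,v)=(x,-v)$, and $\pi=\mathcal L_{\mathbb T}\otimes\mathrm{Unif}_{\{-1,1\}}$. Let $\mathcal P(X)$ and $\mathcal M(X)$ denote the probability measures and the finite signed Borel measures on $X$, with the narrow topology (duality with bounded continuous functions), and let $C([0,T];\mathcal P(X))$ carry the topology of uniform convergence in time with respect to the narrow topology. A *family* $(\mu_t)$ in $\mathcal M(X)$ is called integrable if $t\mapsto\mu_t(B)$ is measurable for every Borel set $B$ and $\int\|\mu_t\|_{TV}\,dt<\infty$; then $\mu_t(dx)\,dt$ denotes the measure $A\mapsto\int\mu_t(\{x:(t,x)\in A\})\,dt$. *Continuity equation.* $(\sigma,j)\in\mathrm{CE}(0,T;\Omega_1)$ means: $\sigma\in C([0,T];\mathcal P(\Omega_1))$; $j=(j^1_t,j^2_t)_{t\in(0,T)}$ is a pair of integrable families in $\mathcal M(\Omega_1)$; and for all $\varphi:\Omega_1\to\mathbb R$ that are $C^1$ in $x$ and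 all $0\le s\le t\le T$, $$\int\varphi\,d\sigma_t-\int\varphi\,d\sigma_s=\int_s^t\Bigl(\int\partial_x\varphi\,dj^1_r+\int(\varphi\circ\iota-\varphi)\,dj^2_r\Bigr)dr .$$ *Rate functional.* For $\nu\ge0$ put $\mathrm{Ent}(\mu|\nu)=\int(f\log f-f+1)\,d\nu$ if $\mu\ge 0$, $\mu\ll\nu$ and $f=d\mu/d\nu$, and $\mathrm{Ent}(\mu|\nu)=+\infty$ otherwise. For $V\ge1$ let $\mathscr L^V(\sigma,j)=\mathrm{Ent}\bigl(j^2\,\big|\,\tfrac{V^2}{2\alpha}\sigma\bigr)$ if $j^1=V\,v\,\sigma$ and $+\infty$ otherwise, and let $\mathscr I^V(\sigma,j)=\int_0^T\mathscr L^V(\sigma_t,j_t)\,dt$ if $(\sigma,j)\in\mathrm{CE}(0,T;\Omega_1)$ and $+\infty$ otherwise. **Proposition.** Let $(V_n)$ be a sequence in $[1,\infty)$ (for instance $V_n\to\infty$), and let $(\sigma^n,j^n)\in\mathrm{CE}(0,T;\Omega_1)$ satisfy $$\sup_n\bigl\{\mathrm{Ent}(\sigma^n_0|\pi)+\mathscr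 I^{V_n}(\sigma^n,j^n)\bigr\}\le C<\infty .$$ Define $$\rho^n_t(dx)=\sum_{v=\pm1}\sigma^n_t(dx,v),\quad \omega^n(dtdx)=V_n\sum_{v=\pm1}v\,\sigma^n_t(dx,v)\,dt,\quad J^n(dtdx)=\sum_{v=\pm1}\frac{v}{V_n}\,j^{2,n}_t(dx,v)\,dt .$$ Then, along a common subsequence, there are limits $\bar\rho,\bar\omega,\bar J$ such that 1. $\rho^n\to\bar\rho$ in $C([0,T];\mathcal P(\mathbb T))$; 2. $\omega^n\to\bar\omega$ narrowly in $\mathcal M([0,T]\times\mathbb T)$; 3. $J^n\to\bar J$ narrowly in $\mathcal M((0,T)\times\mathbb T)$. Moreover $\bar\rho_t\ll\mathcal L_{\mathbb T}$ for every $t\in[0,T]$, and there are integrable families $(\bar\omega_t)_{t\in[0,T]}$ and $(\bar J_t)_{t\in(0,T)}$ in $\mathcal M(\mathbb T)$ with $\bar\omega(dtdx)=\bar\omega_t(dx)\,dt$ and $\bar J(dtdx)=\bar J_t(dx)\,dt$. -/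

import Mathlib

open MeasureTheory Set Filter Topology
open scoped ENNReal NNReal BoundedContinuousFunction

namespace KacDiffusive

noncomputable section

/-! ### Phase space -/

/-- The one-dimensional torus `ℝ / ℤ`; `volume` is its Lebesgue measure, of total mass one. -/
abbrev Torus : Type := UnitAddCircle

/-- The rescaled velocities `{-1, 1}`, realised as the units of `ℤ`, with the discrete topology. -/
abbrev Vel : Type := ℤˣ

/-- The discrete sigma-algebra on the two-point space of velocities. -/
instance instDiscreteMeasurableSpaceVel : DiscreteMeasurableSpace Vel := by
  have : MeasurableSingletonClass Vel := ⟨fun u => by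
    have h : ({u} : Set Vel) = Units.val ⁻¹' {(u : ℤ)} := by
      ext w
      simp [Units.val_inj]
    rw [h]
    exact ⟨{(u : ℤ)}, measurableSet_singleton _, rfl⟩⟩
  infer_instance

/-- The real number `-1` or `1` represented by a velocity. -/
def Vel.toReal (v : Vel) : ℝ := ((v : ℤ) : ℝ)

/-- The phase space `Ω₁ = 𝕋 × {-1, 1}`. -/
abbrev Phase : Type := Torus × Vel

/-- Velocity reversal `ι (x, v) = (x, -v)`. -/
def flipVel (p : Phase) : Phase := (p.1, -p.2)

/-- The stationary measure `π = 𝓛_𝕋 ⊗ Unif {-1, 1}`. -/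
def stat : Measure Phase :=
  (volume : Measure Torus).prod ((2 : ℝ≥0∞)⁻¹ • (Measure.count : Measure Vel))

/-! ### Signed measures, families of signed measures, space-time measures -/

/-- The pairing `⟨f, μ⟩ = ∫ f dμ` of a real function with a finite signed measure. -/
def pairing {X : Type*} [MeasurableSpace X] (f : X → ℝ) (μ : SignedMeasure X) : ℝ :=
  ∫ᵛ x, f x ∂•μ

/-- Narrow convergence of a sequence of finite signed measures: convergence against all bounded
continuous functions. -/
def NarrowTendsto {X : Type*} [MeasurableSpace X] [TopologicalSpace X]
    (μ : ℕ → SignedMeasure X) (ν : SignedMeasure X) : Prop :=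
  ∀ f : X →ᵇ ℝ, Tendsto (fun n => pairing (fun x => f x) (μ n)) atTop
    (𝓝 (pairing (fun x => f x) ν))

/-- A measurable family `(μ_t)` of finite signed measures whose total variation norm is
integrable in time. -/
structure IsIntegrableFamily {τ X : Type*} [MeasurableSpace τ] [MeasurableSpace X]
    (m : Measure τ) (μ : τ → SignedMeasure X) : Prop where
  measurable : ∀ B : Set X, MeasurableSet B → Measurable fun t => μ t B
  integrable : ∫⁻ t, (μ t).variation univ ∂m < ∞

theorem IsIntegrableFamily.stronglyMeasurable_section {τ X : Type*} [MeasurableSpace τ]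
    [MeasurableSpace X] {m : Measure τ} {μ : τ → SignedMeasure X} (h : IsIntegrableFamily m μ)
    {A : Set (τ × X)} (hA : MeasurableSet A) :
    StronglyMeasurable fun t => μ t (Prod.mk t ⁻¹' A) := by
  induction A, hA
    using MeasurableSpace.induction_on_inter generateFrom_prod.symm isPiSystem_prod with
  | empty => simp [stronglyMeasurable_const]
  | basic s hs =>
    obtain ⟨s, hs, t, ht, rfl⟩ := hs
    classical
    have : (fun a => μ a (Prod.mk a ⁻¹' s ×ˢ t)) = s.indicator fun a => μ a t := by
      funext a
      by_cases ha : a ∈ s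
      · simp [ha]
      · simp [ha]
    rw [this]
    exact (h.measurable t ht).stronglyMeasurable.indicator hs
  | compl s hs ihs =>
    simp_rw [preimage_compl, VectorMeasure.of_compl (measurable_prodMk_left hs)]
    exact (h.measurable univ MeasurableSet.univ).stronglyMeasurable.sub ihs
  | iUnion f hfd hfm ihf =>
    have (a : τ) : HasSum (fun i ↦ μ a (Prod.mk a ⁻¹' f i)) (μ a (Prod.mk a ⁻¹' ⋃ i, f i)) := by
      rw [preimage_iUnion]
      apply VectorMeasure.hasSum_of_disjoint_iUnion
      exacts [fun i ↦ measurable_prodMk_left (hfm i), hfd.mono fun _ _ ↦ .preimage _]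
    exact StronglyMeasurable.hasSum ihf this

theorem IsIntegrableFamily.hasSum_integral_section {τ X : Type*} [MeasurableSpace τ]
    [MeasurableSpace X] {m : Measure τ} {μ : τ → SignedMeasure X} (h : IsIntegrableFamily m μ)
    {f : ℕ → Set (τ × X)} (hfm : ∀ i, MeasurableSet (f i))
    (hfd : Pairwise (Function.onFun Disjoint f)) :
    HasSum (fun i => ∫ t, μ t (Prod.mk t ⁻¹' f i) ∂m)
      (∫ t, μ t (Prod.mk t ⁻¹' ⋃ i, f i) ∂m) := by
  have key : ∀ t, ∀ i, ‖μ t (Prod.mk t ⁻¹' f i)‖ₑ ≤ (μ t).variation (Prod.mk t ⁻¹' f i) :=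
    fun t i => VectorMeasure.enorm_measure_le_variation _ _
  have hsum : ∀ t, ∑' i, ‖μ t (Prod.mk t ⁻¹' f i)‖ₑ ≤ (μ t).variation univ := by
    intro t
    calc ∑' i, ‖μ t (Prod.mk t ⁻¹' f i)‖ₑ
        ≤ ∑' i, (μ t).variation (Prod.mk t ⁻¹' f i) := ENNReal.tsum_le_tsum (key t)
      _ = (μ t).variation (⋃ i, Prod.mk t ⁻¹' f i) :=
          (measure_iUnion (fun i j hij => (hfd hij).preimage _)
            (fun i => measurable_prodMk_left (hfm i))).symm
      _ ≤ _ := measure_mono (subset_univ _)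
  have hmeas : ∀ i, AEStronglyMeasurable (fun t => μ t (Prod.mk t ⁻¹' f i)) m :=
    fun i => (h.stronglyMeasurable_section (hfm i)).aestronglyMeasurable
  have hfin : ∑' i, ∫⁻ t, ‖μ t (Prod.mk t ⁻¹' f i)‖ₑ ∂m ≠ ∞ := by
    rw [← lintegral_tsum (fun i => (hmeas i).enorm)]
    exact ((lintegral_mono hsum).trans_lt h.integrable).ne
  have hint : ∀ i, Integrable (fun t => μ t (Prod.mk t ⁻¹' f i)) m := fun i =>
    ⟨hmeas i, lt_of_le_of_lt (ENNReal.le_tsum i) hfin.lt_top⟩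
  have hs : Summable fun i => ∫ t, ‖μ t (Prod.mk t ⁻¹' f i)‖ ∂m := by
    have := ENNReal.summable_toReal hfin
    refine this.congr fun i => ?_
    rw [integral_norm_eq_lintegral_enorm (hmeas i)]
  have := hasSum_integral_of_summable_integral_norm (E := ℝ) hint hs
  have heq : (fun t => μ t (Prod.mk t ⁻¹' ⋃ i, f i)) =
      fun t => ∑' i, μ t (Prod.mk t ⁻¹' f i) := by
    funext t
    rw [preimage_iUnion]
    exact (VectorMeasure.hasSum_of_disjoint_iUnion
      (fun i ↦ measurable_prodMk_left (hfm i)) (fun i j hij => (hfd hij).preimage _)).tsum_eq.symm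
  rw [heq]
  exact this

open Classical in
/-- The space-time measure `μ_t(dx) dt`, that is `A ↦ ∫ μ_t {x | (t, x) ∈ A} dt`, of a family of
signed measures which is measurable and integrable in total variation. (The value for other
families is irrelevant.) -/
def spaceTime {τ X : Type*} [MeasurableSpace τ] [MeasurableSpace X]
    (m : Measure τ) (μ : τ → SignedMeasure X) : SignedMeasure (τ × X) :=
  if h : IsIntegrableFamily m μ then
    { measureOf' := fun A => if MeasurableSet A then ∫ t, μ t (Prod.mk t ⁻¹' A) ∂m else 0
      empty' := by simp
      not_measurable' := by
        intro A hA
        simp [hA]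
      m_iUnion' := by
        intro f hfm hfd
        simp only [hfm, if_true, MeasurableSet.iUnion hfm]
        exact h.hasSum_integral_section hfm hfd }
  else 0

/-- The slice `μ(dx, v)` of a signed measure on the phase space, a signed measure on the torus. -/
def slice (μ : SignedMeasure Phase) (v : Vel) : SignedMeasure Torus :=
  (μ.restrict (Prod.snd ⁻¹' {v})).map Prod.fst

open Classical in
/-- Relative entropy `Ent(μ | ν)` of a signed measure `μ` with respect to a measure `ν`. It is
`∫ (f log f - f + 1) dν` if `μ` is nonnegative with density `f` with respect to `ν`, and `∞`
otherwise. If `μ` is nonnegative, its positive part is `μ` itself. -/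
def signedEnt {X : Type*} [MeasurableSpace X] (μ : SignedMeasure X) (ν : Measure X) : ℝ≥0∞ :=
  if 0 ≤ μ then InformationTheory.klDiv μ.toJordanDecomposition.posPart ν else ∞

/-! ### The continuity equation -/

/-- Lebesgue measure on a set of times, as a measure on the subtype. -/
def lebOn (I : Set ℝ) : Measure I := (volume : Measure ℝ).comap Subtype.val

/-- Inclusion of `(0, T)` in `[0, T]`. -/
def toIcc {T : ℝ} (t : Ioo (0 : ℝ) T) : Icc (0 : ℝ) T := ⟨t.1, Ioo_subset_Icc_self t.2⟩

/-- The class `C^{1,0}` of functions on phase space which are continuously differentiable in `x`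
(no condition is needed on the discrete variable `v`). -/
def IsC10 (φ : Phase → ℝ) : Prop :=
  ∀ v : Vel, ContDiff ℝ 1 fun y : ℝ => φ ((y : Torus), v)

/-- The partial derivative `∂ₓ φ`. -/
def dx (φ : Phase → ℝ) (p : Phase) : ℝ := deriv (fun h : ℝ => φ (p.1 + (h : Torus), p.2)) 0

/-- The discrete velocity gradient `φ ∘ ι - φ`. -/
def dv (φ : Phase → ℝ) (p : Phase) : ℝ := φ (flipVel p) - φ p

/-- Curves `σ ∈ C([0,T]; 𝒫(Ω₁))`, where probability measures carry the narrow topology. -/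
abbrev Curve (T : ℝ) : Type := C(Icc (0 : ℝ) T, ProbabilityMeasure Phase)

/-- Families of fluxes `j_t = (j¹_t, j²_t)`, `t ∈ (0,T)`, of pairs of finite signed measures. -/
abbrev Flux (T : ℝ) : Type := Ioo (0 : ℝ) T → SignedMeasure Phase × SignedMeasure Phase

/-- The class `CE(0,T;Ω₁)` of pairs `(σ, j)` satisfying the continuity equation. -/
structure IsCE {T : ℝ} (σ : Curve T) (j : Flux T) : Prop where
  fst : IsIntegrableFamily (lebOn (Ioo 0 T)) fun t => (j t).1
  snd : IsIntegrableFamily (lebOn (Ioo 0 T)) fun t => (j t).2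
  weak : ∀ φ : Phase → ℝ, IsC10 φ → ∀ s t : Icc (0 : ℝ) T, s ≤ t →
    ∫ p, φ p ∂(σ t : Measure Phase) - ∫ p, φ p ∂(σ s : Measure Phase) =
      ∫ r in {r : Ioo (0 : ℝ) T | (s : ℝ) < r ∧ (r : ℝ) < t},
        (pairing (dx φ) (j r).1 + pairing (dv φ) (j r).2) ∂(lebOn (Ioo 0 T))

/-! ### The rescaled rate functional -/

open Classical in
/-- The rescaled Lagrangian `𝓛^V(σ, j)`, with diffusivity `α`: it equals
`Ent(j² | (V² / (2 α)) σ)` if `j¹ = V v σ`, and `∞` otherwise. -/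
def lagrangian (α V : ℝ) (σ : ProbabilityMeasure Phase)
    (j : SignedMeasure Phase × SignedMeasure Phase) : ℝ≥0∞ :=
  if j.1 = (σ : Measure Phase).withDensityᵥ (fun p => V * p.2.toReal) then
    signedEnt j.2 (ENNReal.ofReal (V ^ 2 / (2 * α)) • (σ : Measure Phase))
  else ∞

open Classical in
/-- The rescaled rate functional `𝓘^V`. -/
def rate (α V : ℝ) {T : ℝ} (σ : Curve T) (j : Flux T) : ℝ≥0∞ :=
  if IsCE σ j then ∫⁻ t, lagrangian α V (σ (toIcc t)) (j t) ∂(lebOn (Ioo 0 T)) else ∞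

/-! ### Density, flux and derived flux -/

/-- The density `ρ_t(dx) = ∑_v σ_t(dx, v)`, the first marginal of `σ_t`, as a curve in
`C([0,T]; 𝒫(𝕋))`. The topology on this space of continuous maps is the compact-open one; since
`[0,T]` is compact, it is the topology of uniform convergence in time with respect to the narrow
topology. -/
def density {T : ℝ} (σ : Curve T) : C(Icc (0 : ℝ) T, ProbabilityMeasure Torus) where
  toFun t := (σ t).map (continuous_fst (X := Torus) (Y := Vel)).measurable.aemeasurable
  continuous_toFun :=
    (ProbabilityMeasure.continuous_map (continuous_fst (X := Torus) (Y := Vel))).comp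
      σ.continuous

/-- The time slices `ω_t(dx) = V ∑_v v σ_t(dx, v)`, `t ∈ [0,T]`. -/
def omegaSlice (V : ℝ) {T : ℝ} (σ : Curve T) (t : Icc (0 : ℝ) T) : SignedMeasure Torus :=
  V • ∑ v : Vel, v.toReal • slice (σ t : Measure Phase).toSignedMeasure v

/-- The space-time measure `ω(dtdx) = V ∑_v v σ_t(dx, v) dt` on `[0,T] × 𝕋`. -/
def omega (V : ℝ) {T : ℝ} (σ : Curve T) : SignedMeasure (Icc (0 : ℝ) T × Torus) :=
  spaceTime (lebOn (Icc 0 T)) (omegaSlice V σ)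

/-- The time slices `J_t(dx) = ∑_v (v / V) j²_t(dx, v)`, `t ∈ (0,T)`. -/
def derivedFluxSlice (V : ℝ) {T : ℝ} (j : Flux T) (t : Ioo (0 : ℝ) T) : SignedMeasure Torus :=
  ∑ v : Vel, (v.toReal / V) • slice (j t).2 v

/-- The space-time measure `J(dtdx) = ∑_v (v / V) j²_t(dx, v) dt` on `(0,T) × 𝕋`. -/
def derivedFlux (V : ℝ) {T : ℝ} (j : Flux T) : SignedMeasure (Ioo (0 : ℝ) T × Torus) :=
  spaceTime (lebOn (Ioo 0 T)) (derivedFluxSlice V j)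

end

end KacDiffusive

namespace KacDiffusive

noncomputable section

/-! ### Pairings of bounded measurable functions with signed measures -/

section Pairing

variable {X Y : Type*} [MeasurableSpace X] [MeasurableSpace Y]

/-! Everything rests on an entropy dissipation inequality that is uniform in `V`: `½ Ent(σ_t|π) +
V²/(2α) ∫₀ᵗ F(σ_r) dr ≤ ½ Ent(σ_0|π) + 𝓘^V(σ, j)`, with `F(σ) = ∫ (√σ(x,1) - √σ(x,-1))² dx`.
Formally, test the continuity equation with half the logarithm of the density and bound the flux
terms by Lagrangian plus Hamiltonian, by convex duality (`ofReal_le_lagrangian`). The transport part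
of the Hamiltonian is an exact `x`-derivative and vanishes. The jump part equals `-V²/(2α) F`, since
`exp (½ (log u(-v) - log u(v))) u(v)` is the geometric mean `√(u(1) u(-1))`.

To make this rigorous, `σ` is mollified in `x` and averaged with `π`, which gives the smooth
densities `denShift ≥ 1/2`. Mollification passes to the test function by duality and is harmless
inside the exponential by Jensen; averaging with `π` only improves the sign. In time, the test
function is frozen at the right endpoint of a short interval, and the errors are summed
(`IsMollifier.entropy_add_fisher_le`).

Four consequences follow. Cauchy-Schwarz turns the bound on `V² ∫ F` into an `L²` bound in time on
the total variation of `ω_t`; it survives removal of the mollifier by Fatou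
(`lintegral_fluxBound_sq_le`). For `J`, duality is used with the test function `l (v/V) h(x)`.
Expanding the exponential to first order produces `ω/(2α)`, and the second-order term is bounded
because `V² (1/V)² = 1`. Hence `|J_t| ≤ 𝓛/l + |ω_t|/(2α) + O_l(1)` for every `l`
(`variation_derivedFluxSlice_le`). Both families are therefore equi-integrable in time. Prokhorov's
theorem applied to the Jordan parts, and disintegration of the limits, give convergence and the time
slices (`exists_subseq_narrowTendsto`). The curves `ρ` have increments governed by the flux, hence
are equicontinuous, and Arzelà-Ascoli applies (`exists_subseq_density`). The entropy bound at each
fixed time, in dual form, is stable under narrow limits and forces `ρ_t ≪ dx`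
(`absolutelyContinuous_of_integral_le`). -/

instance isFiniteMeasure_variation (s : SignedMeasure X) : IsFiniteMeasure s.variation := by
  rw [← SignedMeasure.totalVariation_eq_variation]; infer_instance

theorem integrable_of_abs_le {μ : Measure X} [IsFiniteMeasure μ] {f : X → ℝ} (hf : Measurable f)
    {M : ℝ} (hM : ∀ x, |f x| ≤ M) : Integrable f μ :=
  Integrable.of_bound hf.aestronglyMeasurable M (Eventually.of_forall hM)

theorem pairing_toSignedMeasure (f : X → ℝ) (μ : Measure X) [IsFiniteMeasure μ] :
    pairing f μ.toSignedMeasure = ∫ x, f x ∂μ := by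
  rw [← VectorMeasure.integral_toSignedMeasure (f := f)]
  unfold pairing
  congr 1
  ext
  simp

theorem pairing_sub_measure {f : X → ℝ} (hf : Measurable f) {M : ℝ} (hM : ∀ x, |f x| ≤ M)
    (μ ν : SignedMeasure X) : pairing f (μ - ν) = pairing f μ - pairing f ν :=
  VectorMeasure.integral_sub_vectorMeasure (integrable_of_abs_le hf hM)
    (integrable_of_abs_le hf hM)

theorem pairing_smul_measure (f : X → ℝ) (c : ℝ) (μ : SignedMeasure X) :
    pairing f (c • μ) = c * pairing f μ := by
  exact VectorMeasure.integral_smul_vectorMeasure (μ := μ)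
    (B := ContinuousLinearMap.lsmul ℝ ℝ) f c

theorem pairing_sum_measure {ι : Type*} {f : X → ℝ} (hf : Measurable f) {M : ℝ}
    (hM : ∀ x, |f x| ≤ M) (t : Finset ι) (μ : ι → SignedMeasure X) :
    pairing f (∑ i ∈ t, μ i) = ∑ i ∈ t, pairing f (μ i) :=
  VectorMeasure.integral_finsetSum_vectorMeasure fun _ _ => integrable_of_abs_le hf hM

theorem pairing_add {f g : X → ℝ} (hf : Measurable f) {M N : ℝ} (hM : ∀ x, |f x| ≤ M)
    (hg : Measurable g) (hN : ∀ x, |g x| ≤ N) (μ : SignedMeasure X) :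
    pairing (fun x => f x + g x) μ = pairing f μ + pairing g μ :=
  VectorMeasure.integral_fun_add (integrable_of_abs_le hf hM) (integrable_of_abs_le hg hN)

theorem pairing_const_mul (c : ℝ) (f : X → ℝ) (μ : SignedMeasure X) :
    pairing (fun x => c * f x) μ = c * pairing f μ := by
  exact VectorMeasure.integral_fun_smul (μ := μ)
    (B := ContinuousLinearMap.lsmul ℝ ℝ) c f

theorem pairing_zero (μ : SignedMeasure X) : pairing (fun _ => (0 : ℝ)) μ = 0 := by
  simpa using pairing_const_mul 0 (fun _ => (0 : ℝ)) μ

theorem pairing_eq_jordan {f : X → ℝ} (hf : Measurable f) {M : ℝ} (hM : ∀ x, |f x| ≤ M)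
    (μ : SignedMeasure X) :
    pairing f μ = ∫ x, f x ∂μ.toJordanDecomposition.posPart -
      ∫ x, f x ∂μ.toJordanDecomposition.negPart := by
  conv_lhs => rw [← μ.toSignedMeasure_toJordanDecomposition]
  rw [JordanDecomposition.toSignedMeasure, pairing_sub_measure hf hM, pairing_toSignedMeasure,
    pairing_toSignedMeasure]

theorem pairing_indicator_one (μ : SignedMeasure X) {A : Set X} (hA : MeasurableSet A) :
    pairing (A.indicator fun _ => (1 : ℝ)) μ = μ A := by
  rw [pairing_eq_jordan (M := 1) (measurable_const.indicator hA), integral_indicator_const _ hA,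
    integral_indicator_const _ hA, SignedMeasure.apply_eq_posPart_real_sub_negPart_real _ hA]
  · simp
  · intro x
    by_cases hx : x ∈ A <;> simp [hx]

theorem abs_pairing_le {f : X → ℝ} {M : ℝ} (hM : ∀ x, |f x| ≤ M) (μ : SignedMeasure X) :
    |pairing f μ| ≤ M * μ.variation.real univ := by
  have hc : ‖ContinuousLinearMap.lsmul ℝ ℝ (E := ℝ)‖ ≤ 1 :=
    ContinuousLinearMap.opNorm_lsmul_le
  have := VectorMeasure.norm_integral_le_of_norm_le_const (μ := μ) (f := f) (C := M)
    (B := ContinuousLinearMap.lsmul ℝ ℝ) (Eventually.of_forall hM)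
  rcases isEmpty_or_nonempty X with hX | ⟨⟨x⟩⟩
  · simp [pairing, VectorMeasure.eq_zero_of_isEmpty]
  · have hM0 : 0 ≤ M := (abs_nonneg _).trans (hM x)
    refine this.trans ?_
    gcongr
    exact mul_le_of_le_one_right hM0 hc

theorem tendsto_pairing {F : ℕ → X → ℝ} {f : X → ℝ} (hF : ∀ n, Measurable (F n)) {M : ℝ}
    (hM : ∀ n x, |F n x| ≤ M) (hlim : ∀ x, Tendsto (fun n => F n x) atTop (𝓝 (f x)))
    (μ : SignedMeasure X) :
    Tendsto (fun n => pairing (F n) μ) atTop (𝓝 (pairing f μ)) :=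
  VectorMeasure.tendsto_integral_of_dominated_convergence (fun _ => M)
    (fun n => (hF n).aestronglyMeasurable) (integrable_const M)
    (fun n => Eventually.of_forall (hM n)) (Eventually.of_forall hlim)

/-- The polar decomposition of a signed measure. -/
theorem exists_sign (μ : SignedMeasure X) : ∃ h : X → ℝ, Measurable h ∧ (∀ x, |h x| ≤ 1) ∧
    pairing h μ = μ.variation.real univ := by
  obtain ⟨S, hS, -, -, hp, hn⟩ := μ.toJordanDecomposition.exists_compl_positive_negative
  -- The positive part gives no mass to `S` and the negative part none to `Sᶜ`, so the sign is `+1`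
  -- on `Sᶜ` and `-1` on `S`.
  have hm : Measurable (fun x => Sᶜ.indicator (fun _ => (1 : ℝ)) x - S.indicator (fun _ => 1) x) :=
    (measurable_const.indicator hS.compl).sub (measurable_const.indicator hS)
  have hb : ∀ x, |Sᶜ.indicator (fun _ => (1 : ℝ)) x - S.indicator (fun _ => 1) x| ≤ 1 := by
    intro x
    by_cases hx : x ∈ S <;> simp [hx]
  refine ⟨_, hm, hb, ?_⟩
  rw [pairing_eq_jordan hm hb]
  have hi : ∀ (ν : Measure X) [IsFiniteMeasure ν],
      ∫ x, (Sᶜ.indicator (fun _ => (1 : ℝ)) x - S.indicator (fun _ => 1) x) ∂ν =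
        ν.real Sᶜ - ν.real S := by
    intro ν _
    rw [integral_sub ((integrable_const _).indicator hS.compl) ((integrable_const _).indicator hS),
      integral_indicator_const _ hS.compl, integral_indicator_const _ hS]
    simp
  rw [hi, hi, ← SignedMeasure.totalVariation_eq_variation, SignedMeasure.totalVariation,
    measureReal_add_apply, ← measureReal_add_measureReal_compl hS,
    ← measureReal_add_measureReal_compl (μ := μ.toJordanDecomposition.negPart) hS]
  simp only [measureReal_def, hp, hn]
  simp

theorem pairing_withDensityᵥ {μ : Measure X} [IsFiniteMeasure μ] {f g : X → ℝ} (hf : Measurable f)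
    {M N : ℝ} (hM : ∀ x, |f x| ≤ M) (hg : Measurable g) (hN : ∀ x, |g x| ≤ N) :
    pairing f (μ.withDensityᵥ g) = ∫ x, f x * g x ∂μ := by
  have hgi : Integrable g μ := integrable_of_abs_le hg hN
  have := isFiniteMeasure_withDensity_ofReal hgi.2
  have := isFiniteMeasure_withDensity_ofReal hgi.neg.2
  rw [withDensityᵥ_eq_withDensity_pos_part_sub_withDensity_neg_part hgi,
    pairing_sub_measure hf hM, pairing_toSignedMeasure, pairing_toSignedMeasure]
  have h1 : ∀ h : X → ℝ, Measurable h → ∫ x, f x ∂(μ.withDensity fun x => ENNReal.ofReal (h x)) =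
      ∫ x, max (h x) 0 * f x ∂μ := by
    intro h hh
    rw [integral_withDensity_eq_integral_toReal_smul hh.ennreal_ofReal
      (Eventually.of_forall fun _ => ENNReal.ofReal_lt_top)]
    simp [ENNReal.toReal_ofReal']
  rw [h1 g hg, h1 (fun x => -g x) hg.neg, ← integral_sub]
  · congr 1
    ext x
    rcases le_total (g x) 0 with h | h
    · rw [max_eq_right h, max_eq_left (by linarith)]; ring
    · rw [max_eq_left h, max_eq_right (by linarith)]; ring
  all_goals
    refine integrable_of_abs_le (M := N * M) (by fun_prop) fun x => ?_
    rw [abs_mul]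
    refine mul_le_mul ?_ (hM x) (abs_nonneg _) ((abs_nonneg _).trans (hN x))
    have := abs_le.1 (hN x)
    rw [abs_le]
    constructor
    · exact le_trans (by linarith [(abs_nonneg _).trans (hN x)]) (le_max_right _ _)
    · exact max_le (by linarith) ((abs_nonneg _).trans (hN x))

theorem pairing_map {f : Y → ℝ} (hf : Measurable f) {φ : X → Y} (hφ : Measurable φ)
    {M : ℝ} (hM : ∀ x, |f x| ≤ M) (μ : SignedMeasure X) :
    pairing f (μ.map φ) = pairing (fun x => f (φ x)) μ := by
  exact VectorMeasure.integral_map hφ hf.aestronglyMeasurable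
    (integrable_of_abs_le (hf.comp hφ) fun x => hM (φ x))

theorem pairing_restrict (f : X → ℝ) {A : Set X} (hA : MeasurableSet A) (μ : SignedMeasure X) :
    pairing f (μ.restrict A) = pairing (A.indicator f) μ :=
  (VectorMeasure.integral_indicator hA).symm

end Pairing

/-! ### Pairings with space-time measures -/

theorem exists_simpleFunc_abs_sub_le {X : Type*} [MeasurableSpace X] {f : X → ℝ}
    (hf : Measurable f) {M : ℝ} (hM : ∀ x, |f x| ≤ M) {ε : ℝ} (hε : 0 < ε) :
    ∃ g : SimpleFunc X ℝ, ∀ x, |f x - g x| ≤ ε := by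
  -- Rounding down to multiples of `ε` takes finitely many values because `f` is bounded.
  have hfin : (range fun x => ε * (⌊f x / ε⌋ : ℝ)).Finite := by
    refine ((Set.finite_Icc ⌊-M / ε⌋ ⌊M / ε⌋).image fun k : ℤ => ε * (k : ℝ)).subset ?_
    rintro _ ⟨x, rfl⟩
    refine ⟨⌊f x / ε⌋, ⟨Int.floor_mono ?_, Int.floor_mono ?_⟩, rfl⟩
    · have := (abs_le.1 (hM x)).1
      gcongr
    · have := (abs_le.1 (hM x)).2
      gcongr
  have hmeas : Measurable fun x => ε * (⌊f x / ε⌋ : ℝ) := by fun_prop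
  refine ⟨⟨fun x => ε * (⌊f x / ε⌋ : ℝ), fun y => hmeas (measurableSet_singleton y), hfin⟩,
    fun x => ?_⟩
  change |f x - ε * (⌊f x / ε⌋ : ℝ)| ≤ ε
  have h1 := Int.floor_le (f x / ε)
  have h2 := Int.lt_floor_add_one (f x / ε)
  rw [le_div_iff₀ hε] at h1
  rw [div_lt_iff₀ hε] at h2
  rw [abs_le]
  constructor <;> nlinarith

section SpaceTime

variable {τ X : Type*} [MeasurableSpace τ] [MeasurableSpace X] {m : Measure τ}
  {μ : τ → SignedMeasure X}

theorem spaceTime_apply (h : IsIntegrableFamily m μ) {A : Set (τ × X)} (hA : MeasurableSet A) :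
    spaceTime m μ A = ∫ t, μ t (Prod.mk t ⁻¹' A) ∂m := by
  rw [spaceTime, dif_pos h]
  exact if_pos hA

theorem simpleFunc_abs_le {X : Type*} [MeasurableSpace X] (g : SimpleFunc X ℝ) :
    ∃ M, ∀ x, |g x| ≤ M := by
  obtain ⟨M, hM⟩ : BddAbove _ := (g.finite_range.image abs).bddAbove
  exact ⟨M, fun x => hM ⟨g x, ⟨x, rfl⟩, rfl⟩⟩

/-- Simple functions reduce to measurability of sections; a bounded measurable function is a uniform
limit of simple ones, and pairings converge by domination. -/
theorem IsIntegrableFamily.measurable_pairing (h : IsIntegrableFamily m μ) {F : τ × X → ℝ}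
    (hF : Measurable F) {M : ℝ} (hM : ∀ p, |F p| ≤ M) :
    Measurable fun t => pairing (fun x => F (t, x)) (μ t) := by
  have key : ∀ g : SimpleFunc (τ × X) ℝ,
      Measurable fun t => pairing (fun x => g (t, x)) (μ t) := by
    intro g
    induction g using SimpleFunc.induction with
    | const c hs =>
      rename_i s
      have : ∀ t, pairing (fun x => (SimpleFunc.piecewise s hs (SimpleFunc.const _ c)
          (SimpleFunc.const _ 0) : τ × X → ℝ) (t, x)) (μ t) = c * μ t (Prod.mk t ⁻¹' s) := by
        intro t
        rw [← pairing_indicator_one (μ t) (measurable_prodMk_left hs), ← pairing_const_mul]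
        congr 1
        ext x
        by_cases hx : (t, x) ∈ s <;> simp [hx]
      simp_rw [this]
      exact (h.stronglyMeasurable_section hs).measurable.const_mul c
    | add _ hf hg =>
      rename_i f g _
      obtain ⟨M, hM⟩ := simpleFunc_abs_le f
      obtain ⟨N, hN⟩ := simpleFunc_abs_le g
      have : ∀ t, pairing (fun x => (f + g : SimpleFunc _ _) (t, x)) (μ t) =
          pairing (fun x => f (t, x)) (μ t) + pairing (fun x => g (t, x)) (μ t) := fun t =>
        pairing_add (f.measurable.comp measurable_prodMk_left) (fun x => hM (t, x))
          (g.measurable.comp measurable_prodMk_left) (fun x => hN (t, x)) (μ t)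
      simp_rw [this]
      exact hf.add hg
  choose g hg using fun n : ℕ => exists_simpleFunc_abs_sub_le hF hM
    (ε := 1 / ((n : ℝ) + 1)) (by positivity)
  refine measurable_of_tendsto_metrizable (fun n => key (g n)) (tendsto_pi_nhds.2 fun t => ?_)
  refine tendsto_pairing (M := M + 1) (fun n => (g n).measurable.comp measurable_prodMk_left)
    (fun n x => ?_) (fun x => ?_) (μ t)
  · have h1 := hg n (t, x)
    have h2 := hM (t, x)
    have h3 : 1 / ((n : ℝ) + 1) ≤ 1 := by
      rw [div_le_one (by positivity)]; linarith [n.cast_nonneg (α := ℝ)]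
    have := abs_sub_abs_le_abs_sub (g n (t, x)) (F (t, x))
    rw [abs_sub_comm] at this
    change |g n (t, x)| ≤ M + 1
    linarith
  · rw [tendsto_iff_dist_tendsto_zero]
    refine squeeze_zero (fun _ => dist_nonneg) (fun n => ?_)
      tendsto_one_div_add_atTop_nhds_zero_nat
    rw [dist_comm, Real.dist_eq]
    exact hg n (t, x)

theorem ofReal_abs_pairing_le {f : X → ℝ} {M : ℝ} (hM0 : 0 ≤ M) (hM : ∀ x, |f x| ≤ M)
    (μ : SignedMeasure X) : ‖pairing f μ‖ₑ ≤ ENNReal.ofReal M * μ.variation univ := by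
  rw [← ofReal_norm, Real.norm_eq_abs, ← ofReal_measureReal, ← ENNReal.ofReal_mul hM0]
  exact ENNReal.ofReal_le_ofReal (abs_pairing_le hM μ)

theorem IsIntegrableFamily.integrable_pairing (h : IsIntegrableFamily m μ) {F : τ × X → ℝ}
    (hF : Measurable F) {M : ℝ} (hM0 : 0 ≤ M) (hM : ∀ p, |F p| ≤ M) :
    Integrable (fun t => pairing (fun x => F (t, x)) (μ t)) m := by
  refine ⟨(h.measurable_pairing hF hM).aestronglyMeasurable, ?_⟩
  refine (lintegral_mono fun t => ofReal_abs_pairing_le hM0 (fun x => hM (t, x)) (μ t)).trans_lt ?_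
  rw [lintegral_const_mul' _ _ ENNReal.ofReal_ne_top]
  exact ENNReal.mul_lt_top ENNReal.ofReal_lt_top h.integrable

end SpaceTime

/-! ### Narrow compactness of equi-integrable families -/

section Compactness

open ProbabilityTheory

variable {τ X : Type*} [MeasurableSpace τ] [MeasurableSpace X] {m : Measure τ}

/-- Splitting the integral of a sum requires one measurable summand, and measurability of `t ↦
|μ'_t|(X)` is not part of being an integrable family. This is why a measurable majorant `g` is
carried along. -/
theorem IsIntegrableFamily.sub {μ μ' : τ → SignedMeasure X} (h : IsIntegrableFamily m μ)
    (h' : IsIntegrableFamily m μ') {g : τ → ℝ≥0∞} (hg : Measurable g)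
    (hgμ : ∀ t, (μ' t).variation univ ≤ g t) (hgi : ∫⁻ t, g t ∂m < ∞) :
    IsIntegrableFamily m (fun t => μ t - μ' t) where
  measurable B hB := (h.measurable B hB).sub (h'.measurable B hB)
  integrable := by
    calc ∫⁻ t, (μ t - μ' t).variation univ ∂m ≤ ∫⁻ t, ((μ t).variation univ + g t) ∂m := by
          refine lintegral_mono fun t => ?_
          refine (VectorMeasure.variation_sub_le (μ := μ t) (ν := μ' t) univ).trans ?_
          rw [Measure.add_apply]
          gcongr
          exact hgμ t
      _ = ∫⁻ t, (μ t).variation univ ∂m + ∫⁻ t, g t ∂m := lintegral_add_right _ hg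
      _ < ∞ := ENNReal.add_lt_top.2 ⟨h.integrable, hgi⟩

theorem IsIntegrableFamily.integrable_section {μ : τ → SignedMeasure X}
    (h : IsIntegrableFamily m μ) {A : Set (τ × X)} (hA : MeasurableSet A) :
    Integrable (fun t => μ t (Prod.mk t ⁻¹' A)) m :=
  ⟨(h.stronglyMeasurable_section hA).aestronglyMeasurable,
    (lintegral_mono fun t => (VectorMeasure.enorm_measure_le_variation (μ t) _).trans
      (measure_mono (subset_univ _))).trans_lt h.integrable⟩

theorem spaceTime_sub {μ μ' : τ → SignedMeasure X} (h : IsIntegrableFamily m μ)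
    (h' : IsIntegrableFamily m μ') (hs : IsIntegrableFamily m (fun t => μ t - μ' t)) :
    spaceTime m (fun t => μ t - μ' t) = spaceTime m μ - spaceTime m μ' := by
  ext A hA
  rw [sub_apply, spaceTime_apply hs hA, spaceTime_apply h hA, spaceTime_apply h' hA,
    ← integral_sub (h.integrable_section hA) (h'.integrable_section hA)]
  rfl

/-- A finite measure on a product whose first marginal is absolutely continuous is the space-time
measure of an integrable family. -/
theorem exists_spaceTime_eq [StandardBorelSpace X] [Nonempty X] [SigmaFinite m]
    (ν : Measure (τ × X)) [IsFiniteMeasure ν] (hν : ν.fst ≪ m) :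
    ∃ μ : τ → SignedMeasure X, IsIntegrableFamily m μ ∧ spaceTime m μ = ν.toSignedMeasure ∧
      ∃ g : τ → ℝ≥0∞, Measurable g ∧ (∀ t, (μ t).variation univ ≤ g t) ∧ ∫⁻ t, g t ∂m < ∞ := by
  set d : τ → ℝ≥0∞ := ν.fst.rnDeriv m with hd
  have hdm : Measurable d := Measure.measurable_rnDeriv _ _
  have hdi : ∫⁻ t, d t ∂m < ∞ := Measure.lintegral_rnDeriv_lt_top _ _
  set κ := ν.condKernel
  -- Disintegrate over the first marginal and absorb the density of that marginal with respect to
  -- `m` into the kernel.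
  set μ : τ → SignedMeasure X := fun t => (d t).toReal • (κ t).toSignedMeasure with hμ
  have hval : ∀ t B, MeasurableSet B → μ t B = (d t).toReal * (κ t).real B := by
    intro t B hB
    simp [hμ, Measure.toSignedMeasure_apply_measurable hB]
  have hvar : ∀ t, (μ t).variation univ ≤ d t := by
    intro t
    rw [hμ]
    simp only [VectorMeasure.variation_smul, Measure.variation_toSignedMeasure]
    rw [Measure.smul_apply, measure_univ, ENNReal.smul_def, smul_eq_mul, mul_one,
      ← enorm_eq_nnnorm, Real.enorm_of_nonneg ENNReal.toReal_nonneg]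
    exact ENNReal.ofReal_toReal_le
  have hfam : IsIntegrableFamily m μ := by
    refine ⟨fun B hB => ?_, (lintegral_mono hvar).trans_lt hdi⟩
    simp_rw [fun t => hval t B hB]
    exact hdm.ennreal_toReal.mul (Kernel.measurable_coe κ hB).ennreal_toReal
  refine ⟨μ, hfam, ?_, d, hdm, hvar, hdi⟩
  ext A hA
  rw [spaceTime_apply hfam hA, Measure.toSignedMeasure_apply_measurable hA]
  simp_rw [fun t => hval t _ (measurable_prodMk_left hA : MeasurableSet (Prod.mk t ⁻¹' A))]
  have hκm : Measurable fun t => κ t (Prod.mk t ⁻¹' A) :=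
    Kernel.measurable_kernel_prodMk_left hA
  have : ν A = ∫⁻ t, d t * κ t (Prod.mk t ⁻¹' A) ∂m := by
    conv_lhs => rw [← ν.disintegrate κ]
    rw [Measure.compProd_apply hA, ← Measure.withDensity_rnDeriv_eq _ _ hν,
      lintegral_withDensity_eq_lintegral_mul _ hdm hκm]
    rfl
  rw [measureReal_def, this, ← integral_toReal (f := fun t => d t * κ t (Prod.mk t ⁻¹' A)) (hdm.mul hκm).aemeasurable]
  · simp [measureReal_def]
  · filter_upwards [Measure.rnDeriv_lt_top ν.fst m] with t ht
    exact ENNReal.mul_lt_top ht (measure_lt_top _ _)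

variable [TopologicalSpace τ] [PolishSpace τ] [BorelSpace τ]
  [TopologicalSpace X] [PolishSpace X] [CompactSpace X] [BorelSpace X]

/-- Prokhorov's theorem for finite measures of mass bounded below whose time marginals are
equi-integrable. -/
theorem exists_subseq_tendsto_of_fst_le [IsFiniteMeasure m] (ν : ℕ → Measure (τ × X))
    [∀ n, IsFiniteMeasure (ν n)] {c₀ : ℝ≥0} (hc₀ : c₀ ≠ 0) (hmass : ∀ n, c₀ ≤ ν n univ)
    (hν : ∀ ε : ℝ≥0, 0 < ε → ∃ c : ℝ≥0, ∀ n B, MeasurableSet B →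
      ν n (B ×ˢ univ) ≤ ε + c * m B) :
    ∃ k : ℕ → ℕ, StrictMono k ∧ ∃ ν' : Measure (τ × X), IsFiniteMeasure ν' ∧
      (∀ F : (τ × X) →ᵇ ℝ, Tendsto (fun n => ∫ p, F p ∂(ν (k n))) atTop (𝓝 (∫ p, F p ∂ν'))) ∧
      ν'.fst ≪ m := by
  have hc₀' : (c₀ : ℝ≥0∞) ≠ 0 := by simpa using hc₀
  have hne : ∀ n, ν n univ ≠ 0 := fun n h => hc₀' (le_zero_iff.1 (h ▸ hmass n))
  have hprob : ∀ n, IsProbabilityMeasure ((ν n univ)⁻¹ • ν n) := fun n =>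
    ⟨by simp [ENNReal.inv_mul_cancel (hne n) (measure_ne_top _ _)]⟩
  set P : ℕ → ProbabilityMeasure (τ × X) := fun n => ⟨(ν n univ)⁻¹ • ν n, hprob n⟩ with hP
  have hPle : ∀ ε : ℝ≥0, 0 < ε → ∃ c : ℝ≥0, ∀ n B, MeasurableSet B →
      (P n : Measure (τ × X)) (B ×ˢ univ) ≤ ε + c * m B := by
    intro ε hε
    obtain ⟨c, hc⟩ := hν (c₀ * ε) (by positivity)
    refine ⟨c₀⁻¹ * c, fun n B hB => ?_⟩
    change (ν n univ)⁻¹ * ν n (B ×ˢ univ) ≤ _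
    calc (ν n univ)⁻¹ * ν n (B ×ˢ univ) ≤ (c₀ : ℝ≥0∞)⁻¹ * ((c₀ * ε : ℝ≥0) + c * m B) :=
          mul_le_mul' (ENNReal.inv_le_inv.2 (hmass n)) (hc n B hB)
      _ = _ := by
          rw [mul_add, ENNReal.coe_mul, ← mul_assoc, ENNReal.inv_mul_cancel hc₀' ENNReal.coe_ne_top,
            one_mul, ENNReal.coe_mul, ENNReal.coe_inv hc₀, mul_assoc]
  -- Tightness in time is inherited from the single finite measure `m` on a Polish space, through
  -- the bound on time marginals; the compact factor `X` costs nothing. This is what prevents loss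
  -- of mass at the ends of an open interval.
  have htight : IsTightMeasureSet {((μ : ProbabilityMeasure (τ × X)) : Measure (τ × X)) |
      μ ∈ range P} := by
    rw [isTightMeasureSet_iff_exists_isCompact_measure_compl_le]
    intro ε hε
    obtain ⟨ε', hε', hlt⟩ := ENNReal.lt_iff_exists_nnreal_btwn.1 hε
    have hε'0 : 0 < ε' := by simpa using hε'
    obtain ⟨c, hc⟩ := hPle (ε' / 2) (by positivity)
    have := isTightMeasureSet_singleton (μ := m)
    rw [isTightMeasureSet_iff_exists_isCompact_measure_compl_le] at this
    obtain ⟨K, hK, hKm⟩ := this ((ε' / 2 / (c + 1) : ℝ≥0)) (by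
      rw [ENNReal.coe_pos]; positivity)
    refine ⟨K ×ˢ univ, hK.prod isCompact_univ, ?_⟩
    rintro _ ⟨_, ⟨n, rfl⟩, rfl⟩
    have hcompl : (K ×ˢ (univ : Set X))ᶜ = Kᶜ ×ˢ univ := by
      ext p; simp
    rw [hcompl]
    refine (hc n _ hK.measurableSet.compl).trans (le_trans ?_ hlt.le)
    calc ((ε' / 2 : ℝ≥0) : ℝ≥0∞) + c * m Kᶜ
        ≤ (ε' / 2 : ℝ≥0) + c * (ε' / 2 / (c + 1) : ℝ≥0) := by
          gcongr
          exact hKm m rfl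
      _ = ((ε' / 2 + c * (ε' / 2 / (c + 1)) : ℝ≥0) : ℝ≥0∞) := by push_cast; rfl
      _ ≤ ε' := by
          rw [ENNReal.coe_le_coe]
          have : c * (ε' / 2 / (c + 1)) ≤ ε' / 2 := by
            rw [mul_div_assoc', div_le_iff₀ (by positivity), mul_comm]
            gcongr
            exact le_self_add
          calc _ ≤ ε' / 2 + ε' / 2 := by gcongr
            _ = ε' := add_halves _
  obtain ⟨c, hc⟩ := hν 1 one_pos
  have hM : ∀ n, (ν n).real univ ≤ 1 + c * m.real univ := by
    intro n
    have := hc n univ MeasurableSet.univ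
    rw [univ_prod_univ] at this
    have h2 := ENNReal.toReal_mono (by finiteness) this
    rwa [ENNReal.toReal_add (by finiteness) (by finiteness), ENNReal.toReal_mul] at h2
  -- Normalized measures and total masses are extracted together; the masses lie in a compact
  -- interval.
  have hcpt := (isCompact_closure_of_isTightMeasureSet htight).prod
    (isCompact_Icc (a := (c₀ : ℝ)) (b := 1 + c * m.real univ))
  obtain ⟨⟨P', r⟩, -, k, hk, hlim⟩ := hcpt.tendsto_subseq
    (x := fun n => (P n, (ν n).real univ)) fun n =>
      ⟨subset_closure ⟨n, rfl⟩, ENNReal.toReal_mono (measure_ne_top _ _) (hmass n), hM n⟩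
  rw [nhds_prod_eq] at hlim
  have hPlim : Tendsto (fun n => P (k n)) atTop (𝓝 P') := tendsto_fst.comp hlim
  have hrlim : Tendsto (fun n => (ν (k n)).real univ) atTop (𝓝 r) := tendsto_snd.comp hlim
  have hr0 : 0 ≤ r := ge_of_tendsto' hrlim fun n => measureReal_nonneg
  refine ⟨k, hk, ENNReal.ofReal r • (P' : Measure (τ × X)), ?_, fun F => ?_, ?_⟩
  · exact ⟨by simp⟩
  · have h1 := (ProbabilityMeasure.tendsto_iff_forall_integral_tendsto.1 hPlim) F
    have h2 := hrlim.mul h1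
    rw [integral_smul_measure, ENNReal.toReal_ofReal hr0, smul_eq_mul]
    refine h2.congr fun n => ?_
    change _ * ∫ p, F p ∂((ν (k n) univ)⁻¹ • ν (k n)) = _
    rw [integral_smul_measure, smul_eq_mul, ← mul_assoc, ENNReal.toReal_inv, measureReal_def,
      mul_inv_cancel₀, one_mul]
    exact (ENNReal.toReal_pos (hne _) (measure_ne_top _ _)).ne'
  -- The portmanteau theorem transfers the marginal bound to the limit only on open sets; outer
  -- regularity of `m` then covers a null set by an open set of small measure.
  · have hopen : ∀ ε : ℝ≥0, 0 < ε → ∃ c : ℝ≥0, ∀ U : Set τ, IsOpen U →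
        (P' : Measure (τ × X)) (U ×ˢ univ) ≤ ε + c * m U := by
      intro ε hε
      obtain ⟨c, hc⟩ := hPle ε hε
      refine ⟨c, fun U hU => ?_⟩
      refine (ProbabilityMeasure.le_liminf_measure_open_of_tendsto hPlim
        (hU.prod isOpen_univ)).trans ?_
      refine liminf_le_of_le (by isBoundedDefault) fun b hb => ?_
      obtain ⟨n, hn⟩ := hb.exists
      exact hn.trans (hc (k n) U hU.measurableSet)
    refine Measure.AbsolutelyContinuous.mk fun B hB hB0 => ?_
    rw [Measure.fst_apply hB, Measure.smul_apply]
    have : (P' : Measure (τ × X)) (Prod.fst ⁻¹' B) = 0 := by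
      refine le_antisymm (ENNReal.le_of_forall_pos_le_add fun ε hε _ => ?_) bot_le
      rw [zero_add]
      obtain ⟨c, hc⟩ := hopen (ε / 2) (by positivity)
      obtain ⟨U, hBU, hU, hUm⟩ := B.exists_isOpen_lt_of_lt (μ := m)
        ((ε / 2 / (c + 1) : ℝ≥0)) (by rw [hB0, ENNReal.coe_pos]; positivity)
      calc (P' : Measure (τ × X)) (Prod.fst ⁻¹' B) ≤ (P' : Measure (τ × X)) (U ×ˢ univ) :=
            measure_mono fun p hp => ⟨hBU hp, mem_univ _⟩
        _ ≤ (ε / 2 : ℝ≥0) + c * m U := hc U hU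
        _ ≤ (ε / 2 : ℝ≥0) + c * (ε / 2 / (c + 1) : ℝ≥0) := by gcongr
        _ = ((ε / 2 + c * (ε / 2 / (c + 1)) : ℝ≥0) : ℝ≥0∞) := by push_cast; rfl
        _ ≤ ε := by
          rw [ENNReal.coe_le_coe]
          have : c * (ε / 2 / (c + 1)) ≤ ε / 2 := by
            rw [mul_div_assoc', div_le_iff₀ (by positivity), mul_comm]
            gcongr
            exact le_self_add
          calc _ ≤ ε / 2 + ε / 2 := by gcongr
            _ = ε := add_halves _
    simp [this]

/-- Families of signed measures whose total variations are equi-integrable in time are narrowly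
relatively compact, and the limits are again induced by integrable families. -/
theorem exists_subseq_narrowTendsto [StandardBorelSpace X] [Nonempty X] [IsFiniteMeasure m]
    [NeZero m] (μ : ℕ → τ → SignedMeasure X) (hμ : ∀ n, IsIntegrableFamily m (μ n))
    (hequi : ∀ ε : ℝ≥0, 0 < ε → ∃ c : ℝ≥0, ∀ n B, MeasurableSet B →
      ∫⁻ t in B, (μ n t).variation univ ∂m ≤ ε + c * m B) :
    ∃ k : ℕ → ℕ, StrictMono k ∧ ∃ μ' : τ → SignedMeasure X, IsIntegrableFamily m μ' ∧
      NarrowTendsto (fun n => spaceTime m (μ (k n))) (spaceTime m μ') := by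
  obtain ⟨x₀⟩ := ‹Nonempty X›
  -- Adding `m₀` to both Jordan parts keeps their masses away from zero, so that they can be
  -- normalized; it cancels in the difference.
  set m₀ : Measure (τ × X) := m.prod (Measure.dirac x₀) with hm₀
  have hm₀B : ∀ B, m₀ (B ×ˢ univ) = m B := fun B => by simp [hm₀]
  -- With `A` a Hahn set or its complement, this controls each Jordan part of the space-time measure
  -- on the strip over `B`.
  have hpart : ∀ n B, MeasurableSet B → ∀ A, MeasurableSet A →
      ENNReal.ofReal |spaceTime m (μ n) (A ∩ B ×ˢ univ)| ≤
        ∫⁻ t in B, (μ n t).variation univ ∂m := by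
    intro n B hB A hA
    rw [spaceTime_apply (hμ n) (hA.inter (hB.prod MeasurableSet.univ)), ← Real.norm_eq_abs,
      ofReal_norm]
    refine (enorm_integral_le_lintegral_enorm _).trans ?_
    rw [← lintegral_indicator hB]
    refine lintegral_mono fun t => ?_
    by_cases ht : t ∈ B
    · rw [indicator_of_mem ht]
      exact (VectorMeasure.enorm_measure_le_variation _ _).trans (measure_mono (subset_univ _))
    · rw [indicator_of_notMem ht]
      have : Prod.mk t ⁻¹' (A ∩ B ×ˢ univ) = ∅ := by
        ext x; simp [ht]
      simp [this]
  have hpos : ∀ n B, MeasurableSet B →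
      (spaceTime m (μ n)).toJordanDecomposition.posPart (B ×ˢ univ) ≤
        ∫⁻ t in B, (μ n t).variation univ ∂m := by
    intro n B hB
    obtain ⟨i, hi, hi1, hi2, hp, -⟩ := (spaceTime m (μ n)).toJordanDecomposition_spec
    rw [hp, SignedMeasure.toMeasureOfZeroLE_apply _ hi1 hi (hB.prod MeasurableSet.univ)]
    refine le_trans (le_of_eq ?_) (hpart n B hB i hi)
    rw [ENNReal.coe_nnreal_eq]
    congr 1
    exact (abs_of_nonneg (VectorMeasure.nonneg_of_zero_le_restrict _
      (VectorMeasure.zero_le_restrict_subset _ hi inter_subset_left hi1))).symm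
  have hneg : ∀ n B, MeasurableSet B →
      (spaceTime m (μ n)).toJordanDecomposition.negPart (B ×ˢ univ) ≤
        ∫⁻ t in B, (μ n t).variation univ ∂m := by
    intro n B hB
    obtain ⟨i, hi, hi1, hi2, -, hp⟩ := (spaceTime m (μ n)).toJordanDecomposition_spec
    rw [hp, SignedMeasure.toMeasureOfLEZero_apply _ hi2 hi.compl (hB.prod MeasurableSet.univ)]
    refine le_trans (le_of_eq ?_) (hpart n B hB iᶜ hi.compl)
    rw [ENNReal.coe_nnreal_eq]
    congr 1
    exact (abs_of_nonpos (VectorMeasure.nonpos_of_restrict_le_zero _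
      (VectorMeasure.restrict_le_zero_subset _ hi.compl inter_subset_left hi2))).symm
  set c₀ : ℝ≥0 := (m univ).toNNReal with hc₀
  have hc₀e : (c₀ : ℝ≥0∞) = m univ := ENNReal.coe_toNNReal (measure_ne_top _ _)
  have hc₀0 : c₀ ≠ 0 := by
    rw [← ENNReal.coe_ne_zero, hc₀e]
    exact (Measure.measure_univ_ne_zero.2 (NeZero.ne m))
  have hmass : ∀ ν : Measure (τ × X), (c₀ : ℝ≥0∞) ≤ (ν + m₀) univ := by
    intro ν
    rw [hc₀e, ← hm₀B, univ_prod_univ, Measure.add_apply]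
    exact le_add_self
  have hbd : ∀ ν : ℕ → Measure (τ × X), (∀ n B, MeasurableSet B →
      ν n (B ×ˢ univ) ≤ ∫⁻ t in B, (μ n t).variation univ ∂m) →
      ∀ ε : ℝ≥0, 0 < ε → ∃ c : ℝ≥0, ∀ n B, MeasurableSet B →
      (ν n + m₀) (B ×ˢ univ) ≤ ε + c * m B := by
    intro ν hν ε hε
    obtain ⟨c, hc⟩ := hequi ε hε
    refine ⟨c + 1, fun n B hB => ?_⟩
    rw [Measure.add_apply, hm₀B]
    calc _ ≤ (ε + c * m B) + m B := by gcongr; exact (hν n B hB).trans (hc n B hB)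
      _ = _ := by push_cast; ring
  obtain ⟨k₁, hk₁, ν₁, hν₁, hlim₁, hac₁⟩ := exists_subseq_tendsto_of_fst_le (m := m)
    (fun n => (spaceTime m (μ n)).toJordanDecomposition.posPart + m₀) hc₀0 (fun n => hmass _)
    (hbd _ hpos)
  obtain ⟨k₂, hk₂, ν₂, hν₂, hlim₂, hac₂⟩ := exists_subseq_tendsto_of_fst_le (m := m)
    (fun n => (spaceTime m (μ (k₁ n))).toJordanDecomposition.negPart + m₀) hc₀0 (fun n => hmass _)
    (fun ε hε => (hbd _ hneg ε hε).imp fun c hc n => hc (k₁ n))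
  have : Nonempty X := ⟨x₀⟩
  obtain ⟨μ₁, hμ₁, hst₁, -⟩ := exists_spaceTime_eq (m := m) ν₁ hac₁
  obtain ⟨μ₂, hμ₂, hst₂, g, hg, hgμ, hgi⟩ := exists_spaceTime_eq (m := m) ν₂ hac₂
  have hsub := hμ₁.sub hμ₂ hg hgμ hgi
  refine ⟨k₁ ∘ k₂, hk₁.comp hk₂, fun t => μ₁ t - μ₂ t, hsub, fun F => ?_⟩
  have hFb : ∀ p, |F p| ≤ ‖F‖ := fun p => F.norm_coe_le_norm p
  have hFm : Measurable F := F.continuous.measurable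
  rw [spaceTime_sub hμ₁ hμ₂ hsub, hst₁, hst₂, pairing_sub_measure hFm hFb,
    pairing_toSignedMeasure, pairing_toSignedMeasure]
  refine (((hlim₁ F).comp hk₂.tendsto_atTop).sub (hlim₂ F)).congr fun n => ?_
  simp only [Function.comp_apply]
  rw [pairing_eq_jordan hFm hFb, integral_add_measure, integral_add_measure]
  · ring
  all_goals exact integrable_of_abs_le hFm hFb

end Compactness

/-! ### The entropy inequality -/

section Entropy

open InformationTheory

/-- Fenchel-Young: `a ↦ exp a - 1` is the convex conjugate of `klFun`. For `r > 0` this is `exp b ≥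
b + 1` at `b = a - log r`. -/
theorem mul_sub_exp_le_klFun {r : ℝ} (hr : 0 ≤ r) (a : ℝ) :
    r * a - (Real.exp a - 1) ≤ klFun r := by
  rw [klFun_apply]
  rcases hr.eq_or_lt with rfl | hr
  · simp [Real.exp_nonneg]
  · have h := Real.add_one_le_exp (a - Real.log r)
    rw [Real.exp_sub, Real.exp_log hr, le_div_iff₀ hr] at h
    linarith

/-- The integrated Fenchel-Young inequality, applied to the density `dμ/dν`; only the case of finite
divergence needs an argument. -/
theorem ofReal_integral_sub_le_klDiv {X : Type*} [MeasurableSpace X] {μ ν : Measure X}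
    [IsFiniteMeasure μ] [IsFiniteMeasure ν] {f : X → ℝ} (hf : Measurable f) {M : ℝ}
    (hM : ∀ x, |f x| ≤ M) :
    ENNReal.ofReal (∫ x, f x ∂μ - ∫ x, (Real.exp (f x) - 1) ∂ν) ≤ klDiv μ ν := by
  by_cases hkl : klDiv μ ν = ∞
  · simp [hkl]
  obtain ⟨hac, hint⟩ := klDiv_ne_top_iff.1 hkl
  refine ENNReal.ofReal_le_of_le_toReal ?_
  rw [toReal_klDiv_eq_integral_klFun hac, ← integral_rnDeriv_smul hac, ← integral_sub]
  · refine integral_mono (Integrable.sub ?_ ?_) ((integrable_klFun_rnDeriv_iff hac).2 hint)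
      fun x => mul_sub_exp_le_klFun ENNReal.toReal_nonneg _
    · exact (integrable_rnDeriv_smul_iff hac).2 (integrable_of_abs_le hf hM)
    · exact (integrable_of_abs_le (M := Real.exp M) (by fun_prop) fun x => by
        rw [Real.abs_exp]; exact Real.exp_le_exp.2 (abs_le.1 (hM x)).2).sub (integrable_const _)
  · exact (integrable_rnDeriv_smul_iff hac).2 (integrable_of_abs_le hf hM)
  · exact (integrable_of_abs_le (M := Real.exp M) (by fun_prop) fun x => by
      rw [Real.abs_exp]; exact Real.exp_le_exp.2 (abs_le.1 (hM x)).2).sub (integrable_const _)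

theorem negPart_eq_zero_of_nonneg {X : Type*} [MeasurableSpace X] {μ : SignedMeasure X}
    (h : 0 ≤ μ) : μ.toJordanDecomposition.negPart = 0 := by
  obtain ⟨S, hS, -, -, hp, hn⟩ := μ.toJordanDecomposition.exists_compl_positive_negative
  have h1 := μ.apply_eq_posPart_real_sub_negPart_real hS
  have h2 : 0 ≤ μ S := h S hS
  rw [measureReal_def, hp] at h1
  have h3 : μ.toJordanDecomposition.negPart.real S = 0 :=
    le_antisymm (by simp at h1; linarith) measureReal_nonneg
  rw [measureReal_eq_zero_iff] at h3
  rw [← Measure.measure_univ_eq_zero, ← measure_add_measure_compl hS, h3, hn, add_zero]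

theorem ofReal_pairing_sub_le_signedEnt {X : Type*} [MeasurableSpace X] {μ : SignedMeasure X}
    {ν : Measure X} [IsFiniteMeasure ν] {f : X → ℝ} (hf : Measurable f) {M : ℝ}
    (hM : ∀ x, |f x| ≤ M) :
    ENNReal.ofReal (pairing f μ - ∫ x, (Real.exp (f x) - 1) ∂ν) ≤ signedEnt μ ν := by
  unfold signedEnt
  split_ifs with h
  · rw [pairing_eq_jordan hf hM, negPart_eq_zero_of_nonneg h]
    simpa using ofReal_integral_sub_le_klDiv hf hM
  · exact le_top

theorem abs_vel_toReal (v : Vel) : |v.toReal| = 1 := by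
  rcases Int.units_eq_one_or v with rfl | rfl <;> simp [Vel.toReal]

/-- Convex duality for the Lagrangian: the constraint on `j¹` makes the `f`-terms cancel exactly,
and entropy duality handles `j²`. All later bounds arise from choices of `f` and `g` here. -/
theorem ofReal_le_lagrangian {α V : ℝ} (hα : 0 < α) (σ : ProbabilityMeasure Phase)
    (j : SignedMeasure Phase × SignedMeasure Phase) {f g : Phase → ℝ} (hf : Measurable f)
    {M N : ℝ} (hM : ∀ x, |f x| ≤ M) (hg : Measurable g) (hN : ∀ x, |g x| ≤ N) :
    ENNReal.ofReal (pairing f j.1 + pairing g j.2 -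
      (∫ p, f p * (V * p.2.toReal) ∂(σ : Measure Phase) +
        V ^ 2 / (2 * α) * ∫ p, (Real.exp (g p) - 1) ∂(σ : Measure Phase))) ≤
      lagrangian α V σ j := by
  unfold lagrangian
  split_ifs with h
  · rw [h, pairing_withDensityᵥ hf hM (N := |V|) (by fun_prop)
      (fun x => by rw [abs_mul, abs_vel_toReal, mul_one])]
    have hfin : IsFiniteMeasure (ENNReal.ofReal (V ^ 2 / (2 * α)) • (σ : Measure Phase)) :=
      Measure.smul_finite _ ENNReal.ofReal_ne_top
    refine le_trans (le_of_eq ?_) (ofReal_pairing_sub_le_signedEnt hg hN)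
    rw [integral_smul_measure, ENNReal.toReal_ofReal (by positivity), smul_eq_mul]
    congr 1
    ring
  · exact le_top

end Entropy

/-! ### Lebesgue measure on time intervals -/

section Time

theorem map_lebOn {I : Set ℝ} (hI : MeasurableSet I) :
    (lebOn I).map Subtype.val = (volume : Measure ℝ).restrict I :=
  (MeasurableEmbedding.subtype_coe hI).map_comap _ |>.trans (by rw [Subtype.range_coe])

theorem lebOn_apply {I : Set ℝ} (hI : MeasurableSet I) (A : Set I) :
    lebOn I A = volume (Subtype.val '' A) :=
  (MeasurableEmbedding.subtype_coe hI).comap_apply _ _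

theorem lebOn_univ {I : Set ℝ} (hI : MeasurableSet I) : lebOn I univ = volume I := by
  rw [lebOn_apply hI]; simp

instance isFiniteMeasure_lebOn_Ioo (a b : ℝ) : IsFiniteMeasure (lebOn (Ioo a b)) :=
  ⟨by rw [lebOn_univ measurableSet_Ioo]; simp⟩

instance isFiniteMeasure_lebOn_Icc (a b : ℝ) : IsFiniteMeasure (lebOn (Icc a b)) :=
  ⟨by rw [lebOn_univ measurableSet_Icc]; simp⟩

/-- The open time interval `(s, t)` as a subset of `(0, T)`. -/
def between {T : ℝ} (s t : Icc (0 : ℝ) T) : Set (Ioo (0 : ℝ) T) :=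
  {r : Ioo (0 : ℝ) T | (s : ℝ) < r ∧ (r : ℝ) < t}

variable {T : ℝ}

theorem measurableSet_between (s t : Icc (0 : ℝ) T) : MeasurableSet (between s t) :=
  measurable_subtype_coe (measurableSet_Ioo (a := (s : ℝ)) (b := (t : ℝ)))

theorem lebOn_between (s t : Icc (0 : ℝ) T) :
    lebOn (Ioo 0 T) (between s t) = ENNReal.ofReal (t - s) := by
  rw [lebOn_apply measurableSet_Ioo, ← Real.volume_Ioo]
  congr 1
  ext r
  constructor
  · rintro ⟨r, h, rfl⟩; exact h
  · rintro ⟨h1, h2⟩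
    exact ⟨⟨r, s.2.1.trans_lt h1, h2.trans_le t.2.2⟩, ⟨h1, h2⟩, rfl⟩

theorem lebOn_real_between {s t : Icc (0 : ℝ) T} (hst : s ≤ t) :
    (lebOn (Ioo 0 T)).real (between s t) = t - s := by
  rw [measureReal_def, lebOn_between, ENNReal.toReal_ofReal (sub_nonneg.2 hst)]

theorem disjoint_between (s t u : Icc (0 : ℝ) T) : Disjoint (between s t) (between t u) := by
  rw [Set.disjoint_left]
  rintro r h1 h2
  exact lt_asymm h1.2 h2.1

theorem between_union_ae_eq {s t u : Icc (0 : ℝ) T} (hst : s ≤ t) (htu : t ≤ u) :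
    (between s t ∪ between t u : Set _) =ᵐ[lebOn (Ioo 0 T)] between s u := by
  have hsub : between s t ∪ between t u ⊆ between s u := by
    rintro r (h | h)
    · exact ⟨h.1, h.2.trans_le htu⟩
    · exact ⟨lt_of_le_of_lt hst h.1, h.2⟩
  refine ae_eq_of_subset_of_measure_ge hsub ?_
    ((measurableSet_between s t).union (measurableSet_between t u)).nullMeasurableSet
    (measure_ne_top _ _)
  rw [measure_union (disjoint_between s t u) (measurableSet_between t u), lebOn_between,
    lebOn_between, lebOn_between, ← ENNReal.ofReal_add (sub_nonneg.2 hst) (sub_nonneg.2 htu)]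
  simp

theorem setLIntegral_between_add {s t u : Icc (0 : ℝ) T} (hst : s ≤ t) (htu : t ≤ u)
    (f : Ioo (0 : ℝ) T → ℝ≥0∞) :
    ∫⁻ r in between s u, f r ∂(lebOn (Ioo 0 T)) = ∫⁻ r in between s t, f r ∂(lebOn (Ioo 0 T)) +
      ∫⁻ r in between t u, f r ∂(lebOn (Ioo 0 T)) := by
  rw [← setLIntegral_congr (between_union_ae_eq hst htu),
    lintegral_union (measurableSet_between t u) (disjoint_between s t u)]

theorem setIntegral_between_add {s t u : Icc (0 : ℝ) T} (hst : s ≤ t) (htu : t ≤ u)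
    {f : Ioo (0 : ℝ) T → ℝ} (hf : Integrable f (lebOn (Ioo 0 T))) :
    ∫ r in between s u, f r ∂(lebOn (Ioo 0 T)) = ∫ r in between s t, f r ∂(lebOn (Ioo 0 T)) +
      ∫ r in between t u, f r ∂(lebOn (Ioo 0 T)) := by
  rw [← setIntegral_congr_set (between_union_ae_eq hst htu),
    setIntegral_union (disjoint_between s t u) (measurableSet_between t u) hf.integrableOn
      hf.integrableOn]

theorem continuous_toIcc : Continuous (toIcc : Ioo (0 : ℝ) T → Icc (0 : ℝ) T) :=
  Continuous.subtype_mk continuous_subtype_val _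

theorem map_toIcc : (lebOn (Ioo 0 T)).map toIcc = lebOn (Icc 0 T) := by
  have hval : MeasurableEmbedding (Subtype.val : Icc (0 : ℝ) T → ℝ) :=
    MeasurableEmbedding.subtype_coe measurableSet_Icc
  have h : ((lebOn (Ioo 0 T)).map toIcc).map Subtype.val = (lebOn (Icc 0 T)).map Subtype.val := by
    rw [Measure.map_map measurable_subtype_coe continuous_toIcc.measurable,
      map_lebOn measurableSet_Icc, ← restrict_Ioo_eq_restrict_Icc, ← map_lebOn measurableSet_Ioo]
    rfl
  rw [← hval.comap_map (μ := (lebOn (Ioo 0 T)).map toIcc), h, hval.comap_map]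

theorem between_bot_top (hT : 0 < T) :
    between (T := T) ⟨0, left_mem_Icc.2 hT.le⟩ ⟨T, right_mem_Icc.2 hT.le⟩ = univ := by
  exact eq_univ_of_forall fun r => r.2

theorem integrable_comp_toIcc {G : Icc (0 : ℝ) T → ℝ} (hG : Continuous G) :
    Integrable (fun r => G (toIcc r)) (lebOn (Ioo 0 T)) := by
  obtain ⟨M, hM⟩ := (isCompact_range hG).isBounded.exists_norm_le
  exact integrable_of_abs_le (hG.comp continuous_toIcc).measurable fun r => hM _ ⟨_, rfl⟩

end Time

/-! ### Consequences of the continuity equation -/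

section ContinuityEquation

variable {T : ℝ}

/-- `ψ'` is the derivative of the function `ψ` on the torus. -/
def HasTorusDeriv (ψ ψ' : Torus → ℝ) : Prop :=
  ∀ y : ℝ, HasDerivAt (fun h : ℝ => ψ (h : Torus)) (ψ' (y : Torus)) y

theorem exists_abs_le_of_continuous {X : Type*} [TopologicalSpace X] [CompactSpace X] {f : X → ℝ}
    (hf : Continuous f) : ∃ M, 0 ≤ M ∧ ∀ x, |f x| ≤ M := by
  obtain ⟨M, hM⟩ := (isCompact_range hf).isBounded.exists_norm_le
  exact ⟨|M|, abs_nonneg _, fun x => (hM _ ⟨x, rfl⟩).trans (le_abs_self M)⟩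

theorem continuous_uncurry_vel {ψ : Vel → Torus → ℝ} (hψ : ∀ v, Continuous (ψ v)) :
    Continuous fun p : Phase => ψ p.2 p.1 := by
  rw [continuous_prod_of_discrete_right]
  exact hψ

theorem isC10_of_hasTorusDeriv {ψ ψ' : Vel → Torus → ℝ} (h : ∀ v, HasTorusDeriv (ψ v) (ψ' v))
    (hψ' : ∀ v, Continuous (ψ' v)) : IsC10 fun p => ψ p.2 p.1 := by
  intro v
  rw [contDiff_one_iff_deriv]
  refine ⟨fun y => (h v y).differentiableAt, ?_⟩
  have : deriv (fun y : ℝ => ψ v (y : Torus)) = fun y : ℝ => ψ' v (y : Torus) :=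
    funext fun y => (h v y).deriv
  change Continuous (deriv (fun y : ℝ => ψ v (y : Torus)))
  rw [this]
  exact (hψ' v).comp (AddCircle.continuous_mk' 1)

theorem dx_of_hasTorusDeriv {ψ ψ' : Vel → Torus → ℝ} (h : ∀ v, HasTorusDeriv (ψ v) (ψ' v)) :
    dx (fun p => ψ p.2 p.1) = fun p => ψ' p.2 p.1 := by
  ext ⟨x, v⟩
  induction x using QuotientAddGroup.induction_on with
  | H y =>
    have h1 : HasDerivAt (fun h : ℝ => ψ v ((y + h : ℝ) : Torus)) (ψ' v ((y : ℝ) : Torus)) 0 := by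
      have := (h v (y + 0)).comp_const_add y 0
      simpa using this
    simp only [dx]
    rw [← h1.deriv]
    congr 1

theorem continuous_integral_curve (σ : Curve T) {f : Phase → ℝ} (hf : Continuous f) :
    Continuous fun t => ∫ p, f p ∂(σ t : Measure Phase) := by
  have := ProbabilityMeasure.continuous_integral_boundedContinuousFunction
    (BoundedContinuousFunction.mkOfCompact ⟨f, hf⟩)
  exact this.comp σ.continuous

/-- The generator of the Kac process in Hamilton-Jacobi form, integrated against a measure. -/
def hamiltonian (α V : ℝ) (σ : ProbabilityMeasure Phase) (f g : Phase → ℝ) : ℝ :=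
  ∫ p, f p * (V * p.2.toReal) ∂(σ : Measure Phase) +
    V ^ 2 / (2 * α) * ∫ p, (Real.exp (g p) - 1) ∂(σ : Measure Phase)

theorem continuous_toReal : Continuous Vel.toReal := continuous_of_discreteTopology

theorem continuous_hamiltonian (α V : ℝ) (σ : Curve T) {f g : Phase → ℝ} (hf : Continuous f)
    (hg : Continuous g) : Continuous fun t => hamiltonian α V (σ t) f g := by
  refine (continuous_integral_curve σ ?_).add
    (continuous_const.mul (continuous_integral_curve σ ?_))
  · exact hf.mul (continuous_const.mul (continuous_toReal.comp continuous_snd))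
  · fun_prop

theorem continuous_flipVel : Continuous flipVel :=
  continuous_fst.prodMk ((continuous_of_discreteTopology (f := fun v : Vel => -v)).comp
    continuous_snd)

/-- Dropping the negative part of `f` leaves a monotonicity of lower integrals, so `g` need not be
measurable; this matters because `g` will be the Lagrangian along a curve. -/
theorem integral_le_toReal_lintegral {X : Type*} [MeasurableSpace X] {μ : Measure X} {f : X → ℝ}
    (hf : Integrable f μ) {g : X → ℝ≥0∞} (hfg : ∀ x, ENNReal.ofReal (f x) ≤ g x)
    (hg : ∫⁻ x, g x ∂μ ≠ ∞) : ∫ x, f x ∂μ ≤ (∫⁻ x, g x ∂μ).toReal := by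
  rw [integral_eq_lintegral_pos_part_sub_lintegral_neg_part hf]
  exact (sub_le_self _ ENNReal.toReal_nonneg).trans (ENNReal.toReal_mono hg (lintegral_mono hfg))

/-- The weak equation rewrites the increment as flux pairings, and duality eliminates the flux in
favour of Lagrangian plus Hamiltonian. -/
theorem integral_sub_integral_le {α V : ℝ} (hα : 0 < α) {σ : Curve T} {j : Flux T}
    (h : IsCE σ j) (hfin : ∫⁻ r, lagrangian α V (σ (toIcc r)) (j r) ∂(lebOn (Ioo 0 T)) ≠ ∞)
    {ψ ψ' : Vel → Torus → ℝ} (hψ : ∀ v, Continuous (ψ v)) (hd : ∀ v, HasTorusDeriv (ψ v) (ψ' v))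
    (hψ' : ∀ v, Continuous (ψ' v)) {s t : Icc (0 : ℝ) T} (hst : s ≤ t) :
    ∫ p, ψ p.2 p.1 ∂(σ t : Measure Phase) - ∫ p, ψ p.2 p.1 ∂(σ s : Measure Phase) ≤
      (∫⁻ r in between s t, lagrangian α V (σ (toIcc r)) (j r) ∂(lebOn (Ioo 0 T))).toReal +
      ∫ r in between s t, hamiltonian α V (σ (toIcc r)) (fun p => ψ' p.2 p.1)
        (dv fun p => ψ p.2 p.1) ∂(lebOn (Ioo 0 T)) := by
  have hf : Continuous fun p : Phase => ψ' p.2 p.1 := continuous_uncurry_vel hψ'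
  have hg : Continuous (dv fun p => ψ p.2 p.1) :=
    ((continuous_uncurry_vel hψ).comp continuous_flipVel).sub (continuous_uncurry_vel hψ)
  obtain ⟨M, hM0, hM⟩ := exists_abs_le_of_continuous hf
  obtain ⟨N, hN0, hN⟩ := exists_abs_le_of_continuous hg
  have hG := integrable_comp_toIcc (continuous_hamiltonian α V σ hf hg)
  have hp1 : Integrable (fun r => pairing (fun p : Phase => ψ' p.2 p.1) (j r).1)
      (lebOn (Ioo 0 T)) :=
    h.fst.integrable_pairing (F := fun q : Ioo (0 : ℝ) T × Phase => ψ' q.2.2 q.2.1)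
      (hf.measurable.comp measurable_snd) hM0 fun q => hM q.2
  have hp2 : Integrable (fun r => pairing (dv fun p => ψ p.2 p.1) (j r).2)
      (lebOn (Ioo 0 T)) :=
    h.snd.integrable_pairing
      (F := fun q : Ioo (0 : ℝ) T × Phase => dv (fun p => ψ p.2 p.1) q.2)
      (hg.measurable.comp measurable_snd) hN0 fun q => hN q.2
  rw [h.weak _ (isC10_of_hasTorusDeriv hd hψ') s t hst, dx_of_hasTorusDeriv hd,
    ← sub_le_iff_le_add]
  change ∫ r in between s t, _ ∂_ - _ ≤ _
  have hi : Integrable (fun r => pairing (fun p : Phase => ψ' p.2 p.1) (j r).1 +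
      pairing (dv fun p => ψ p.2 p.1) (j r).2 - hamiltonian α V (σ (toIcc r))
        (fun p => ψ' p.2 p.1) (dv fun p => ψ p.2 p.1)) (lebOn (Ioo 0 T)) :=
    (hp1.add hp2).sub hG
  rw [← integral_sub (f := fun r => pairing (fun p : Phase => ψ' p.2 p.1) (j r).1 +
    pairing (dv fun p => ψ p.2 p.1) (j r).2) (hp1.add hp2).integrableOn hG.integrableOn]
  exact integral_le_toReal_lintegral hi.integrableOn
    (fun r => ofReal_le_lagrangian hα _ _ hf.measurable hM hg.measurable hN)
    (ne_top_of_le_ne_top hfin (setLIntegral_le_lintegral _ _))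

end ContinuityEquation

/-! ### Mollification on the torus -/

section Mollification

theorem _root_.Continuous.integrable_of_compactSpace {X : Type*} [TopologicalSpace X]
    [CompactSpace X] [MeasurableSpace X] [OpensMeasurableSpace X] {f : X → ℝ} (hf : Continuous f)
    (μ : Measure X) [IsFiniteMeasure μ] : Integrable f μ := by
  obtain ⟨M, -, hM⟩ := exists_abs_le_of_continuous hf
  exact integrable_of_abs_le hf.measurable hM

instance isProbabilityMeasure_volume_torus : IsProbabilityMeasure (volume : Measure Torus) :=
  ⟨by rw [AddCircle.measure_univ]; simp⟩

theorem HasTorusDeriv.at_add {ψ ψ' : Torus → ℝ} (h : HasTorusDeriv ψ ψ') (x : Torus) (y : ℝ) :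
    HasDerivAt (fun h : ℝ => ψ ((h : Torus) + x)) (ψ' ((y : Torus) + x)) y := by
  induction x using QuotientAddGroup.induction_on with
  | H z => exact (h (y + z)).comp_add_const y z

theorem HasTorusDeriv.integral_eq_zero {ψ ψ' : Torus → ℝ} (h : HasTorusDeriv ψ ψ')
    (hc : Continuous ψ') : ∫ x, ψ' x = 0 := by
  rw [← AddCircle.intervalIntegral_preimage 1 0 ψ',
    intervalIntegral.integral_eq_sub_of_hasDerivAt (fun y _ => h y)]
  · have : ((0 + 1 : ℝ) : Torus) = ((0 : ℝ) : Torus) := by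
      rw [zero_add, AddCircle.coe_zero]; exact AddCircle.coe_period 1
    rw [this, sub_self]
  · exact (hc.comp (AddCircle.continuous_mk' 1)).intervalIntegrable _ _

/-- The convolution of the kernel `p` with the measure `w • μ`. -/
def conv (p w : Torus → ℝ) (μ : Measure Torus) (x : Torus) : ℝ := ∫ y, p (x - y) * w y ∂μ

variable {p p' w : Torus → ℝ} {μ : Measure Torus} [IsFiniteMeasure μ]

theorem continuous_conv (hp : Continuous p) (hw : Continuous w) : Continuous (conv p w μ) := by
  have h : Continuous fun q : Torus × Torus => p (q.1 - q.2) * w q.2 := by fun_prop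
  have := continuous_parametric_integral_of_continuous (μ := μ)
    (f := fun x y => p (x - y) * w y) h isCompact_univ
  simp only [setIntegral_univ] at this
  exact this

theorem hasTorusDeriv_conv (hp : Continuous p) (hp' : Continuous p') (h : HasTorusDeriv p p')
    (hw : Continuous w) : HasTorusDeriv (conv p w μ) (conv p' w μ) := by
  intro y
  obtain ⟨M, -, hM⟩ := exists_abs_le_of_continuous
    (f := fun q : Torus × Torus => p' (q.1 - q.2) * w q.2) (by fun_prop)
  refine (hasDerivAt_integral_of_dominated_loc_of_deriv_le (μ := μ) (bound := fun _ => M)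
    (F := fun (h : ℝ) z => p ((h : Torus) - z) * w z)
    (F' := fun (h : ℝ) z => p' ((h : Torus) - z) * w z) (s := univ) univ_mem
    (Eventually.of_forall fun h => ?_) ?_ ?_ (Eventually.of_forall fun z h _ => hM (h, z))
    (integrable_const M) (Eventually.of_forall fun z s _ => ?_)).2
  · exact (Continuous.integrable_of_compactSpace (by fun_prop) μ).aestronglyMeasurable
  · exact Continuous.integrable_of_compactSpace (by fun_prop) μ
  · exact (Continuous.integrable_of_compactSpace (by fun_prop) μ).aestronglyMeasurable
  · simpa only [sub_eq_add_neg] using (h.at_add (-z) s).mul_const (w z)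

/-- Duality of convolutions with kernels of parity `ε`. -/
theorem integral_mul_conv {ε : ℝ} (hp : Continuous p) (hpar : ∀ x, p (-x) = ε * p x)
    (hw : Continuous w) :
    ∫ x, w x * conv p (fun _ => 1) μ x = ε * ∫ x, conv p w volume x ∂μ := by
  have hint : Integrable (fun q : Torus × Torus => w q.1 * p (q.1 - q.2))
      ((volume : Measure Torus).prod μ) :=
    Continuous.integrable_of_compactSpace (by fun_prop) _
  calc ∫ x, w x * conv p (fun _ => 1) μ x = ∫ x, ∫ y, w x * p (x - y) ∂μ := by
        simp only [conv, mul_one, integral_const_mul]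
    _ = ∫ y, ∫ x, w x * p (x - y) ∂volume ∂μ :=
        integral_integral_swap (f := fun x y => w x * p (x - y)) hint
    _ = ∫ y, ε * conv p w volume y ∂μ := by
        congr 1
        ext y
        change _ = ε * ∫ x, p (y - x) * w x
        rw [← integral_const_mul]
        congr 1
        ext x
        rw [← neg_sub y x, hpar]
        ring
    _ = _ := integral_const_mul _ _

/-- A continuously differentiable symmetric probability kernel on the torus. -/
structure IsMollifier (p p' : Torus → ℝ) : Prop where
  continuous : Continuous p
  continuous_deriv : Continuous p'
  nonneg : ∀ x, 0 ≤ p x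
  even : ∀ x, p (-x) = p x
  integral_eq_one : ∫ x, p x = 1
  hasTorusDeriv : HasTorusDeriv p p'

namespace IsMollifier

variable (hp : IsMollifier p p')
include hp

theorem odd_deriv (x : Torus) : p' (-x) = -1 * p' x := by
  induction x using QuotientAddGroup.induction_on with
  | H y =>
    have h1 := (hp.hasTorusDeriv (-y)).scomp y (hasDerivAt_neg y)
    have h2 := hp.hasTorusDeriv y
    have h3 : ((fun h : ℝ => p (h : Torus)) ∘ Neg.neg) = fun h : ℝ => p (h : Torus) := by
      ext h
      exact hp.even h
    rw [h3] at h1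
    have := h1.unique h2
    change p' ((-y : ℝ) : Torus) = _
    simp only [smul_eq_mul] at this
    linarith

theorem integral_sub (x : Torus) : ∫ y, p (x - y) = 1 := by
  rw [integral_sub_left_eq_self, hp.integral_eq_one]

theorem integral_mul_conv (hw : Continuous w) :
    ∫ x, w x * conv p (fun _ => 1) μ x = ∫ x, conv p w volume x ∂μ := by
  rw [KacDiffusive.integral_mul_conv hp.continuous (ε := 1) (fun x => by rw [hp.even, one_mul]) hw,
    one_mul]

theorem conv_one (x : Torus) : conv p (fun _ => 1) volume x = 1 := by
  simp only [conv, mul_one]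
  exact hp.integral_sub x

theorem integral_conv_one : ∫ x, conv p (fun _ => 1) μ x = μ.real univ := by
  have := hp.integral_mul_conv (μ := μ) (w := fun _ => 1) continuous_const
  simp only [one_mul, hp.conv_one] at this
  simpa using this

theorem integral_conv (hw : Continuous w) : ∫ x, conv p w volume x = ∫ x, w x := by
  rw [← hp.integral_mul_conv hw]
  simp [hp.conv_one]

omit [IsFiniteMeasure μ] in
theorem conv_nonneg (hw : ∀ x, 0 ≤ w x) (x : Torus) : 0 ≤ conv p w μ x :=
  integral_nonneg fun y => mul_nonneg (hp.nonneg _) (hw y)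

theorem conv_mono {w₁ w₂ : Torus → ℝ} (h₁ : Continuous w₁) (h₂ : Continuous w₂)
    (h : ∀ x, w₁ x ≤ w₂ x) (x : Torus) : conv p w₁ μ x ≤ conv p w₂ μ x := by
  have := hp.continuous
  exact integral_mono (Continuous.integrable_of_compactSpace (by fun_prop) μ)
    (Continuous.integrable_of_compactSpace (by fun_prop) μ)
    fun y => mul_le_mul_of_nonneg_left (h y) (hp.nonneg _)

theorem abs_conv_le {M : ℝ} (hM : ∀ x, |w x| ≤ M) (hw : Continuous w) (x : Torus) :
    |conv p w volume x| ≤ M := by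
  have h1 := hp.conv_mono (μ := volume) hw continuous_const (fun x => (abs_le.1 (hM x)).2) x
  have h2 := hp.conv_mono (μ := volume) continuous_const hw (fun x => (abs_le.1 (hM x)).1) x
  have h3 : ∀ c, conv p (fun _ => c) volume x = c := by
    intro c
    have := hp.integral_sub x
    simp [conv, integral_mul_const, this]
  rw [h3] at h1 h2
  exact abs_le.2 ⟨h2, h1⟩

/-- Jensen's inequality for the exponential. -/
theorem exp_conv_le (hw : Continuous w) (x : Torus) :
    Real.exp (conv p w volume x) ≤ conv p (fun y => Real.exp (w y)) volume x := by
  have hpc := hp.continuous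
  set c := conv p w volume x with hc
  -- The tangent line of `exp` at the mean `c`, composed with `w`, averages to `exp c`; Jensen
  -- follows since `exp` lies above it.
  have h1 : conv p (fun y => Real.exp c * (1 - c) + Real.exp c * w y) volume x = Real.exp c := by
    have : ∀ y, p (x - y) * (Real.exp c * (1 - c) + Real.exp c * w y) =
        Real.exp c * (1 - c) * p (x - y) + Real.exp c * (p (x - y) * w y) := fun y => by ring
    simp only [conv, this]
    rw [integral_add, integral_const_mul, integral_const_mul, hp.integral_sub]
    · change _ + _ * c = _
      ring
    · exact Continuous.integrable_of_compactSpace (by fun_prop) _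
    · exact Continuous.integrable_of_compactSpace (by fun_prop) _
  rw [← h1]
  refine hp.conv_mono (by fun_prop) (by fun_prop) (fun y => ?_) x
  have h2 := Real.add_one_le_exp (w y - c)
  rw [Real.exp_sub, le_div_iff₀ (Real.exp_pos c)] at h2
  linarith

end IsMollifier

/-- The profile `(1 + cos (2 π x)) / 2` generating an approximate identity on the torus. -/
def bumpProfile (x : Torus) : ℝ := (1 + (fourier 1 x : ℂ).re) / 2

theorem bumpProfile_coe (y : ℝ) : bumpProfile (y : Torus) = (1 + Real.cos (2 * Real.pi * y)) / 2 := by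
  rw [bumpProfile, fourier_coe_apply]
  congr 2
  rw [← Complex.exp_ofReal_mul_I_re]
  congr 2
  push_cast
  ring

/-- The derivative of `bumpProfile`. -/
def bumpProfileDeriv (x : Torus) : ℝ := -Real.pi * (fourier 1 x : ℂ).im

theorem hasTorusDeriv_bumpProfile : HasTorusDeriv bumpProfile bumpProfileDeriv := by
  intro y
  have h1 : (fun h : ℝ => bumpProfile (h : Torus)) =
      fun h : ℝ => (1 + Real.cos (2 * Real.pi * h)) / 2 := funext bumpProfile_coe
  have h2 : bumpProfileDeriv (y : Torus) = -Real.sin (2 * Real.pi * y) * (2 * Real.pi * 1) / 2 := by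
    rw [bumpProfileDeriv, fourier_coe_apply]
    have : (Complex.exp (2 * Real.pi * Complex.I * (1 : ℤ) * y / (1 : ℝ))).im =
        Real.sin (2 * Real.pi * y) := by
      rw [← Complex.exp_ofReal_mul_I_im]
      congr 2
      push_cast
      ring
    rw [this]
    ring
  rw [h1, h2]
  exact ((((hasDerivAt_id y).const_mul _).cos).const_add 1).div_const 2

theorem continuous_bumpProfile : Continuous bumpProfile := by
  unfold bumpProfile; fun_prop

theorem continuous_bumpProfileDeriv : Continuous bumpProfileDeriv := by
  unfold bumpProfileDeriv; fun_prop

theorem bumpProfile_nonneg (x : Torus) : 0 ≤ bumpProfile x := by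
  induction x using QuotientAddGroup.induction_on with
  | H y =>
    rw [bumpProfile_coe]
    linarith [Real.neg_one_le_cos (2 * Real.pi * y)]

theorem bumpProfile_neg (x : Torus) : bumpProfile (-x) = bumpProfile x := by
  induction x using QuotientAddGroup.induction_on with
  | H y =>
    rw [← AddCircle.coe_neg, bumpProfile_coe, bumpProfile_coe, mul_neg, Real.cos_neg]

theorem bumpProfile_zero : bumpProfile 0 = 1 := by
  simp [bumpProfile]

theorem bumpProfile_lt_one {x : Torus} (hx : x ≠ 0) : bumpProfile x < 1 := by
  induction x using QuotientAddGroup.induction_on with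
  | H y =>
    rw [bumpProfile_coe]
    have : Real.cos (2 * Real.pi * y) ≠ 1 := by
      intro h
      obtain ⟨k, hk⟩ := (Real.cos_eq_one_iff _).1 h
      apply hx
      have : y = k := by
        have := Real.pi_pos
        field_simp at hk
        linarith
      rw [this]
      exact (AddCircle.coe_eq_zero_iff 1).2 ⟨k, by simp⟩
    have := lt_of_le_of_ne (Real.cos_le_one _) this
    linarith

theorem integral_bumpProfile_pow_pos (n : ℕ) : 0 < ∫ x, bumpProfile x ^ n := by
  refine (continuous_bumpProfile.pow n).integral_pos_of_hasCompactSupport_nonneg_nonzero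
    (HasCompactSupport.of_compactSpace _) (fun x => pow_nonneg (bumpProfile_nonneg x) n) (x := 0) ?_
  simp [bumpProfile_zero]

/-- The approximate identity obtained by normalizing the powers of `bumpProfile`. -/
def bump (n : ℕ) (x : Torus) : ℝ := (∫ y, bumpProfile y ^ n)⁻¹ * bumpProfile x ^ n

/-- The derivative of `bump n`. -/
def bumpDeriv (n : ℕ) (x : Torus) : ℝ :=
  (∫ y, bumpProfile y ^ n)⁻¹ * (n * bumpProfile x ^ (n - 1) * bumpProfileDeriv x)

theorem isMollifier_bump (n : ℕ) : IsMollifier (bump n) (bumpDeriv n) where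
  continuous := continuous_const.mul (continuous_bumpProfile.pow n)
  continuous_deriv := continuous_const.mul
    ((continuous_const.mul (continuous_bumpProfile.pow _)).mul continuous_bumpProfileDeriv)
  nonneg x := mul_nonneg (inv_nonneg.2 (integral_bumpProfile_pow_pos n).le)
    (pow_nonneg (bumpProfile_nonneg x) n)
  even x := by simp [bump, bumpProfile_neg]
  integral_eq_one := by
    simp only [bump]
    rw [integral_const_mul, inv_mul_cancel₀ (integral_bumpProfile_pow_pos n).ne']
  hasTorusDeriv y := ((hasTorusDeriv_bumpProfile y).pow n).const_mul _

/-- Normalized powers of a nonnegative continuous function concentrate at its unique maximum, here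
`0`. -/
theorem tendsto_conv_bump {w : Torus → ℝ} (hw : Continuous w) (x : Torus) :
    Tendsto (fun n => conv (bump n) w volume x) atTop (𝓝 (w x)) := by
  have h := tendsto_setIntegral_pow_smul_of_unique_maximum_of_isCompact_of_continuousOn
    (μ := (volume : Measure Torus)) (s := univ) (x₀ := 0) (c := bumpProfile)
    (g := fun y => w (x - y)) isCompact_univ continuous_bumpProfile.continuousOn
    (fun y _ hy => by rw [bumpProfile_zero]; exact bumpProfile_lt_one hy)
    (fun y _ => bumpProfile_nonneg y) (by rw [bumpProfile_zero]; exact one_pos) (by simp)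
    (by fun_prop)
  simp only [setIntegral_univ, sub_zero, smul_eq_mul] at h
  refine h.congr fun n => ?_
  have h1 : conv (bump n) w volume x =
      ∫ y, (∫ z, bumpProfile z ^ n)⁻¹ * (bumpProfile y ^ n * w (x - y)) := by
    rw [← integral_sub_left_eq_self _ volume x]
    simp only [conv, bump, sub_sub_cancel, mul_assoc]
  rw [h1, integral_const_mul]

end Mollification

/-! ### Mollified densities and their entropy -/

section Density

/-- The slice `μ(dx, v)` of a measure on the phase space. -/
def velMeasure (μ : Measure Phase) (v : Vel) : Measure Torus :=
  (μ.restrict (Prod.snd ⁻¹' {v})).map Prod.fst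

instance isFiniteMeasure_velMeasure (μ : Measure Phase) [IsFiniteMeasure μ] (v : Vel) :
    IsFiniteMeasure (velMeasure μ v) := by
  unfold velMeasure; infer_instance

theorem measurableSet_snd_preimage (v : Vel) :
    MeasurableSet (Prod.snd ⁻¹' {v} : Set Phase) :=
  measurable_snd (measurableSet_singleton v)

theorem integral_velMeasure (μ : Measure Phase) (v : Vel) {f : Torus → ℝ} (hf : Measurable f) :
    ∫ x, f x ∂(velMeasure μ v) = ∫ p in Prod.snd ⁻¹' {v}, f p.1 ∂μ := by
  rw [velMeasure, integral_map measurable_fst.aemeasurable hf.aestronglyMeasurable]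

theorem sum_vel {M : Type*} [AddCommMonoid M] (f : Vel → M) : ∑ v, f v = f 1 + f (-1) := by
  have : (Finset.univ : Finset Vel) = {1, -1} := by decide
  rw [this, Finset.sum_pair (by decide)]

theorem integral_eq_sum_velMeasure (μ : Measure Phase) [IsFiniteMeasure μ] {f : Vel → Torus → ℝ}
    (hf : ∀ v, Continuous (f v)) :
    ∫ p, f p.2 p.1 ∂μ = ∑ v, ∫ x, f v x ∂(velMeasure μ v) := by
  have h : ∀ v, ∫ x, f v x ∂(velMeasure μ v) =
      ∫ p, (Prod.snd ⁻¹' {v}).indicator (fun p : Phase => f p.2 p.1) p ∂μ := by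
    intro v
    rw [integral_velMeasure μ v (hf v).measurable, integral_indicator (measurableSet_snd_preimage v)]
    refine setIntegral_congr_fun (measurableSet_snd_preimage v) fun p hp => ?_
    have : p.2 = v := hp
    change f v p.1 = f p.2 p.1
    rw [this]
  rw [Finset.sum_congr rfl fun v _ => h v, ← integral_finsetSum]
  · congr 1
    ext p
    rw [Finset.sum_eq_single p.2]
    · exact (indicator_of_mem (s := Prod.snd ⁻¹' {p.2}) (a := p) rfl
        fun q : Phase => f q.2 q.1).symm
    · exact fun v _ hv => indicator_of_notMem (s := Prod.snd ⁻¹' {v}) (a := p)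
        (fun h => hv h.symm) fun q : Phase => f q.2 q.1
    · exact fun h => absurd (Finset.mem_univ _) h
  · intro v _
    exact ((continuous_uncurry_vel hf).integrable_of_compactSpace μ).indicator
      (measurableSet_snd_preimage v)

theorem velMeasure_real_univ_le (s : ProbabilityMeasure Phase) (v : Vel) :
    (velMeasure s v).real univ ≤ 1 := by
  rw [velMeasure, measureReal_def, Measure.map_apply measurable_fst MeasurableSet.univ]
  exact ENNReal.toReal_mono ENNReal.one_ne_top ((Measure.restrict_apply_le _ _).trans prob_le_one)

theorem sum_velMeasure_real_univ (s : ProbabilityMeasure Phase) :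
    ∑ v, (velMeasure s v).real univ = 1 := by
  have := integral_eq_sum_velMeasure (s : Measure Phase) (f := fun _ _ => 1)
    (fun _ => continuous_const)
  simpa using this.symm

/-- The density of the mollified slices of a measure on the phase space. -/
def den (p : Torus → ℝ) (s : ProbabilityMeasure Phase) (v : Vel) : Torus → ℝ :=
  conv p (fun _ => 1) (velMeasure s v)

/-- The mollified densities, shifted to be bounded away from zero. -/
def denShift (p : Torus → ℝ) (s : ProbabilityMeasure Phase) (v : Vel) (x : Torus) : ℝ :=
  den p s v x + 1 / 2

/-- The logarithm of the shifted mollified densities. -/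
def logDen (p : Torus → ℝ) (s : ProbabilityMeasure Phase) (v : Vel) (x : Torus) : ℝ :=
  Real.log (denShift p s v x)

/-- The entropy of the shifted mollified densities. -/
def entropy (p : Torus → ℝ) (s : ProbabilityMeasure Phase) : ℝ :=
  ∑ v, ∫ x, denShift p s v x * logDen p s v x

/-- The Fisher information in the velocity variable of the shifted mollified densities. -/
def fisher (p : Torus → ℝ) (s : ProbabilityMeasure Phase) : ℝ :=
  ∫ x, (√(denShift p s 1 x) - √(denShift p s (-1) x)) ^ 2

variable {p p' : Torus → ℝ} (hp : IsMollifier p p') (s : ProbabilityMeasure Phase)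

theorem continuous_den {q : Torus → ℝ} (hq : Continuous q) (s : ProbabilityMeasure Phase)
    (v : Vel) : Continuous (den q s v) :=
  continuous_conv hq continuous_const

namespace IsMollifier

include hp

theorem den_nonneg (v : Vel) (x : Torus) : 0 ≤ den p s v x :=
  hp.conv_nonneg (fun _ => zero_le_one) x

theorem half_le_denShift (v : Vel) (x : Torus) : 1 / 2 ≤ denShift p s v x := by
  have := hp.den_nonneg s v x
  unfold denShift; linarith

theorem denShift_pos (v : Vel) (x : Torus) : 0 < denShift p s v x :=
  lt_of_lt_of_le (by norm_num) (hp.half_le_denShift s v x)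

theorem continuous_denShift (v : Vel) : Continuous (denShift p s v) :=
  (continuous_den hp.continuous s v).add continuous_const

theorem continuous_logDen (v : Vel) : Continuous (logDen p s v) :=
  (hp.continuous_denShift s v).log fun x => (hp.denShift_pos s v x).ne'

theorem sum_integral_den : ∑ v, ∫ x, den p s v x = 1 := by
  exact (Finset.sum_congr rfl fun v _ => hp.integral_conv_one).trans (sum_velMeasure_real_univ s)

/-- The mass is `1` from the probability measure and `1/2` from each velocity. Equivalently,
`denShift` is the density with respect to `π` of the average of the mollified measure and `π`. -/
theorem sum_integral_denShift : ∑ v, ∫ x, denShift p s v x = 2 := by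
  have h : ∀ v, ∫ x, denShift p s v x = (∫ x, den p s v x) + 1 / 2 := by
    intro v
    unfold denShift
    rw [integral_add ((continuous_den hp.continuous s v).integrable_of_compactSpace _)
      (integrable_const _)]
    simp
  simp_rw [h]
  rw [Finset.sum_add_distrib, hp.sum_integral_den]
  simp
  norm_num

theorem denShift_le {B : ℝ} (hB : ∀ x, |p x| ≤ B) (v : Vel) (x : Torus) :
    denShift p s v x ≤ B + 1 / 2 := by
  have hB0 : 0 ≤ B := (abs_nonneg _).trans (hB 0)
  have := hp.continuous
  have h1 : den p s v x ≤ ∫ _, B ∂(velMeasure s v) :=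
    integral_mono (Continuous.integrable_of_compactSpace (by fun_prop) _) (integrable_const _)
      fun y => by rw [mul_one]; exact (abs_le.1 (hB _)).2
  rw [integral_const, smul_eq_mul] at h1
  have := mul_le_of_le_one_left hB0 (velMeasure_real_univ_le s v)
  unfold denShift; linarith

theorem abs_logDen_le {B : ℝ} (hB : ∀ x, |p x| ≤ B) (v : Vel) (x : Torus) :
    |logDen p s v x| ≤ B + 1 := by
  have h1 := hp.denShift_le s hB v x
  have h2 := hp.half_le_denShift s v x
  have h3 := Real.log_le_sub_one_of_pos (hp.denShift_pos s v x)
  have hB0 : 0 ≤ B := (abs_nonneg _).trans (hB 0)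
  have h4 := Real.one_sub_inv_le_log_of_pos (hp.denShift_pos s v x)
  have h5 : (denShift p s v x)⁻¹ ≤ 2 := by
    rw [inv_le_comm₀ (hp.denShift_pos s v x) two_pos]; linarith
  unfold logDen
  rw [abs_le]
  constructor <;> linarith

theorem hasTorusDeriv_den (v : Vel) : HasTorusDeriv (den p s v) (den p' s v) :=
  hasTorusDeriv_conv hp.continuous hp.continuous_deriv hp.hasTorusDeriv continuous_const

/-- With `u = denShift`, the integrand `log u · u'` is the derivative of the periodic function `u
log u - u`. Hence transport does not change the entropy. -/
theorem integral_logDen_mul_deriv (v : Vel) : ∫ x, logDen p s v x * den p' s v x = 0 := by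
  have h : HasTorusDeriv (fun x => denShift p s v x * logDen p s v x - denShift p s v x)
      (fun x => logDen p s v x * den p' s v x) := by
    intro y
    have h1 : HasDerivAt (fun h : ℝ => denShift p s v (h : Torus)) (den p' s v y) y :=
      (hp.hasTorusDeriv_den s v y).add_const _
    have h2 := h1.log (hp.denShift_pos s v y).ne'
    have h3 := (h1.mul h2).sub h1
    refine h3.congr_deriv ?_
    have := (hp.denShift_pos s v y).ne'
    unfold logDen
    field_simp
    ring
  exact h.integral_eq_zero ((hp.continuous_logDen s v).mul
    (continuous_den hp.continuous_deriv s v))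

/-- The convex function `u log u` lies above its tangent at the density of `s`; the constant part of
the slope drops out since the masses agree, and the mollifier moves onto the logarithm by duality.
-/
theorem entropy_sub_le (r : ProbabilityMeasure Phase) :
    entropy p s - entropy p r ≤
      ∫ q, conv p (logDen p s q.2) volume q.1 ∂(s : Measure Phase) -
      ∫ q, conv p (logDen p s q.2) volume q.1 ∂(r : Measure Phase) := by
  have hl := hp.continuous_logDen s
  have h1 : ∀ m : ProbabilityMeasure Phase,
      ∫ q, conv p (logDen p s q.2) volume q.1 ∂(m : Measure Phase) =
        ∑ v, ∫ x, logDen p s v x * den p m v x := by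
    intro m
    rw [integral_eq_sum_velMeasure (m : Measure Phase) (f := fun v => conv p (logDen p s v) volume)
      (fun v => continuous_conv hp.continuous (hl v))]
    exact Finset.sum_congr rfl fun v _ => (hp.integral_mul_conv (hl v)).symm
  have h2 : ∀ v x, denShift p s v x * logDen p s v x - denShift p r v x * logDen p r v x ≤
      logDen p s v x * den p s v x - logDen p s v x * den p r v x +
        (den p s v x - den p r v x) := by
    intro v x
    have ha := hp.denShift_pos s v x
    have hb := hp.denShift_pos r v x
    have := Real.log_le_sub_one_of_pos (div_pos ha hb)
    rw [Real.log_div ha.ne' hb.ne', le_sub_iff_add_le, le_div_iff₀ hb] at this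
    have e1 : den p s v x = denShift p s v x - 1 / 2 := by simp [denShift]
    have e2 : den p r v x = denShift p r v x - 1 / 2 := by simp [denShift]
    unfold logDen
    rw [e1, e2]
    linarith
  have hi : ∀ {f : Torus → ℝ}, Continuous f → Integrable f volume :=
    fun hf => hf.integrable_of_compactSpace _
  have c1 := hp.continuous_denShift s
  have c2 := hp.continuous_denShift r
  have c3 := hp.continuous_logDen r
  have c4 := continuous_den hp.continuous s
  have c5 := continuous_den hp.continuous r
  have h3 : ∀ v, (∫ x, denShift p s v x * logDen p s v x) -
      (∫ x, denShift p r v x * logDen p r v x) ≤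
      (∫ x, logDen p s v x * den p s v x) - (∫ x, logDen p s v x * den p r v x) +
        ((∫ x, den p s v x) - ∫ x, den p r v x) := by
    intro v
    have := hl v
    have := c1 v
    have := c2 v
    have := c3 v
    have := c4 v
    have := c5 v
    rw [← MeasureTheory.integral_sub (hi (by fun_prop)) (hi (by fun_prop)),
      ← MeasureTheory.integral_sub (hi (by fun_prop)) (hi (by fun_prop)),
      ← MeasureTheory.integral_sub (hi (by fun_prop)) (hi (by fun_prop)),
      ← integral_add (hi (by fun_prop)) (hi (by fun_prop))]
    exact integral_mono (hi (by fun_prop)) (hi (by fun_prop)) (h2 v)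
  have h4 := Finset.sum_le_sum fun v (_ : v ∈ (Finset.univ : Finset Vel)) => h3 v
  simp only [Finset.sum_add_distrib, Finset.sum_sub_distrib, hp.sum_integral_den] at h4
  rw [h1, h1, entropy, entropy]
  linarith

/-- The exponentiated half velocity gradient of the logarithmic densities. -/
theorem exp_half_sub_logDen_mul (v : Vel) (x : Torus) :
    Real.exp (1 / 2 * (logDen p s (-v) x - logDen p s v x)) * denShift p s v x =
      √(denShift p s 1 x) * √(denShift p s (-1) x) := by
  have h : ∀ w, denShift p s w x = Real.exp (logDen p s w x) := fun w =>
    (Real.exp_log (hp.denShift_pos s w x)).symm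
  rw [h v, h 1, h (-1), ← Real.exp_half, ← Real.exp_half, ← Real.exp_add, ← Real.exp_add]
  congr 1
  rcases Int.units_eq_one_or v with rfl | rfl
  · ring
  · rw [neg_neg]; ring

/-- With the shifted densities in place of `den`, the left side is `2 ∫ √(u₁ u₋₁) = 2 - F`. Removing
the shift `1/2` subtracts half the integral of a sum of reciprocal exponentials, which is at least
`1`. -/
theorem sum_integral_exp_mul_den_le :
    ∑ v, ∫ x, Real.exp (1 / 2 * (logDen p s (-v) x - logDen p s v x)) * den p s v x ≤
      1 - fisher p s := by
  have hl := hp.continuous_logDen s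
  have hd := hp.continuous_denShift s
  have hi : ∀ {f : Torus → ℝ}, Continuous f → Integrable f volume :=
    fun hf => hf.integrable_of_compactSpace _
  have hden : ∀ v, Continuous (den p s v) := continuous_den hp.continuous s
  have hsum := hp.sum_integral_denShift s
  rw [sum_vel] at hsum ⊢
  rw [neg_neg]
  rw [← integral_add (hi (hd 1)) (hi (hd (-1)))] at hsum
  have hm1 := hl 1
  have hm2 := hl (-1)
  have h3 := hden 1
  have h4 := hden (-1)
  have h5 := hd 1
  have h6 := hd (-1)
  rw [← integral_add (hi (by fun_prop)) (hi (by fun_prop)),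
    fisher, le_sub_iff_add_le, ← integral_add
      (hi (by fun_prop)) (hi (by fun_prop))]
  have : (1 : ℝ) = ∫ x, (denShift p s 1 x + denShift p s (-1) x - 1) := by
    rw [MeasureTheory.integral_sub (hi (by fun_prop)) (integrable_const _), hsum]
    simp
    norm_num
  refine le_of_le_of_eq ?_ this.symm
  refine integral_mono (hi (by fun_prop)) (hi (by fun_prop)) fun x => ?_
  have e1 := hp.exp_half_sub_logDen_mul s 1 x
  have e2 := hp.exp_half_sub_logDen_mul s (-1) x
  have d1 : den p s 1 x = denShift p s 1 x - 1 / 2 := by simp [denShift]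
  have d2 : den p s (-1) x = denShift p s (-1) x - 1 / 2 := by simp [denShift]
  have q1 := Real.sq_sqrt (hp.denShift_pos s 1 x).le
  have q2 := Real.sq_sqrt (hp.denShift_pos s (-1) x).le
  simp only [neg_neg] at e2
  set a := Real.exp (1 / 2 * (logDen p s (-1) x - logDen p s 1 x)) with ha
  set b := Real.exp (1 / 2 * (logDen p s 1 x - logDen p s (-1) x)) with hb
  -- Together with positivity this gives `a + b ≥ 2`, the gain from the shift.
  have hab : a * b = 1 := by
    rw [ha, hb, ← Real.exp_add, ← Real.exp_zero]
    congr 1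
    ring
  have ha0 : 0 < a := Real.exp_pos _
  have hb0 : 0 < b := Real.exp_pos _
  rw [d1, d2]
  nlinarith [sq_nonneg (a - b)]

/-- If `r = s`, transport vanishes and the jump part gives exactly the dissipation bound. For nearby
`r`, the test function built from `s` is kept and the change of densities enters linearly, which
produces the `ε` term. -/
theorem hamiltonian_le {α V : ℝ} (hα : 0 < α) (hV : 0 ≤ V) (r : ProbabilityMeasure Phase)
    {B ε : ℝ} (hB : ∀ x, |p x| ≤ B) (hε : ∀ v x, |den p r v x - den p s v x| ≤ ε)
    (hε' : ∀ v x, |den p' r v x - den p' s v x| ≤ ε) :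
    hamiltonian α V r (fun q => 1 / 2 * conv p' (logDen p s q.2) volume q.1)
      (dv fun q => 1 / 2 * conv p (logDen p s q.2) volume q.1) ≤
      -(V ^ 2 / (2 * α)) * fisher p s +
        (V * (B + 1) + V ^ 2 / (2 * α) * (2 * Real.exp (B + 1))) * ε := by
  have hl := hp.continuous_logDen s
  have hB0 : 0 ≤ B := (abs_nonneg _).trans (hB 0)
  have hε0 : 0 ≤ ε := (abs_nonneg _).trans (hε 1 0)
  have hi : ∀ {f : Torus → ℝ} {μ : Measure Torus} [IsFiniteMeasure μ],
      Continuous f → Integrable f μ := fun hf => hf.integrable_of_compactSpace _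
  have hden : ∀ m v, Continuous (den p m v) := continuous_den hp.continuous
  have hden' : ∀ m v, Continuous (den p' m v) := continuous_den hp.continuous_deriv
  have hdiff : ∀ (f : Torus → ℝ) (q : Torus → ℝ) (K : ℝ) (v : Vel), Continuous f →
      Continuous q → 0 ≤ K → (∀ x, |f x| ≤ K) → (∀ x, |den q r v x - den q s v x| ≤ ε) →
      |(∫ x, f x * den q r v x) - ∫ x, f x * den q s v x| ≤ K * ε := by
    intro f q K v hf hq hK0 hK hqε
    have cr := continuous_den hq r v
    have cs := continuous_den hq s v
    rw [← MeasureTheory.integral_sub (hi (by fun_prop)) (hi (by fun_prop)), ← Real.norm_eq_abs]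
    have := norm_integral_le_of_norm_le_const (μ := (volume : Measure Torus)) (C := K * ε)
      (f := fun x => f x * den q r v x - f x * den q s v x) (Eventually.of_forall fun x => by
        rw [← mul_sub, Real.norm_eq_abs, abs_mul]
        exact mul_le_mul (hK x) (hqε x) (abs_nonneg _) hK0)
    simpa using this
  have htr : ∫ q, 1 / 2 * conv p' (logDen p s q.2) volume q.1 * (V * q.2.toReal)
      ∂(r : Measure Phase) ≤ V * (B + 1) * ε := by
    rw [integral_eq_sum_velMeasure (r : Measure Phase)
      (f := fun v x => 1 / 2 * conv p' (logDen p s v) volume x * (V * v.toReal))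
      (fun v => (continuous_const.mul (continuous_conv hp.continuous_deriv (hl v))).mul
        continuous_const)]
    -- Duality with the odd kernel `p'` turns this into a pairing of `logDen p s v` with `den p' r
    -- v`, whose counterpart for `s` is zero.
    have h1 : ∀ v : Vel, ∫ x, 1 / 2 * conv p' (logDen p s v) volume x * (V * v.toReal)
        ∂(velMeasure r v) ≤ V * (B + 1) * ε / 2 := by
      intro v
      have h2 := KacDiffusive.integral_mul_conv (μ := velMeasure r v) hp.continuous_deriv
        hp.odd_deriv (hl v)
      have h3 := hdiff (logDen p s v) p' (B + 1) v (hl v) hp.continuous_deriv (by linarith)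
        (hp.abs_logDen_le s hB v) (hε' v)
      rw [hp.integral_logDen_mul_deriv, sub_zero] at h3
      change |∫ x, logDen p s v x * conv p' (fun _ => 1) (velMeasure r v) x| ≤ _ at h3
      rw [h2, neg_one_mul, abs_neg] at h3
      have h4 : ∀ x, 1 / 2 * conv p' (logDen p s v) volume x * (V * v.toReal) =
          V / 2 * v.toReal * conv p' (logDen p s v) volume x := fun x => by ring
      simp_rw [h4]
      rw [integral_const_mul]
      refine (le_abs_self _).trans ?_
      rw [abs_mul, abs_mul, abs_vel_toReal, mul_one, abs_of_nonneg (by positivity)]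
      calc _ ≤ V / 2 * ((B + 1) * ε) := by gcongr
        _ = _ := by ring
    rw [sum_vel]
    linarith [h1 1, h1 (-1)]
  have hjump : ∫ q, (Real.exp (dv (fun q => 1 / 2 * conv p (logDen p s q.2) volume q.1) q) - 1)
      ∂(r : Measure Phase) ≤ -fisher p s + 2 * Real.exp (B + 1) * ε := by
    set E : Vel → Torus → ℝ := fun v x =>
      Real.exp (1 / 2 * (logDen p s (-v) x - logDen p s v x)) with hE
    have hEc : ∀ v, Continuous (E v) := fun v => by
      have := hl v; have := hl (-v); fun_prop
    have hEb : ∀ v x, |E v x| ≤ Real.exp (B + 1) := by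
      intro v x
      rw [Real.abs_exp, Real.exp_le_exp]
      have h1 := abs_le.1 (hp.abs_logDen_le s hB v x)
      have h2 := abs_le.1 (hp.abs_logDen_le s hB (-v) x)
      linarith
    have hcc : ∀ v, Continuous (conv p (logDen p s v) volume) := fun v =>
      continuous_conv hp.continuous (hl v)
    -- The velocity gradient commutes with the convolution, and Jensen takes the convolution out of
    -- the exponential.
    have hle : ∀ q : Phase, Real.exp (dv (fun q => 1 / 2 * conv p (logDen p s q.2) volume q.1) q) ≤
        conv p (E q.2) volume q.1 := by
      rintro ⟨x, v⟩
      have h1 : dv (fun q => 1 / 2 * conv p (logDen p s q.2) volume q.1) (x, v) =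
          conv p (fun y => 1 / 2 * (logDen p s (-v) y - logDen p s v y)) volume x := by
        have := hp.continuous
        have := hl v; have := hl (-v)
        simp only [dv, flipVel, conv]
        rw [← mul_sub, ← MeasureTheory.integral_sub (hi (by fun_prop)) (hi (by fun_prop)),
          ← integral_const_mul]
        congr 1
        ext y
        ring
      rw [h1]
      exact hp.exp_conv_le (by have := hl v; have := hl (-v); fun_prop) x
    have hc1 : Continuous fun q : Phase =>
        Real.exp (dv (fun q => 1 / 2 * conv p (logDen p s q.2) volume q.1) q) := by
      have h0 := continuous_uncurry_vel (ψ := fun v x => 1 / 2 * conv p (logDen p s v) volume x)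
        (fun v => continuous_const.mul (hcc v))
      exact ((h0.comp continuous_flipVel).sub h0).rexp
    have hc2 : ∀ v, Continuous (conv p (E v) volume) := fun v =>
      continuous_conv hp.continuous (hEc v)
    rw [MeasureTheory.integral_sub (hc1.integrable_of_compactSpace _) (integrable_const _)]
    have h2 : ∫ q, Real.exp (dv (fun q => 1 / 2 * conv p (logDen p s q.2) volume q.1) q)
        ∂(r : Measure Phase) ≤ ∑ v, ∫ x, E v x * den p r v x := by
      refine (integral_mono (hc1.integrable_of_compactSpace _)
        ((continuous_uncurry_vel hc2).integrable_of_compactSpace _) hle).trans (le_of_eq ?_)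
      rw [integral_eq_sum_velMeasure (r : Measure Phase) hc2]
      exact Finset.sum_congr rfl fun v _ => (hp.integral_mul_conv (hEc v)).symm
    have h3 := hp.sum_integral_exp_mul_den_le s
    have h4 : ∀ v, ∫ x, E v x * den p r v x ≤ (∫ x, E v x * den p s v x) + Real.exp (B + 1) * ε := by
      intro v
      have := (abs_le.1 (hdiff (E v) p _ v (hEc v) hp.continuous (Real.exp_pos _).le (hEb v)
        (hε v))).2
      linarith
    change ∑ v, ∫ x, E v x * den p s v x ≤ _ at h3
    rw [sum_vel] at h2 h3
    have := h4 1
    have := h4 (-1)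
    simp only [integral_const, smul_eq_mul, mul_one, probReal_univ]
    linarith
  unfold hamiltonian
  have hA : 0 ≤ V ^ 2 / (2 * α) := by positivity
  have := mul_le_mul_of_nonneg_left hjump hA
  linarith

end IsMollifier

end Density

/-! ### Entropy dissipation along the continuity equation -/

section Dissipation

open InformationTheory

variable {p p' : Torus → ℝ}

instance isFiniteMeasure_stat : IsFiniteMeasure stat := by
  have : IsFiniteMeasure ((2 : ℝ≥0∞)⁻¹ • (Measure.count : Measure Vel)) :=
    Measure.smul_finite _ (by simp)
  unfold stat; infer_instance

theorem velMeasure_stat (v : Vel) : velMeasure stat v = (2 : ℝ≥0∞)⁻¹ • volume := by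
  ext A hA
  have hfin : IsFiniteMeasure ((2 : ℝ≥0∞)⁻¹ • (Measure.count : Measure Vel)) :=
    Measure.smul_finite _ (by simp)
  rw [velMeasure, Measure.map_apply measurable_fst hA,
    Measure.restrict_apply (measurable_fst hA), ← Set.prod_eq, stat, Measure.prod_prod]
  simp [mul_comm]

theorem integral_stat {f : Vel → Torus → ℝ} (hf : ∀ v, Continuous (f v)) :
    ∫ q, f q.2 q.1 ∂stat = 1 / 2 * ∑ v, ∫ x, f v x := by
  rw [integral_eq_sum_velMeasure stat hf, Finset.mul_sum]
  refine Finset.sum_congr rfl fun v _ => ?_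
  rw [velMeasure_stat, integral_smul_measure]
  simp

/-- Entropy duality with the mollified `logDen` as test function: its exponential has `π`-integral
at most `1` by Jensen and the mass `2` of the shifted densities. The contribution of the shift to
`entropy` is at most zero, since `log u ≤ u - 1`. -/
theorem IsMollifier.ofReal_entropy_le_klDiv (hp : IsMollifier p p')
    (s : ProbabilityMeasure Phase) :
    ENNReal.ofReal (entropy p s) ≤ klDiv (s : Measure Phase) stat := by
  have hl := hp.continuous_logDen s
  have hd := hp.continuous_denShift s
  have hc : ∀ v, Continuous (conv p (logDen p s v) volume) := fun v =>
    continuous_conv hp.continuous (hl v)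
  have hi : ∀ {f : Torus → ℝ}, Continuous f → Integrable f volume :=
    fun hf => hf.integrable_of_compactSpace _
  obtain ⟨M, -, hM⟩ := exists_abs_le_of_continuous (continuous_uncurry_vel hc)
  refine le_trans (ENNReal.ofReal_le_ofReal ?_)
    (ofReal_integral_sub_le_klDiv (continuous_uncurry_vel hc).measurable hM)
  have h1 : ∫ q, (Real.exp (conv p (logDen p s q.2) volume q.1) - 1) ∂stat ≤ 0 := by
    rw [integral_stat (f := fun v x => Real.exp (conv p (logDen p s v) volume x) - 1)
      (fun v => (hc v).rexp.sub continuous_const)]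
    have : ∀ v, ∫ x, (Real.exp (conv p (logDen p s v) volume x) - 1) ≤
        (∫ x, denShift p s v x) - 1 := by
      intro v
      rw [MeasureTheory.integral_sub (hi (hc v).rexp) (integrable_const _), ← hp.integral_conv (hd v)]
      have h2 : ∀ x, Real.exp (conv p (logDen p s v) volume x) ≤
          conv p (denShift p s v) volume x := by
        intro x
        refine (hp.exp_conv_le (hl v) x).trans (le_of_eq ?_)
        congr 1
        ext y
        exact Real.exp_log (hp.denShift_pos s v y)
      have h3 := integral_mono (hi (hc v).rexp) (hi (continuous_conv hp.continuous (hd v))) h2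
      simp only [integral_const, probReal_univ, smul_eq_mul, mul_one]
      linarith
    have h4 := hp.sum_integral_denShift s
    rw [sum_vel] at h4 ⊢
    linarith [this 1, this (-1)]
  have h2 : entropy p s ≤ ∫ q, conv p (logDen p s q.2) volume q.1 ∂(s : Measure Phase) := by
    rw [integral_eq_sum_velMeasure (s : Measure Phase) hc, entropy]
    have h3 : ∀ v, ∫ x, denShift p s v x * logDen p s v x ≤
        (∫ x, conv p (logDen p s v) volume x ∂(velMeasure s v)) +
          1 / 2 * ((∫ x, denShift p s v x) - 1) := by
      intro v
      have c1 := hl v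
      have c2 := hd v
      have c3 : Continuous (den p s v) := continuous_den hp.continuous s v
      rw [← hp.integral_mul_conv (hl v)]
      change _ ≤ (∫ x, logDen p s v x * den p s v x) + _
      have h4 : (1 : ℝ) = ∫ _ : Torus, (1 : ℝ) := by simp
      have h5 : (∫ x, denShift p s v x) - 1 = ∫ x, (denShift p s v x - 1) := by
        rw [MeasureTheory.integral_sub (hi c2) (integrable_const _)]
        simp
      rw [h5, ← integral_const_mul, ← integral_add (hi (by fun_prop)) (hi (by fun_prop))]
      refine integral_mono (hi (by fun_prop)) (hi (by fun_prop)) fun x => ?_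
      have h6 := Real.log_le_sub_one_of_pos (hp.denShift_pos s v x)
      have e1 : den p s v x = denShift p s v x - 1 / 2 := by simp [denShift]
      change denShift p s v x * logDen p s v x ≤
        logDen p s v x * den p s v x + 1 / 2 * (denShift p s v x - 1)
      change logDen p s v x ≤ _ at h6
      rw [e1]
      linarith
    have h4 := hp.sum_integral_denShift s
    rw [sum_vel] at h4 ⊢
    rw [sum_vel]
    linarith [h3 1, h3 (-1)]
  linarith

theorem IsMollifier.entropy_nonneg (hp : IsMollifier p p') (s : ProbabilityMeasure Phase) :
    0 ≤ entropy p s := by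
  have hi : ∀ {f : Torus → ℝ}, Continuous f → Integrable f volume :=
    fun hf => hf.integrable_of_compactSpace _
  have h : ∀ v, (∫ x, denShift p s v x) - 1 ≤ ∫ x, denShift p s v x * logDen p s v x := by
    intro v
    have c1 := hp.continuous_logDen s v
    have c2 := hp.continuous_denShift s v
    have h5 : (∫ x, denShift p s v x) - 1 = ∫ x, (denShift p s v x - 1) := by
      rw [MeasureTheory.integral_sub (hi c2) (integrable_const _)]
      simp
    rw [h5]
    refine integral_mono (hi (by fun_prop)) (hi (by fun_prop)) fun x => ?_
    have hpos := hp.denShift_pos s v x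
    have h6 := Real.one_sub_inv_le_log_of_pos hpos
    have h7 := mul_le_mul_of_nonneg_left h6 hpos.le
    rw [mul_sub, mul_inv_cancel₀ hpos.ne', mul_one] at h7
    exact h7
  have h4 := hp.sum_integral_denShift s
  rw [entropy]
  rw [sum_vel] at h4 ⊢
  linarith [h 1, h (-1)]

variable {T : ℝ} (σ : Curve T)

/-- On the compact phase space `f y` depends on `y` uniformly, so a change of `y` is controlled for
all probability measures at once, and only the time dependence at fixed `y₀` is left. -/
theorem continuous_integral_curve_param {Y : Type*} [TopologicalSpace Y] {f : Y → Phase → ℝ}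
    (hf : Continuous fun q : Y × Phase => f q.1 q.2) :
    Continuous fun q : Icc (0 : ℝ) T × Y => ∫ z, f q.2 z ∂(σ q.1 : Measure Phase) := by
  have hc : ∀ y, Continuous (f y) := fun y => hf.comp (Continuous.prodMk_right y)
  set g : Y → C(Phase, ℝ) := fun y => ⟨f y, hc y⟩ with hg
  have hcurry : Continuous g := ContinuousMap.continuous_of_continuous_uncurry g hf
  rw [continuous_iff_continuousAt]
  rintro ⟨t₀, y₀⟩
  rw [ContinuousAt, Metric.tendsto_nhds]
  intro ε hε
  have h1 := Metric.tendsto_nhds.1 ((hcurry.tendsto y₀).comp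
    (continuous_snd.tendsto ((t₀, y₀) : Icc (0 : ℝ) T × Y))) (ε / 2) (half_pos hε)
  have h2 := Metric.tendsto_nhds.1 (((continuous_integral_curve σ (hc y₀)).tendsto t₀).comp
    (continuous_fst.tendsto ((t₀, y₀) : Icc (0 : ℝ) T × Y))) (ε / 2) (half_pos hε)
  filter_upwards [h1, h2] with q hq1 hq2
  have h3 : dist (∫ z, f q.2 z ∂(σ q.1 : Measure Phase)) (∫ z, f y₀ z ∂(σ q.1 : Measure Phase)) <
      ε / 2 := by
    rw [Real.dist_eq, ← MeasureTheory.integral_sub ((hc _).integrable_of_compactSpace _)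
      ((hc _).integrable_of_compactSpace _), ← Real.norm_eq_abs]
    refine lt_of_le_of_lt ?_ hq1
    have := norm_integral_le_of_norm_le_const (μ := (σ q.1 : Measure Phase))
      (f := fun z => f q.2 z - f y₀ z) (C := dist (g q.2) (g y₀))
      (Eventually.of_forall fun z => ContinuousMap.dist_apply_le_dist (f := g q.2)
        (g := g y₀) z)
    simpa using this
  simp only [Function.comp_apply] at hq2
  linarith [dist_triangle (∫ z, f q.2 z ∂(σ q.1 : Measure Phase))
    (∫ z, f y₀ z ∂(σ q.1 : Measure Phase)) (∫ z, f y₀ z ∂(σ t₀ : Measure Phase))]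

theorem den_eq_integral {q : Torus → ℝ} (hq : Continuous q) (s : ProbabilityMeasure Phase)
    (v : Vel) (x : Torus) :
    den q s v x = ∫ z : Phase, q (x - z.1) * (if z.2 = v then 1 else 0) ∂(s : Measure Phase) := by
  rw [den, conv, integral_velMeasure _ _ (by fun_prop),
    ← integral_indicator (measurableSet_snd_preimage v)]
  congr 1
  ext z
  by_cases h : z.2 = v <;> simp [h]

theorem continuous_den_curve {q : Torus → ℝ} (hq : Continuous q) (v : Vel) :
    Continuous fun z : Icc (0 : ℝ) T × Torus => den q (σ z.1) v z.2 := by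
  simp_rw [den_eq_integral hq]
  refine continuous_integral_curve_param σ
    (f := fun x (z : Phase) => q (x - z.1) * (if z.2 = v then 1 else 0)) ?_
  have h1 : Continuous fun w : Vel => if w = v then (1 : ℝ) else 0 := continuous_of_discreteTopology
  exact (hq.comp (by fun_prop)).mul (h1.comp (by fun_prop))

theorem continuous_fisher (hp : Continuous p) : Continuous fun t => fisher p (σ t) := by
  have h : Continuous fun z : Icc (0 : ℝ) T × Torus =>
      (√(denShift p (σ z.1) 1 z.2) - √(denShift p (σ z.1) (-1) z.2)) ^ 2 := by
    have h1 := continuous_den_curve σ hp 1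
    have h2 := continuous_den_curve σ hp (-1)
    unfold denShift
    fun_prop
  have := continuous_parametric_integral_of_continuous (μ := (volume : Measure Torus))
    (f := fun t x => (√(denShift p (σ t) 1 x) - √(denShift p (σ t) (-1) x)) ^ 2) h isCompact_univ
  simp only [setIntegral_univ] at this
  exact this

theorem exists_modulus {F : Icc (0 : ℝ) T × Torus → ℝ} (hF : Continuous F) {ε : ℝ} (hε : 0 < ε) :
    ∃ η > 0, ∀ s t : Icc (0 : ℝ) T, |(s : ℝ) - t| < η → ∀ x, |F (s, x) - F (t, x)| ≤ ε := by
  obtain ⟨η, hη, h⟩ := Metric.uniformContinuous_iff.1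
    (CompactSpace.uniformContinuous_of_continuous hF) ε hε
  refine ⟨η, hη, fun s t hst x => (h (a := (s, x)) (b := (t, x)) ?_).le⟩
  rw [Prod.dist_eq, dist_self, max_lt_iff]
  exact ⟨hst, hη⟩

/-- A function on an interval whose increments are small with respect to the increments of time is
nonincreasing. -/
theorem le_of_increment_le (hT : 0 ≤ T) {Φ : Icc (0 : ℝ) T → ℝ}
    (h : ∀ ε > 0, ∃ η > 0, ∀ s t : Icc (0 : ℝ) T, s ≤ t → (t : ℝ) - s < η →
      Φ t - Φ s ≤ ε * (t - s)) (t : Icc (0 : ℝ) T) : Φ t ≤ Φ ⟨0, left_mem_Icc.2 hT⟩ := by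
  have key : ∀ ε > 0, Φ t ≤ Φ ⟨0, left_mem_Icc.2 hT⟩ + ε * t := by
    intro ε hε
    obtain ⟨η, hη, hinc⟩ := h ε hε
    -- Cut `[0, t]` into `N` equal steps of length below `η` and add the increments.
    obtain ⟨N, hN⟩ := exists_nat_gt ((t : ℝ) / η)
    have ht0 : (0 : ℝ) ≤ t := t.2.1
    have hNpos : (0 : ℝ) < N := lt_of_le_of_lt (by positivity) hN
    have hmem : ∀ i : ℕ, i ≤ N → (i : ℝ) * (t / N) ∈ Icc (0 : ℝ) T := by
      intro i hi
      refine ⟨by positivity, le_trans ?_ t.2.2⟩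
      rw [mul_div_assoc', div_le_iff₀ hNpos, mul_comm]
      gcongr
    have hstep : ∀ i : ℕ, ∀ hi : i ≤ N,
        Φ ⟨_, hmem i hi⟩ ≤ Φ ⟨0, left_mem_Icc.2 hT⟩ + ε * (i * (t / N)) := by
      intro i
      induction i with
      | zero =>
        intro hi
        have : (⟨_, hmem 0 hi⟩ : Icc (0 : ℝ) T) = ⟨0, left_mem_Icc.2 hT⟩ := by
          apply Subtype.ext; simp
        rw [this]
        simp
      | succ i ih =>
        intro hi
        have h1 := ih (Nat.le_of_succ_le hi)
        have h3 : ((i + 1 : ℕ) : ℝ) * (t / N) - i * (t / N) = t / N := by push_cast; ring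
        have h2 := hinc ⟨_, hmem i (Nat.le_of_succ_le hi)⟩ ⟨_, hmem (i + 1) hi⟩
          (Subtype.mk_le_mk.2 (by gcongr; simp)) (by
            rw [h3, div_lt_iff₀ hNpos, mul_comm]; exact (div_lt_iff₀ hη).1 hN)
        simp only [h3] at h2
        push_cast at h2 ⊢
        linarith
    have h4 := hstep N le_rfl
    have h5 : (N : ℝ) * (t / N) = t := by field_simp
    simpa only [h5] using h4
  refine le_of_forall_pos_le_add fun δ hδ => ?_
  have ht0 : (0 : ℝ) ≤ t := t.2.1
  refine (key (δ / (t + 1)) (by positivity)).trans ?_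
  gcongr
  rw [div_mul_eq_mul_div, div_le_iff₀ (by positivity)]
  nlinarith

/-- Entropy plus accumulated dissipation minus accumulated Lagrangian is nonincreasing: on a short
interval `[s, t]`, convexity of the entropy at `t`, the dual bound and the Hamiltonian estimate give
an increment of at most `ε (t - s)`. -/
theorem IsMollifier.entropy_add_fisher_le (hp : IsMollifier p p') (hT : 0 ≤ T) {α V : ℝ}
    (hα : 0 < α) (hV : 0 ≤ V) {σ : Curve T} {j : Flux T} (h : IsCE σ j)
    (hfin : ∫⁻ r, lagrangian α V (σ (toIcc r)) (j r) ∂(lebOn (Ioo 0 T)) ≠ ∞)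
    (t : Icc (0 : ℝ) T) :
    1 / 2 * entropy p (σ t) + V ^ 2 / (2 * α) *
        ∫ r in between ⟨0, left_mem_Icc.2 hT⟩ t, fisher p (σ (toIcc r)) ∂(lebOn (Ioo 0 T)) ≤
      1 / 2 * entropy p (σ ⟨0, left_mem_Icc.2 hT⟩) +
        (∫⁻ r in between ⟨0, left_mem_Icc.2 hT⟩ t,
          lagrangian α V (σ (toIcc r)) (j r) ∂(lebOn (Ioo 0 T))).toReal := by
  set o : Icc (0 : ℝ) T := ⟨0, left_mem_Icc.2 hT⟩ with ho
  set A := V ^ 2 / (2 * α) with hA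
  have hA0 : 0 ≤ A := by positivity
  set L : Ioo (0 : ℝ) T → ℝ≥0∞ := fun r => lagrangian α V (σ (toIcc r)) (j r) with hL
  have hLfin : ∀ s t : Icc (0 : ℝ) T, ∫⁻ r in between s t, L r ∂(lebOn (Ioo 0 T)) ≠ ∞ :=
    fun s t => ne_top_of_le_ne_top hfin (setLIntegral_le_lintegral _ _)
  have hfi : Integrable (fun r => fisher p (σ (toIcc r))) (lebOn (Ioo 0 T)) :=
    integrable_comp_toIcc (continuous_fisher σ hp.continuous)
  have hbase : between o o = ∅ := by
    ext r
    simp only [mem_empty_iff_false, iff_false]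
    exact fun hr => lt_asymm hr.1 hr.2
  suffices hmain : 1 / 2 * entropy p (σ t) +
      A * ∫ r in between o t, fisher p (σ (toIcc r)) ∂(lebOn (Ioo 0 T)) -
      (∫⁻ r in between o t, L r ∂(lebOn (Ioo 0 T))).toReal ≤ 1 / 2 * entropy p (σ o) +
      A * ∫ r in between o o, fisher p (σ (toIcc r)) ∂(lebOn (Ioo 0 T)) -
      (∫⁻ r in between o o, L r ∂(lebOn (Ioo 0 T))).toReal by
    rw [hbase] at hmain
    simp at hmain
    simp only [one_div]
    linarith
  refine le_of_increment_le hT (Φ := fun t => 1 / 2 * entropy p (σ t) +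
      A * ∫ r in between o t, fisher p (σ (toIcc r)) ∂(lebOn (Ioo 0 T)) -
      (∫⁻ r in between o t, L r ∂(lebOn (Ioo 0 T))).toReal) (fun ε hε => ?_) t
  obtain ⟨B, hB0, hB⟩ := exists_abs_le_of_continuous hp.continuous
  set K := V * (B + 1) + A * (2 * Real.exp (B + 1)) with hK
  have hK0 : 0 ≤ K := by positivity
  -- Tolerances for the densities and for the Fisher information, so that each error costs at most
  -- `ε / 2` per unit time; the `+ 1` covers vanishing `K` or `A`.
  have hε1 : 0 < ε / (2 * (K + 1)) := by positivity
  have hε2 : 0 < ε / (2 * (A + 1)) := by positivity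
  obtain ⟨η₁, hη₁, h₁⟩ := exists_modulus (continuous_den_curve σ hp.continuous 1) hε1
  obtain ⟨η₂, hη₂, h₂⟩ := exists_modulus (continuous_den_curve σ hp.continuous (-1)) hε1
  obtain ⟨η₃, hη₃, h₃⟩ := exists_modulus (continuous_den_curve σ hp.continuous_deriv 1) hε1
  obtain ⟨η₄, hη₄, h₄⟩ := exists_modulus (continuous_den_curve σ hp.continuous_deriv (-1)) hε1
  obtain ⟨η₅, hη₅, h₅⟩ := exists_modulus (F := fun z => fisher p (σ z.1))
    ((continuous_fisher σ hp.continuous).comp continuous_fst) hε2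
  refine ⟨min (min η₁ η₂) (min (min η₃ η₄) η₅), by positivity, fun s t hst hlt => ?_⟩
  simp only [lt_min_iff] at hlt
  have hot : o ≤ s := s.2.1
  have hdc : ∀ v, Continuous (logDen p (σ t) v) := hp.continuous_logDen (σ t)
  -- The test function is frozen at the right endpoint `t`, the side on which the tangent bound
  -- `entropy_sub_le` is taken.
  have hinc := integral_sub_integral_le hα h hfin
    (ψ := fun v x => 1 / 2 * conv p (logDen p (σ t) v) volume x)
    (ψ' := fun v x => 1 / 2 * conv p' (logDen p (σ t) v) volume x)
    (fun v => continuous_const.mul (continuous_conv hp.continuous (hdc v)))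
    (fun v y => (hasTorusDeriv_conv hp.continuous hp.continuous_deriv hp.hasTorusDeriv
      (hdc v) y).const_mul _)
    (fun v => continuous_const.mul (continuous_conv hp.continuous_deriv (hdc v))) hst
  simp only [integral_const_mul] at hinc
  have hent := hp.entropy_sub_le (σ t) (σ s)
  have hham : ∫ r in between s t, hamiltonian α V (σ (toIcc r))
      (fun q => 1 / 2 * conv p' (logDen p (σ t) q.2) volume q.1)
      (dv fun q => 1 / 2 * conv p (logDen p (σ t) q.2) volume q.1) ∂(lebOn (Ioo 0 T)) ≤
      ∫ r in between s t, (-A * fisher p (σ (toIcc r)) + ε) ∂(lebOn (Ioo 0 T)) := by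
    refine setIntegral_mono_on (Integrable.integrableOn ?_)
      ((hfi.const_mul _).add (integrable_const _)).integrableOn (measurableSet_between s t)
      fun r hr => ?_
    · refine integrable_comp_toIcc (G := fun r => hamiltonian α V (σ r)
        (fun q => 1 / 2 * conv p' (logDen p (σ t) q.2) volume q.1)
        (dv fun q => 1 / 2 * conv p (logDen p (σ t) q.2) volume q.1))
        (continuous_hamiltonian α V σ ?_ ?_)
      · exact continuous_uncurry_vel
          (ψ := fun v x => 1 / 2 * conv p' (logDen p (σ t) v) volume x)
          fun v => continuous_const.mul (continuous_conv hp.continuous_deriv (hdc v))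
      · have := continuous_uncurry_vel
          (ψ := fun v x => 1 / 2 * conv p (logDen p (σ t) v) volume x)
          fun v => continuous_const.mul (continuous_conv hp.continuous (hdc v))
        exact (this.comp continuous_flipVel).sub this
    · have hclose : |((toIcc r : Icc (0 : ℝ) T) : ℝ) - t| ≤ t - s := by
        change |(r : ℝ) - t| ≤ _
        rw [abs_le]
        constructor <;> linarith [hr.1, hr.2]
      have hv : ∀ {P : Vel → Prop}, P 1 → P (-1) → ∀ v, P v := by
        intro P h1 h2 v
        rcases Int.units_eq_one_or v with rfl | rfl
        exacts [h1, h2]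
      have hle := hp.hamiltonian_le (σ t) hα hV (σ (toIcc r)) hB
        (ε := ε / (2 * (K + 1)))
        (hv (h₁ _ _ (hclose.trans_lt hlt.1.1)) (h₂ _ _ (hclose.trans_lt hlt.1.2)))
        (hv (h₃ _ _ (hclose.trans_lt hlt.2.1.1)) (h₄ _ _ (hclose.trans_lt hlt.2.1.2)))
      have hf := (abs_le.1 (h₅ (toIcc r) t (hclose.trans_lt hlt.2.2) 0)).2
      have e1 : K * (ε / (2 * (K + 1))) ≤ ε / 2 := by
        rw [mul_div_assoc', div_le_div_iff₀ (by positivity) two_pos]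
        nlinarith
      have e2 : A * (ε / (2 * (A + 1))) ≤ ε / 2 := by
        rw [mul_div_assoc', div_le_div_iff₀ (by positivity) two_pos]
        nlinarith
      have e3 := mul_le_mul_of_nonneg_left hf hA0
      simp only at e3
      refine hle.trans ?_
      change -A * fisher p (σ t) + K * (ε / (2 * (K + 1))) ≤ _
      linarith
  have hright : ∫ r in between s t, (-A * fisher p (σ (toIcc r)) + ε) ∂(lebOn (Ioo 0 T)) =
      -A * ∫ r in between s t, fisher p (σ (toIcc r)) ∂(lebOn (Ioo 0 T)) + ε * (t - s) := by
    rw [integral_add (hfi.const_mul _).integrableOn (integrable_const _), integral_const_mul,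
      integral_const, measureReal_restrict_apply_univ, lebOn_real_between hst, smul_eq_mul]
    ring
  have hadd1 := setLIntegral_between_add hot hst L
  have hadd2 := setIntegral_between_add hot hst hfi
  rw [hadd1, hadd2, ENNReal.toReal_add (hLfin _ _) (hLfin _ _)]
  rw [hright] at hham
  linarith

end Dissipation

/-! ### Weighted sums of slices -/

section Slices

/-- This moves slice estimates to phase space, where the entropy bounds live. -/
theorem pairing_sum_slice {h : Torus → ℝ} (hh : Measurable h) {M : ℝ} (hM : ∀ x, |h x| ≤ M)
    (c : Vel → ℝ) (μ : SignedMeasure Phase) :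
    pairing h (∑ v : Vel, c v • slice μ v) = pairing (fun p => c p.2 * h p.1) μ := by
  have hM0 : 0 ≤ M := (abs_nonneg _).trans (hM 0)
  have h1 : ∀ v, pairing h (c v • slice μ v) =
      pairing ((Prod.snd ⁻¹' {v} : Set Phase).indicator fun p => c v * h p.1) μ := by
    intro v
    rw [pairing_smul_measure, slice, pairing_map hh measurable_fst hM,
      pairing_restrict _ (measurableSet_snd_preimage v), ← pairing_const_mul]
    congr 1
    ext p
    by_cases hp : p.2 = v <;> simp [hp]
  have hb : ∀ v, ∀ p : Phase,
      |(Prod.snd ⁻¹' {v} : Set Phase).indicator (fun p => c v * h p.1) p| ≤ |c v| * M := by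
    intro v p
    by_cases hp : p.2 = v
    · simp only [mem_preimage, mem_singleton_iff, hp, indicator_of_mem, abs_mul]
      exact mul_le_mul_of_nonneg_left (hM _) (abs_nonneg _)
    · simp only [mem_preimage, mem_singleton_iff, hp, not_false_eq_true, indicator_of_notMem,
        abs_zero]
      positivity
  have hm : ∀ v, Measurable
      ((Prod.snd ⁻¹' {v} : Set Phase).indicator fun p : Phase => c v * h p.1) := fun v =>
    ((hh.comp measurable_fst).const_mul _).indicator (measurableSet_snd_preimage v)
  rw [pairing_sum_measure hh hM, sum_vel, h1, h1, ← pairing_add (hm 1) (hb 1) (hm (-1)) (hb (-1))]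
  congr 1
  ext p
  rcases Int.units_eq_one_or p.2 with hp | hp <;> simp [hp]

/-- Test the weighted sum with its own sign `h`; on phase space this is the pairing of `μ` with
`c(v) h(x)`, which is bounded by `K`. -/
theorem variation_sum_slice_le {c : Vel → ℝ} {K : ℝ} (hc : ∀ v, |c v| ≤ K)
    (μ : SignedMeasure Phase) :
    (∑ v : Vel, c v • slice μ v).variation univ ≤ ENNReal.ofReal K * μ.variation univ := by
  obtain ⟨h, hh, hh1, hs⟩ := exists_sign (∑ v : Vel, c v • slice μ v)
  have hK : 0 ≤ K := (abs_nonneg _).trans (hc 1)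
  rw [pairing_sum_slice hh hh1] at hs
  have := abs_pairing_le (f := fun p : Phase => c p.2 * h p.1) (M := K) (fun p => by
    rw [abs_mul]
    exact (mul_le_mul (hc _) (hh1 _) (abs_nonneg _) hK).trans_eq (mul_one _)) μ
  rw [hs] at this
  rw [← ofReal_measureReal (measure_ne_top _ _),
    ← ofReal_measureReal (μ := μ.variation) (measure_ne_top _ _), ← ENNReal.ofReal_mul hK]
  exact ENNReal.ofReal_le_ofReal ((le_abs_self _).trans this)

theorem IsIntegrableFamily.sum_slice {τ : Type*} [MeasurableSpace τ] {m : Measure τ}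
    {μ : τ → SignedMeasure Phase} (h : IsIntegrableFamily m μ) (c : Vel → ℝ) :
    IsIntegrableFamily m fun t => ∑ v : Vel, c v • slice (μ t) v where
  measurable B hB := by
    have h1 : ∀ x, |B.indicator (fun _ => (1 : ℝ)) x| ≤ 1 := by
      intro x
      by_cases hx : x ∈ B <;> simp [hx]
    have hm : Measurable (B.indicator fun _ => (1 : ℝ)) := measurable_const.indicator hB
    have hK : ∀ v, |c v| ≤ ∑ v, |c v| := fun v =>
      Finset.single_le_sum (f := fun v => |c v|) (fun _ _ => abs_nonneg _) (Finset.mem_univ v)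
    simp_rw [← pairing_indicator_one _ hB, pairing_sum_slice hm h1]
    refine h.measurable_pairing
      (F := fun q : τ × Phase => c q.2.2 * B.indicator (fun _ => (1 : ℝ)) q.2.1) ?_
      (M := ∑ v, |c v|) fun q => ?_
    · exact ((measurable_of_finite c).comp (by fun_prop)).mul (hm.comp (by fun_prop))
    · rw [abs_mul]
      exact (mul_le_mul (hK _) (h1 _) (abs_nonneg _) ((abs_nonneg _).trans (hK 1))).trans_eq
        (mul_one _)
  integrable := by
    have hK : ∀ v, |c v| ≤ ∑ v, |c v| := fun v =>
      Finset.single_le_sum (f := fun v => |c v|) (fun _ _ => abs_nonneg _) (Finset.mem_univ v)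
    refine (lintegral_mono fun t => variation_sum_slice_le hK (μ t)).trans_lt ?_
    rw [lintegral_const_mul' _ _ ENNReal.ofReal_ne_top]
    exact ENNReal.mul_lt_top ENNReal.ofReal_lt_top h.integrable

theorem variation_toSignedMeasure_le {X : Type*} [MeasurableSpace X] (μ : Measure X)
    [IsFiniteMeasure μ] : μ.toSignedMeasure.variation univ ≤ μ univ := by
  obtain ⟨h, hh, hh1, hs⟩ := exists_sign μ.toSignedMeasure
  rw [pairing_toSignedMeasure] at hs
  rw [← ofReal_measureReal (measure_ne_top _ _), ← ofReal_measureReal (μ := μ) (measure_ne_top _ _),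
    ← hs]
  refine ENNReal.ofReal_le_ofReal ?_
  calc ∫ x, h x ∂μ ≤ ∫ _, 1 ∂μ :=
        integral_mono (integrable_of_abs_le hh hh1) (integrable_const _)
          fun x => (le_abs_self _).trans (hh1 x)
    _ = μ.real univ := by simp

/-- By portmanteau, the mass of an open set is lower semicontinuous in time, and open sets form a
generating π-system. -/
theorem measurable_curve {τ X : Type*} [TopologicalSpace τ] [MeasurableSpace τ]
    [OpensMeasurableSpace τ] [TopologicalSpace X] [HasOuterApproxClosed X] [MeasurableSpace X]
    [BorelSpace X]
    {σ : τ → ProbabilityMeasure X} (hσ : Continuous σ) :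
    Measurable fun t => (σ t : Measure X) := by
  refine Measurable.measure_of_isPiSystem_of_isProbabilityMeasure
    (S := {s | IsOpen s}) (BorelSpace.measurable_eq.trans rfl) isPiSystem_isOpen fun G hG => ?_
  refine LowerSemicontinuous.measurable fun t y hy => ?_
  exact eventually_lt_of_lt_liminf
    (hy.trans_le (ProbabilityMeasure.le_liminf_measure_open_of_tendsto (hσ.tendsto t) hG))

theorem isIntegrableFamily_curve {T : ℝ} (σ : Curve T) :
    IsIntegrableFamily (lebOn (Icc 0 T)) fun t => (σ t : Measure Phase).toSignedMeasure where
  measurable B hB := by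
    simp_rw [Measure.toSignedMeasure_apply_measurable hB, measureReal_def]
    exact ((Measure.measurable_coe hB).comp (measurable_curve σ.continuous)).ennreal_toReal
  integrable := by
    refine (lintegral_mono fun t => variation_toSignedMeasure_le _).trans_lt ?_
    simp [lebOn_univ measurableSet_Icc]

theorem isIntegrableFamily_omegaSlice (V : ℝ) {T : ℝ} (σ : Curve T) :
    IsIntegrableFamily (lebOn (Icc 0 T)) (omegaSlice V σ) := by
  have := (isIntegrableFamily_curve σ).sum_slice fun v => V * v.toReal
  simp_rw [mul_smul, ← Finset.smul_sum] at this
  exact this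

theorem pairing_omegaSlice (V : ℝ) {T : ℝ} (σ : Curve T) (t : Icc (0 : ℝ) T) {h : Torus → ℝ}
    (hh : Measurable h) {M : ℝ} (hM : ∀ x, |h x| ≤ M) :
    pairing h (omegaSlice V σ t) = ∫ p, V * p.2.toReal * h p.1 ∂(σ t : Measure Phase) := by
  have := pairing_sum_slice hh hM (fun v => V * v.toReal) (σ t : Measure Phase).toSignedMeasure
  simp_rw [mul_smul, ← Finset.smul_sum] at this
  exact this.trans (pairing_toSignedMeasure _ _)

end Slices

/-! ### Bounds on the flux -/

section FluxBounds

open InformationTheory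

/-- The `L¹` distance of the two mollified velocity slices. -/
def velDist (p : Torus → ℝ) (s : ProbabilityMeasure Phase) : ℝ :=
  ∫ x, |den p s 1 x - den p s (-1) x|

theorem velDist_nonneg (p : Torus → ℝ) (s : ProbabilityMeasure Phase) : 0 ≤ velDist p s :=
  integral_nonneg fun _ => abs_nonneg _

variable {p p' : Torus → ℝ}

theorem fisher_nonneg (p : Torus → ℝ) (s : ProbabilityMeasure Phase) : 0 ≤ fisher p s :=
  integral_nonneg fun _ => sq_nonneg _

/-- Cauchy-Schwarz for `|a² - b²| = |a - b| (a + b)`, with `a`, `b` the square roots of the shifted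
densities: the second factor has squared norm at most `2 ∫ (a² + b²) = 4`. It is proved through
Young's inequality with a parameter `l`. -/
theorem IsMollifier.velDist_sq_le (hp : IsMollifier p p') (s : ProbabilityMeasure Phase) :
    velDist p s ^ 2 ≤ 4 * fisher p s := by
  have hi : ∀ {f : Torus → ℝ}, Continuous f → Integrable f volume :=
    fun hf => hf.integrable_of_compactSpace _
  have c1 := hp.continuous_denShift s 1
  have c2 := hp.continuous_denShift s (-1)
  have d1 := continuous_den hp.continuous s 1
  have d2 := continuous_den hp.continuous s (-1)
  have key : ∀ l : ℝ, 0 < l → velDist p s ≤ l / 2 * fisher p s + 2 / l := by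
    intro l hl
    have hsum : ∫ x, (denShift p s 1 x + denShift p s (-1) x) = 2 := by
      rw [integral_add (hi c1) (hi c2), ← sum_vel (fun v => ∫ x, denShift p s v x)]
      exact hp.sum_integral_denShift s
    have : l / 2 * fisher p s + 2 / l = ∫ x,
        (l / 2 * (√(denShift p s 1 x) - √(denShift p s (-1) x)) ^ 2 +
          1 / l * (denShift p s 1 x + denShift p s (-1) x)) := by
      rw [integral_add (hi (by fun_prop)) (hi (by fun_prop)), integral_const_mul,
        integral_const_mul, hsum, fisher]
      ring
    rw [this, velDist]
    refine integral_mono (hi (by fun_prop)) (hi (by fun_prop)) fun x => ?_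
    beta_reduce
    set a := √(denShift p s 1 x) with ha
    set b := √(denShift p s (-1) x) with hb
    have ha2 : a ^ 2 = denShift p s 1 x := Real.sq_sqrt (hp.denShift_pos s 1 x).le
    have hb2 : b ^ 2 = denShift p s (-1) x := Real.sq_sqrt (hp.denShift_pos s (-1) x).le
    have e : den p s 1 x - den p s (-1) x = (a - b) * (a + b) := by
      have : den p s 1 x - den p s (-1) x = denShift p s 1 x - denShift p s (-1) x := by
        simp [denShift]
      rw [this, ← ha2, ← hb2]
      ring
    have hab : 0 ≤ a + b := add_nonneg (Real.sqrt_nonneg _) (Real.sqrt_nonneg _)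
    rw [e, abs_mul, abs_of_nonneg hab,
      ← ha2, ← hb2, ← sq_abs (a - b)]
    have h1 : 0 ≤ (l * |a - b| - (a + b)) ^ 2 := sq_nonneg _
    have h2 : (a + b) ^ 2 ≤ 2 * (a ^ 2 + b ^ 2) := by nlinarith [sq_nonneg (a - b)]
    have h3 : |a - b| * (a + b) ≤ (l ^ 2 * |a - b| ^ 2 + 2 * (a ^ 2 + b ^ 2)) / (2 * l) := by
      rw [le_div_iff₀ (by positivity)]
      nlinarith
    refine h3.trans_eq ?_
    field_simp
  rcases (velDist_nonneg p s).eq_or_lt with h0 | h0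
  · rw [← h0]
    have := fisher_nonneg p s
    simpa using this
  -- This `l` makes the term `2 / l` equal to half of `velDist`, which is then absorbed on the left.
  · have := key (4 / velDist p s) (by positivity)
    have e : 4 / velDist p s / 2 * fisher p s + 2 / (4 / velDist p s) =
        2 * fisher p s / velDist p s + velDist p s / 2 := by
      field_simp
      ring
    rw [e] at this
    have h2 : velDist p s / 2 ≤ 2 * fisher p s / velDist p s := by linarith
    rw [le_div_iff₀ h0] at h2
    nlinarith

variable {T : ℝ}

theorem continuous_velDist (σ : Curve T) (hp : Continuous p) :
    Continuous fun t => velDist p (σ t) := by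
  have h : Continuous fun z : Icc (0 : ℝ) T × Torus =>
      |den p (σ z.1) 1 z.2 - den p (σ z.1) (-1) z.2| :=
    ((continuous_den_curve σ hp 1).sub (continuous_den_curve σ hp (-1))).abs
  have := continuous_parametric_integral_of_continuous (μ := (volume : Measure Torus))
    (f := fun t x => |den p (σ t) 1 x - den p (σ t) (-1) x|) h isCompact_univ
  simp only [setIntegral_univ] at this
  exact this

theorem IsMollifier.entropy_add_fisher_le_of_bound (hp : IsMollifier p p') (hT : 0 ≤ T) {α V : ℝ}
    (hα : 0 < α) (hV : 0 ≤ V) {σ : Curve T} {j : Flux T} (h : IsCE σ j) {C : ℝ≥0}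
    (hC : klDiv (σ ⟨0, left_mem_Icc.2 hT⟩ : Measure Phase) stat +
      ∫⁻ r, lagrangian α V (σ (toIcc r)) (j r) ∂(lebOn (Ioo 0 T)) ≤ C) (t : Icc (0 : ℝ) T) :
    1 / 2 * entropy p (σ t) + V ^ 2 / (2 * α) *
        ∫ r in between ⟨0, left_mem_Icc.2 hT⟩ t, fisher p (σ (toIcc r)) ∂(lebOn (Ioo 0 T)) ≤ C := by
  have hL := ne_top_of_le_ne_top ENNReal.coe_ne_top (le_add_self.trans hC)
  have hK := ne_top_of_le_ne_top ENNReal.coe_ne_top (le_self_add.trans hC)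
  refine (hp.entropy_add_fisher_le hT hα hV h hL t).trans ?_
  have h1 : entropy p (σ ⟨0, left_mem_Icc.2 hT⟩) ≤
      (klDiv (σ ⟨0, left_mem_Icc.2 hT⟩ : Measure Phase) stat).toReal :=
    (ENNReal.ofReal_le_iff_le_toReal hK).1 (hp.ofReal_entropy_le_klDiv _)
  have h2 := ENNReal.toReal_mono hL (setLIntegral_le_lintegral
    (between ⟨0, left_mem_Icc.2 hT⟩ t) fun r => lagrangian α V (σ (toIcc r)) (j r))
  have h3 := ENNReal.toReal_mono ENNReal.coe_ne_top hC
  rw [ENNReal.toReal_add hK hL] at h3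
  have h4 := hp.entropy_nonneg (σ ⟨0, left_mem_Icc.2 hT⟩)
  simp only [ENNReal.coe_toReal] at h3
  linarith

/-- The factor `8 α` is the `4` of `velDist_sq_le` times the `2 α` from the dissipation coefficient
`V² / (2 α)`. The bound depends neither on `V` nor on the mollifier. -/
theorem IsMollifier.lintegral_velDist_sq_le (hp : IsMollifier p p') (hT : 0 < T) {α V : ℝ}
    (hα : 0 < α) (hV : 0 ≤ V) {σ : Curve T} {j : Flux T} (h : IsCE σ j) {C : ℝ≥0}
    (hC : klDiv (σ ⟨0, left_mem_Icc.2 hT.le⟩ : Measure Phase) stat +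
      ∫⁻ r, lagrangian α V (σ (toIcc r)) (j r) ∂(lebOn (Ioo 0 T)) ≤ C) :
    ∫⁻ t, ENNReal.ofReal (V * velDist p (σ t)) ^ 2 ∂(lebOn (Icc 0 T)) ≤
      ENNReal.ofReal (8 * α * C) := by
  have h1 := hp.entropy_add_fisher_le_of_bound hT.le hα hV h hC ⟨T, right_mem_Icc.2 hT.le⟩
  rw [between_bot_top hT, setIntegral_univ] at h1
  have h2 := hp.entropy_nonneg (σ ⟨T, right_mem_Icc.2 hT.le⟩)
  have hfi : Integrable (fun r => fisher p (σ (toIcc r))) (lebOn (Ioo 0 T)) :=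
    integrable_comp_toIcc (continuous_fisher σ hp.continuous)
  have hm : Measurable fun t : Icc (0 : ℝ) T => ENNReal.ofReal (V * velDist p (σ t)) ^ 2 :=
    ((continuous_velDist σ hp.continuous).measurable.const_mul V).ennreal_ofReal.pow_const 2
  rw [← map_toIcc, lintegral_map hm continuous_toIcc.measurable]
  calc ∫⁻ r, ENNReal.ofReal (V * velDist p (σ (toIcc r))) ^ 2 ∂(lebOn (Ioo 0 T)) ≤
        ∫⁻ r, ENNReal.ofReal (4 * V ^ 2 * fisher p (σ (toIcc r))) ∂(lebOn (Ioo 0 T)) := by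
        refine lintegral_mono fun r => ?_
        rw [← ENNReal.ofReal_pow (mul_nonneg hV (velDist_nonneg _ _))]
        refine ENNReal.ofReal_le_ofReal ?_
        nlinarith [mul_le_mul_of_nonneg_left (hp.velDist_sq_le (σ (toIcc r))) (sq_nonneg V)]
    _ = ENNReal.ofReal (∫ r, 4 * V ^ 2 * fisher p (σ (toIcc r)) ∂(lebOn (Ioo 0 T))) :=
        (ofReal_integral_eq_lintegral_ofReal (hfi.const_mul _) (Eventually.of_forall fun r =>
          mul_nonneg (by positivity) (fisher_nonneg _ _))).symm
    _ ≤ _ := by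
        refine ENNReal.ofReal_le_ofReal ?_
        rw [integral_const_mul]
        set I := ∫ r, fisher p (σ (toIcc r)) ∂(lebOn (Ioo 0 T))
        have e : 4 * V ^ 2 * I = 8 * α * (V ^ 2 / (2 * α) * I) := by
          field_simp
          ring
        rw [e]
        refine mul_le_mul_of_nonneg_left ?_ (by positivity)
        linarith

/-- An upper bound for the total variation of the flux. -/
def fluxBound (V : ℝ) (s : ProbabilityMeasure Phase) : ℝ≥0∞ :=
  liminf (fun N => ENNReal.ofReal (V * velDist (bump N) s)) atTop

theorem measurable_fluxBound (V : ℝ) (σ : Curve T) : Measurable fun t => fluxBound V (σ t) :=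
  Measurable.liminf fun N => ((continuous_velDist σ
    (isMollifier_bump N).continuous).measurable.const_mul V).ennreal_ofReal

/-- Fatou's lemma along the mollifiers, whose bounds are uniform. -/
theorem lintegral_fluxBound_sq_le (hT : 0 < T) {α V : ℝ}
    (hα : 0 < α) (hV : 0 ≤ V) {σ : Curve T} {j : Flux T} (h : IsCE σ j) {C : ℝ≥0}
    (hC : klDiv (σ ⟨0, left_mem_Icc.2 hT.le⟩ : Measure Phase) stat +
      ∫⁻ r, lagrangian α V (σ (toIcc r)) (j r) ∂(lebOn (Ioo 0 T)) ≤ C) :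
    ∫⁻ t, fluxBound V (σ t) ^ 2 ∂(lebOn (Icc 0 T)) ≤ ENNReal.ofReal (8 * α * C) := by
  have hsq : ∀ t, fluxBound V (σ t) ^ 2 ≤
      liminf (fun N => ENNReal.ofReal (V * velDist (bump N) (σ t)) ^ 2) atTop := by
    intro t
    rw [fluxBound, Monotone.map_liminf_of_continuousAt (f := fun x : ℝ≥0∞ => x ^ 2)
      (fun a b hab => pow_le_pow_left' hab 2) _ (ENNReal.continuous_pow 2).continuousAt]
    rfl
  calc ∫⁻ t, fluxBound V (σ t) ^ 2 ∂(lebOn (Icc 0 T)) ≤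
        ∫⁻ t, liminf (fun N => ENNReal.ofReal (V * velDist (bump N) (σ t)) ^ 2) atTop
          ∂(lebOn (Icc 0 T)) := lintegral_mono hsq
    _ ≤ liminf (fun N => ∫⁻ t, ENNReal.ofReal (V * velDist (bump N) (σ t)) ^ 2
          ∂(lebOn (Icc 0 T))) atTop :=
        lintegral_liminf_le fun N => ((continuous_velDist σ
          (isMollifier_bump N).continuous).measurable.const_mul V).ennreal_ofReal.pow_const 2
    _ ≤ liminf (fun _ : ℕ => ENNReal.ofReal (8 * α * C)) atTop :=
        liminf_le_liminf (Eventually.of_forall fun N =>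
          (isMollifier_bump N).lintegral_velDist_sq_le hT hα hV h hC)
    _ = _ := liminf_const _

/-- Pointwise `w ≤ w² / l + l`, by comparing `w` with `l`; this is the form in which an `L²` bound
yields equi-integrability. -/
theorem setLIntegral_le_of_lintegral_sq_le {X : Type*} [MeasurableSpace X] {m : Measure X}
    {w : X → ℝ≥0∞} {K : ℝ≥0∞} (hK : ∫⁻ x, w x ^ 2 ∂m ≤ K) {l : ℝ≥0} (hl : l ≠ 0)
    {B : Set X} : ∫⁻ x in B, w x ∂m ≤ K / l + l * m B := by
  have hl' : (l : ℝ≥0∞) ≠ 0 := by simpa using hl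
  have h1 : ∀ x, w x ≤ (l : ℝ≥0∞)⁻¹ * w x ^ 2 + l := by
    intro x
    rcases le_total (w x) l with h | h
    · exact h.trans le_add_self
    · refine le_trans ?_ le_self_add
      rw [← ENNReal.div_eq_inv_mul, ENNReal.le_div_iff_mul_le (Or.inl hl') (Or.inl ENNReal.coe_ne_top),
        sq]
      gcongr
  calc ∫⁻ x in B, w x ∂m ≤ ∫⁻ x in B, ((l : ℝ≥0∞)⁻¹ * w x ^ 2 + l) ∂m := lintegral_mono h1
    _ = (l : ℝ≥0∞)⁻¹ * (∫⁻ x in B, w x ^ 2 ∂m) + l * m B := by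
        rw [lintegral_add_right _ measurable_const,
          lintegral_const_mul' _ _ (ENNReal.inv_ne_top.2 hl'), setLIntegral_const]
    _ ≤ _ := by
        rw [ENNReal.div_eq_inv_mul]
        gcongr
        exact (setLIntegral_le_lintegral _ _).trans hK

/-- Bounded measurable functions on a compact space are approximated in `L¹` by continuous
functions satisfying the same bound. -/
theorem exists_continuous_integral_sub_le {X : Type*} [TopologicalSpace X] [NormalSpace X]
    [MeasurableSpace X] [BorelSpace X] {μ : Measure X} [IsFiniteMeasure μ] [μ.WeaklyRegular]
    {h : X → ℝ} (hh : Measurable h) (h1 : ∀ x, |h x| ≤ 1) {ε : ℝ} (hε : 0 < ε) :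
    ∃ g : X → ℝ, Continuous g ∧ (∀ x, |g x| ≤ 1) ∧ ∫ x, |h x - g x| ∂μ ≤ ε := by
  obtain ⟨g, hg, -⟩ := (integrable_of_abs_le (μ := μ) hh
    h1).exists_boundedContinuous_integral_sub_le hε
  have hgi : Integrable g μ := g.integrable μ
  -- Truncation to `[-1, 1]` does not increase the distance to `h`, which takes its values there.
  refine ⟨fun x => max (-1) (min 1 (g x)), by fun_prop, fun x => ?_, le_trans ?_ hg⟩
  · rw [abs_le]
    exact ⟨le_max_left _ _, max_le (by norm_num) (min_le_left _ _)⟩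
  · have hm : Measurable fun x => max (-1) (min 1 (g x)) := by fun_prop
    refine integral_mono (((integrable_of_abs_le hh h1).sub
      (integrable_of_abs_le (M := 1) hm fun x => ?_)).abs)
      ((integrable_of_abs_le hh h1).sub hgi).abs fun x => ?_
    · rw [abs_le]
      exact ⟨le_max_left _ _, max_le (by norm_num) (min_le_left _ _)⟩
    · simp only [Real.norm_eq_abs]
      have := abs_le.1 (h1 x)
      rcases le_total (g x) (-1) with h2 | h2
      · rw [max_eq_left ((min_le_right _ _).trans h2), abs_of_nonneg (by linarith),
          abs_of_nonneg (by linarith)]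
        linarith
      · rcases le_total 1 (g x) with h3 | h3
        · rw [min_eq_left h3, max_eq_right (by norm_num), abs_of_nonpos (by linarith),
            abs_of_nonpos (by linarith)]
          linarith
        · rw [min_eq_right h3, max_eq_right h2]

theorem IsMollifier.integral_conv_le (hp : IsMollifier p p') {V : ℝ} (hV : 0 ≤ V)
    (s : ProbabilityMeasure Phase) {g : Torus → ℝ} (hg : Continuous g) (h1 : ∀ x, |g x| ≤ 1) :
    ∫ q, V * q.2.toReal * conv p g volume q.1 ∂(s : Measure Phase) ≤ V * velDist p s := by
  have hi : ∀ {f : Torus → ℝ}, Continuous f → Integrable f volume :=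
    fun hf => hf.integrable_of_compactSpace _
  have c := continuous_conv (μ := volume) hp.continuous hg
  have d1 := continuous_den hp.continuous s 1
  have d2 := continuous_den hp.continuous s (-1)
  rw [integral_eq_sum_velMeasure (s : Measure Phase)
    (f := fun v x => V * v.toReal * conv p g volume x) (fun v => continuous_const.mul c), sum_vel]
  simp only [integral_const_mul, ← hp.integral_mul_conv hg]
  change V * _ * (∫ x, g x * den p s 1 x) + V * _ * (∫ x, g x * den p s (-1) x) ≤ _
  have e : V * Vel.toReal 1 * (∫ x, g x * den p s 1 x) +
      V * Vel.toReal (-1) * (∫ x, g x * den p s (-1) x) =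
      V * ∫ x, g x * (den p s 1 x - den p s (-1) x) := by
    simp only [mul_sub]
    rw [MeasureTheory.integral_sub (hi (by fun_prop)) (hi (by fun_prop))]
    simp [Vel.toReal]
    ring
  rw [e]
  refine mul_le_mul_of_nonneg_left ?_ hV
  refine integral_mono (hi (by fun_prop)) (hi (by fun_prop)) fun x => ?_
  refine (le_abs_self _).trans ?_
  rw [abs_mul]
  exact mul_le_of_le_one_left (abs_nonneg _) (h1 x)

/-- Mollifying `g` amounts to mollifying the slices, which gives the bound by `V * velDist`; letting
the mollifier concentrate leaves the liminf. -/
theorem ofReal_integral_le_fluxBound {V : ℝ} (hV : 0 ≤ V) (s : ProbabilityMeasure Phase)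
    {g : Torus → ℝ} (hg : Continuous g) (h1 : ∀ x, |g x| ≤ 1) :
    ENNReal.ofReal (∫ q, V * q.2.toReal * g q.1 ∂(s : Measure Phase)) ≤ fluxBound V s := by
  have hlim : Tendsto (fun N => ∫ q, V * q.2.toReal * conv (bump N) g volume q.1
      ∂(s : Measure Phase)) atTop (𝓝 (∫ q, V * q.2.toReal * g q.1 ∂(s : Measure Phase))) := by
    refine tendsto_integral_of_dominated_convergence (fun _ => V) (fun N => ?_)
      (integrable_const _) (fun N => Eventually.of_forall fun q => ?_)
      (Eventually.of_forall fun q => (tendsto_conv_bump hg q.1).const_mul _)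
    · have := (continuous_conv (μ := volume) (isMollifier_bump N).continuous hg).measurable
      have h2 : Measurable Vel.toReal := measurable_of_finite _
      exact (((h2.comp measurable_snd).const_mul V).mul
        (this.comp measurable_fst)).aestronglyMeasurable
    · rw [Real.norm_eq_abs, abs_mul, abs_mul, abs_vel_toReal, abs_of_nonneg hV, mul_one]
      exact mul_le_of_le_one_right hV ((isMollifier_bump N).abs_conv_le h1 hg q.1)
  rw [← (ENNReal.tendsto_ofReal hlim).liminf_eq]
  exact liminf_le_liminf (Eventually.of_forall fun N =>
    ENNReal.ofReal_le_ofReal ((isMollifier_bump N).integral_conv_le hV s hg h1))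

/-- The sign of a signed measure is only measurable, so `h` is replaced by a continuous function
close in `L¹` of the `x`-marginal of `s`. -/
theorem ofReal_integral_le_fluxBound_of_measurable {V : ℝ} (hV : 0 ≤ V)
    (s : ProbabilityMeasure Phase) {h : Torus → ℝ} (hh : Measurable h) (h1 : ∀ x, |h x| ≤ 1) :
    ENNReal.ofReal (∫ q, V * q.2.toReal * h q.1 ∂(s : Measure Phase)) ≤ fluxBound V s := by
  refine ENNReal.le_of_forall_pos_le_add fun ε hε _ => ?_
  set m : Measure Torus := (s : Measure Phase).map Prod.fst with hm
  obtain ⟨g, hg, hg1, hgε⟩ := exists_continuous_integral_sub_le (μ := m) hh h1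
    (ε := ε / (V + 1)) (by positivity)
  have h2 : Measurable Vel.toReal := measurable_of_finite _
  have hint : ∀ {f : Torus → ℝ}, Measurable f → (∀ x, |f x| ≤ 1) →
      Integrable (fun q : Phase => V * q.2.toReal * f q.1) (s : Measure Phase) := by
    intro f hf hf1
    refine integrable_of_abs_le (M := V) (((h2.comp measurable_snd).const_mul V).mul
        (hf.comp measurable_fst)) fun q => ?_
    rw [abs_mul, abs_mul, abs_vel_toReal, abs_of_nonneg hV, mul_one]
    exact mul_le_of_le_one_right hV (hf1 _)
  have hd : Measurable fun x => |h x - g x| := (hh.sub hg.measurable).abs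
  have hle : ∫ q, V * q.2.toReal * h q.1 ∂(s : Measure Phase) ≤
      (∫ q, V * q.2.toReal * g q.1 ∂(s : Measure Phase)) + ε := by
    have h3 : (∫ q, V * q.2.toReal * h q.1 ∂(s : Measure Phase)) -
        ∫ q, V * q.2.toReal * g q.1 ∂(s : Measure Phase) ≤
        ∫ q, V * |h q.1 - g q.1| ∂(s : Measure Phase) := by
      rw [← MeasureTheory.integral_sub (hint hh h1) (hint hg.measurable hg1)]
      refine integral_mono ((hint hh h1).sub (hint hg.measurable hg1))
        ((integrable_of_abs_le (M := 2) (hd.comp measurable_fst) fun q => ?_).const_mul V)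
        fun q => ?_
      · simp only [Function.comp_apply, abs_abs]
        exact (abs_sub _ _).trans (by linarith [h1 q.1, hg1 q.1])
      · simp only
        rw [← mul_sub]
        refine (le_abs_self _).trans_eq ?_
        rw [abs_mul, abs_mul, abs_vel_toReal, abs_of_nonneg hV, mul_one]
    have h4 : ∫ q, V * |h q.1 - g q.1| ∂(s : Measure Phase) = V * ∫ x, |h x - g x| ∂m := by
      rw [integral_const_mul, hm, integral_map measurable_fst.aemeasurable hd.aestronglyMeasurable]
    have h5 : V * (ε / (V + 1)) ≤ (ε : ℝ) := by
      rw [mul_div_assoc', div_le_iff₀ (by positivity)]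
      nlinarith [ε.2]
    nlinarith [mul_le_mul_of_nonneg_left hgε hV]
  calc _ ≤ ENNReal.ofReal ((∫ q, V * q.2.toReal * g q.1 ∂(s : Measure Phase)) + ε) :=
        ENNReal.ofReal_le_ofReal hle
    _ ≤ ENNReal.ofReal (∫ q, V * q.2.toReal * g q.1 ∂(s : Measure Phase)) + ENNReal.ofReal ε :=
        ENNReal.ofReal_add_le
    _ ≤ _ := by
        rw [ENNReal.ofReal_coe_nnreal]
        gcongr
        exact ofReal_integral_le_fluxBound hV s hg hg1

theorem variation_omegaSlice_le {V : ℝ} (hV : 0 ≤ V) (σ : Curve T) (t : Icc (0 : ℝ) T) :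
    (omegaSlice V σ t).variation univ ≤ fluxBound V (σ t) := by
  obtain ⟨h, hh, hh1, hs⟩ := exists_sign (omegaSlice V σ t)
  rw [pairing_omegaSlice V σ t hh hh1] at hs
  rw [← ofReal_measureReal (measure_ne_top _ _), ← hs]
  exact ofReal_integral_le_fluxBound_of_measurable hV (σ t) hh hh1

end FluxBounds

/-! ### Bounds on the derived flux -/

section DerivedFlux

open InformationTheory

variable {T : ℝ}

theorem isIntegrableFamily_derivedFluxSlice (V : ℝ) {σ : Curve T} {j : Flux T} (h : IsCE σ j) :
    IsIntegrableFamily (lebOn (Ioo 0 T)) (derivedFluxSlice V j) :=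
  h.snd.sum_slice fun v => v.toReal / V

theorem exp_sub_one_sub_id_le (x : ℝ) : Real.exp x - 1 - x ≤ x ^ 2 * Real.exp |x| := by
  have h1 : Real.exp x - 1 ≤ x * Real.exp x := by
    have := Real.add_one_le_exp (-x)
    have h2 := mul_le_mul_of_nonneg_right this (Real.exp_pos x).le
    rw [← Real.exp_add, neg_add_cancel, Real.exp_zero] at h2
    linarith
  rcases le_total 0 x with hx | hx
  · rw [abs_of_nonneg hx]
    nlinarith [mul_le_mul_of_nonneg_left h1 hx]
  · have h2 := Real.add_one_le_exp x
    have h3 : 1 ≤ Real.exp |x| := Real.one_le_exp (abs_nonneg x)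
    nlinarith [mul_le_mul_of_nonneg_left h3 (sq_nonneg x)]

/-- Duality with `f = 0` and `g = l (v/V) h(x)`, where `h` is the sign of `J_t`, so that the pairing
equals `l |J_t|`. Since `V ≥ 1`, `|g| ≤ l` uniformly, and dividing by `l` makes the Lagrangian term
small for large `l`. -/
theorem variation_derivedFluxSlice_le {α V : ℝ} (hα : 0 < α) (hV : 1 ≤ V) (σ : Curve T)
    (j : Flux T) (t : Ioo (0 : ℝ) T) {l : ℝ≥0} (hl : l ≠ 0) :
    (derivedFluxSlice V j t).variation univ ≤
      (l : ℝ≥0∞)⁻¹ * lagrangian α V (σ (toIcc t)) (j t) +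
        (ENNReal.ofReal (1 / (2 * α)) * fluxBound V (σ (toIcc t)) +
          ENNReal.ofReal (l * Real.exp l / (2 * α))) := by
  have hV0 : 0 < V := by linarith
  have hl0 : (0 : ℝ) < l := lt_of_le_of_ne l.2 fun h => hl (NNReal.eq h.symm)
  set s := σ (toIcc t) with hs_def
  obtain ⟨h, hh, hh1, hs⟩ := exists_sign (derivedFluxSlice V j t)
  rw [derivedFluxSlice, pairing_sum_slice hh hh1] at hs
  change pairing (fun p => p.2.toReal / V * h p.1) (j t).2 =
    (derivedFluxSlice V j t).variation.real univ at hs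
  set g : Phase → ℝ := fun p => l * (p.2.toReal / V * h p.1) with hg
  have hv : Measurable Vel.toReal := measurable_of_finite _
  have hgm : Measurable g :=
    (((hv.comp measurable_snd).div_const V).mul (hh.comp measurable_fst)).const_mul _
  have hgb : ∀ p, |g p| ≤ l / V := by
    intro p
    rw [hg]
    simp only
    rw [abs_mul, abs_mul, abs_div, abs_vel_toReal, abs_of_pos hV0, NNReal.abs_eq, div_eq_mul_inv (l : ℝ),
      ← one_div]
    have h1V : 0 ≤ 1 / V := by positivity
    exact mul_le_mul_of_nonneg_left (mul_le_of_le_one_right h1V (hh1 _)) hl0.le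
  have hlV : (l : ℝ) / V ≤ l := div_le_self hl0.le hV
  have hlag := ofReal_le_lagrangian (V := V) hα s (j t) (f := fun _ => 0) measurable_const
    (M := 0) (by simp) hgm hgb
  rw [pairing_zero, hg, pairing_const_mul, hs, ← hg] at hlag
  simp only [zero_mul, integral_zero, zero_add] at hlag
  set v := (derivedFluxSlice V j t).variation.real univ with hv_def
  set q := ∫ p, V * p.2.toReal * h p.1 ∂(s : Measure Phase) with hq
  have hw : Measurable fun p : Phase => V * p.2.toReal * h p.1 :=
    ((hv.comp measurable_snd).const_mul V).mul (hh.comp measurable_fst)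
  have hwb : ∀ p : Phase, |V * p.2.toReal * h p.1| ≤ V := fun p => by
    rw [abs_mul, abs_mul, abs_vel_toReal, abs_of_pos hV0, mul_one]
    exact mul_le_of_le_one_right hV0.le (hh1 _)
  have hexp : V ^ 2 / (2 * α) * ∫ p, (Real.exp (g p) - 1) ∂(s : Measure Phase) ≤
      l / (2 * α) * q + l ^ 2 * Real.exp l / (2 * α) := by
    -- Second-order expansion: multiplied by `V² / (2 α)`, the linear part becomes the pairing of
    -- `h` with `ω_t` and the remainder loses its dependence on `V`.
    have hpt : ∀ p, Real.exp (g p) - 1 ≤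
        l / V ^ 2 * (V * p.2.toReal * h p.1) + l ^ 2 / V ^ 2 * Real.exp l := by
      intro p
      have h1 := exp_sub_one_sub_id_le (g p)
      have h2 : g p = l / V ^ 2 * (V * p.2.toReal * h p.1) := by
        rw [hg]; field_simp
      have h3 : g p ^ 2 * Real.exp |g p| ≤ l ^ 2 / V ^ 2 * Real.exp l := by
        rw [← div_pow, ← sq_abs (g p)]
        have := hgb p
        gcongr
        exact this.trans hlV
      linarith
    have hint : ∫ p, (Real.exp (g p) - 1) ∂(s : Measure Phase) ≤
        l / V ^ 2 * q + l ^ 2 / V ^ 2 * Real.exp l := by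
      calc _ ≤ ∫ p, (l / V ^ 2 * (V * p.2.toReal * h p.1) + l ^ 2 / V ^ 2 * Real.exp l)
            ∂(s : Measure Phase) := by
            refine integral_mono (integrable_of_abs_le (M := Real.exp l + 1) (by fun_prop)
              fun p => ?_) (((integrable_of_abs_le hw hwb).const_mul _).add (integrable_const _)) hpt
            refine (abs_sub _ _).trans ?_
            rw [abs_one, Real.abs_exp]
            gcongr
            exact (le_abs_self _).trans ((hgb p).trans hlV)
        _ = _ := by
            rw [integral_add ((integrable_of_abs_le hw hwb).const_mul _) (integrable_const _),
              integral_const_mul]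
            simp [hq]
    refine (mul_le_mul_of_nonneg_left hint (by positivity)).trans_eq ?_
    field_simp
  have hreal : v ≤ (l : ℝ)⁻¹ * (l * v - V ^ 2 / (2 * α) *
      ∫ p, (Real.exp (g p) - 1) ∂(s : Measure Phase)) +
      (1 / (2 * α) * q + l * Real.exp l / (2 * α)) := by
    have h1 := mul_le_mul_of_nonneg_left hexp (inv_nonneg.2 hl0.le)
    have e1 : (l : ℝ)⁻¹ * (l / (2 * α) * q + l ^ 2 * Real.exp l / (2 * α)) =
        1 / (2 * α) * q + l * Real.exp l / (2 * α) := by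
      field_simp
    rw [e1] at h1
    rw [mul_sub, inv_mul_cancel_left₀ hl0.ne']
    linarith
  rw [← ofReal_measureReal (measure_ne_top _ _), ← hv_def]
  refine (ENNReal.ofReal_le_ofReal hreal).trans (ENNReal.ofReal_add_le.trans ?_)
  refine add_le_add ?_ (ENNReal.ofReal_add_le.trans (add_le_add ?_ le_rfl))
  · rw [ENNReal.ofReal_mul (inv_nonneg.2 hl0.le), ENNReal.ofReal_inv_of_pos hl0,
      ENNReal.ofReal_coe_nnreal]
    gcongr
  · rw [ENNReal.ofReal_mul (by positivity)]
    gcongr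
    exact ofReal_integral_le_fluxBound_of_measurable hV0.le s hh hh1

theorem setLIntegral_variation_derivedFluxSlice_le {α V : ℝ} (hα : 0 < α) (hV : 1 ≤ V)
    {σ : Curve T} {j : Flux T} {C : ℝ≥0}
    (hC : ∫⁻ r, lagrangian α V (σ (toIcc r)) (j r) ∂(lebOn (Ioo 0 T)) ≤ C)
    {l : ℝ≥0} (hl : l ≠ 0) (B : Set (Ioo (0 : ℝ) T)) :
    ∫⁻ t in B, (derivedFluxSlice V j t).variation univ ∂(lebOn (Ioo 0 T)) ≤
      C / l + ENNReal.ofReal (1 / (2 * α)) *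
        ∫⁻ t in B, fluxBound V (σ (toIcc t)) ∂(lebOn (Ioo 0 T)) +
      ENNReal.ofReal (l * Real.exp l / (2 * α)) * lebOn (Ioo 0 T) B := by
  have hl' : (l : ℝ≥0∞) ≠ 0 := by simpa using hl
  have hm : Measurable fun t => fluxBound V (σ (toIcc t)) :=
    (measurable_fluxBound V σ).comp continuous_toIcc.measurable
  calc _ ≤ ∫⁻ t in B, ((l : ℝ≥0∞)⁻¹ * lagrangian α V (σ (toIcc t)) (j t) +
        (ENNReal.ofReal (1 / (2 * α)) * fluxBound V (σ (toIcc t)) +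
          ENNReal.ofReal (l * Real.exp l / (2 * α)))) ∂(lebOn (Ioo 0 T)) :=
        lintegral_mono fun t => variation_derivedFluxSlice_le hα hV σ j t hl
    _ = (l : ℝ≥0∞)⁻¹ * (∫⁻ t in B, lagrangian α V (σ (toIcc t)) (j t) ∂(lebOn (Ioo 0 T))) +
        (ENNReal.ofReal (1 / (2 * α)) *
          (∫⁻ t in B, fluxBound V (σ (toIcc t)) ∂(lebOn (Ioo 0 T))) +
        ENNReal.ofReal (l * Real.exp l / (2 * α)) * lebOn (Ioo 0 T) B) := by
        -- The Lagrangian is kept as the left summand, so that no measurability of it is needed.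
        rw [lintegral_add_right _ ((hm.const_mul _).add_const _),
          lintegral_add_right _ measurable_const,
          lintegral_const_mul' _ _ (ENNReal.inv_ne_top.2 hl'), lintegral_const_mul _ hm,
          setLIntegral_const]
    _ ≤ _ := by
        rw [ENNReal.div_eq_inv_mul, add_assoc]
        gcongr
        exact (setLIntegral_le_lintegral _ _).trans hC

end DerivedFlux

/-! ### Compactness of the fluxes -/

section FluxCompactness

open InformationTheory

variable {T : ℝ}

/-- Compactness of families whose total variation is controlled by a function bounded in `L²` and
a small remainder. -/
theorem equiintegrable_of_le {τ X : Type*} [MeasurableSpace τ] [MeasurableSpace X] {m : Measure τ}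
    {μ : ℕ → τ → SignedMeasure X} {w : ℕ → τ → ℝ≥0∞} {K C κ : ℝ≥0}
    (hw : ∀ n, ∫⁻ t, w n t ^ 2 ∂m ≤ K)
    (hμ : ∀ l : ℝ≥0, l ≠ 0 → ∃ d : ℝ≥0, ∀ n B,
      ∫⁻ t in B, (μ n t).variation univ ∂m ≤ C / l + κ * ∫⁻ t in B, w n t ∂m + d * m B)
    (ε : ℝ≥0) (hε : 0 < ε) : ∃ c : ℝ≥0, ∀ n B, MeasurableSet B →
      ∫⁻ t in B, (μ n t).variation univ ∂m ≤ ε + c * m B := by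
  -- Chosen so that `C / l ≤ ε / 2`; likewise `k` gives `κ K / k ≤ ε / 2`. The `+ 1` keeps both
  -- nonzero.
  set l := (C + 1) * (2 / ε) with hl
  set k := (κ * K + 1) * (2 / ε) with hk
  have hl0 : l ≠ 0 := by positivity
  have hk0 : k ≠ 0 := by positivity
  obtain ⟨d, hd⟩ := hμ l hl0
  refine ⟨κ * k + d, fun n B _ => ?_⟩
  have h1 : (C : ℝ≥0∞) / l ≤ ((ε / 2 : ℝ≥0) : ℝ≥0∞) := by
    rw [← ENNReal.coe_div hl0, ENNReal.coe_le_coe, div_le_iff₀ (by positivity), hl]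
    have : ε / 2 * ((C + 1) * (2 / ε)) = C + 1 := by field_simp
    rw [this]
    exact le_self_add
  have h2 : (κ : ℝ≥0∞) * (K / k) ≤ ((ε / 2 : ℝ≥0) : ℝ≥0∞) := by
    rw [← ENNReal.coe_div hk0, ← ENNReal.coe_mul, ENNReal.coe_le_coe, mul_div_assoc',
      div_le_iff₀ (by positivity), hk]
    have : ε / 2 * ((κ * K + 1) * (2 / ε)) = κ * K + 1 := by field_simp
    rw [this]
    exact le_self_add
  calc _ ≤ (C : ℝ≥0∞) / l + κ * (∫⁻ t in B, w n t ∂m) + d * m B := hd n B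
    _ ≤ (C : ℝ≥0∞) / l + κ * (K / k + k * m B) + d * m B := by
        gcongr
        exact setLIntegral_le_of_lintegral_sq_le (hw n) hk0
    _ = (C : ℝ≥0∞) / l + κ * (K / k) + (κ * k + d) * m B := by ring
    _ ≤ ((ε / 2 : ℝ≥0) : ℝ≥0∞) + ((ε / 2 : ℝ≥0) : ℝ≥0∞) + (κ * k + d) * m B := by gcongr
    _ = _ := by
        rw [← ENNReal.coe_add, add_halves]
        push_cast
        rfl

theorem neZero_lebOn_Icc (hT : 0 < T) : NeZero (lebOn (Icc 0 T)) :=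
  ⟨fun h => by
    have := lebOn_univ (measurableSet_Icc (a := (0 : ℝ)) (b := T))
    rw [h] at this
    simp at this
    linarith⟩

theorem neZero_lebOn_Ioo (hT : 0 < T) : NeZero (lebOn (Ioo 0 T)) :=
  ⟨fun h => by
    have := lebOn_univ (measurableSet_Ioo (a := (0 : ℝ)) (b := T))
    rw [h] at this
    simp at this
    linarith⟩

variable {α : ℝ} {V : ℕ → ℝ} {σ : ℕ → Curve T} {j : ℕ → Flux T} {C : ℝ≥0}

theorem exists_subseq_omega (hT : 0 < T) (hα : 0 < α) (hV : ∀ n, 1 ≤ V n)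
    (hCE : ∀ n, IsCE (σ n) (j n))
    (hC : ∀ n, klDiv (σ n ⟨0, left_mem_Icc.2 hT.le⟩ : Measure Phase) stat +
      ∫⁻ r, lagrangian α (V n) (σ n (toIcc r)) (j n r) ∂(lebOn (Ioo 0 T)) ≤ C) :
    ∃ k : ℕ → ℕ, StrictMono k ∧ ∃ ωt : Icc (0 : ℝ) T → SignedMeasure Torus,
      IsIntegrableFamily (lebOn (Icc 0 T)) ωt ∧
      NarrowTendsto (fun n => omega (V (k n)) (σ (k n))) (spaceTime (lebOn (Icc 0 T)) ωt) := by
  have := neZero_lebOn_Icc hT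
  have hV0 : ∀ n, 0 ≤ V n := fun n => zero_le_one.trans (hV n)
  have hbound : ∀ n, ∫⁻ t, fluxBound (V n) (σ n t) ^ 2 ∂(lebOn (Icc 0 T)) ≤
      ((8 * α * C).toNNReal : ℝ≥0) := fun n =>
    lintegral_fluxBound_sq_le hT hα (hV0 n) (hCE n) (hC n)
  have hequi := equiintegrable_of_le (μ := fun n => omegaSlice (V n) (σ n)) (C := 0) (κ := 1)
    hbound fun l _ => ⟨0, fun n B => by
      simp only [ENNReal.coe_zero, ENNReal.zero_div, zero_add, ENNReal.coe_one, one_mul, zero_mul,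
        add_zero]
      exact lintegral_mono fun t => variation_omegaSlice_le (hV0 n) (σ n) t⟩
  exact exists_subseq_narrowTendsto (fun n => omegaSlice (V n) (σ n))
    (fun n => isIntegrableFamily_omegaSlice (V n) (σ n)) hequi

theorem exists_subseq_derivedFlux (hT : 0 < T) (hα : 0 < α) (hV : ∀ n, 1 ≤ V n)
    (hCE : ∀ n, IsCE (σ n) (j n))
    (hC : ∀ n, klDiv (σ n ⟨0, left_mem_Icc.2 hT.le⟩ : Measure Phase) stat +
      ∫⁻ r, lagrangian α (V n) (σ n (toIcc r)) (j n r) ∂(lebOn (Ioo 0 T)) ≤ C) :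
    ∃ k : ℕ → ℕ, StrictMono k ∧ ∃ Jt : Ioo (0 : ℝ) T → SignedMeasure Torus,
      IsIntegrableFamily (lebOn (Ioo 0 T)) Jt ∧
      NarrowTendsto (fun n => derivedFlux (V (k n)) (j (k n)))
        (spaceTime (lebOn (Ioo 0 T)) Jt) := by
  have := neZero_lebOn_Ioo hT
  have : PolishSpace (Ioo (0 : ℝ) T) := isOpen_Ioo.polishSpace
  have hV0 : ∀ n, 0 ≤ V n := fun n => zero_le_one.trans (hV n)
  have hbound : ∀ n, ∫⁻ t, fluxBound (V n) (σ n (toIcc t)) ^ 2 ∂(lebOn (Ioo 0 T)) ≤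
      ((8 * α * C).toNNReal : ℝ≥0) := by
    intro n
    have h := lintegral_fluxBound_sq_le hT hα (hV0 n) (hCE n) (hC n)
    rwa [← map_toIcc, lintegral_map ((measurable_fluxBound (V n) (σ n)).pow_const 2)
      continuous_toIcc.measurable] at h
  have hequi := equiintegrable_of_le (μ := fun n => derivedFluxSlice (V n) (j n)) (C := C)
    (κ := (1 / (2 * α)).toNNReal) hbound fun l hl =>
      ⟨(l * Real.exp l / (2 * α)).toNNReal, fun n B =>
        setLIntegral_variation_derivedFluxSlice_le hα (hV n) (le_add_self.trans (hC n)) hl B⟩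
  exact exists_subseq_narrowTendsto (fun n => derivedFluxSlice (V n) (j n))
    (fun n => isIntegrableFamily_derivedFluxSlice (V n) (hCE n)) hequi

end FluxCompactness

/-! ### Compactness of curves in a compact metrizable space -/

section Ascoli

/-- The pairs at distance at least `ε` form a compact set, covered by open sets on which some `D i`
differs by more than some `1 / (N + 1)`. Finitely many suffice, so small increments of finitely many
`D i` force a distance below `ε`. -/
theorem equicontinuous_of_separating {X Y ι κ : Type*} [TopologicalSpace X] [MetricSpace Y]
    [CompactSpace Y] {D : ι → Y → ℝ} (hD : ∀ i, Continuous (D i))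
    (hsep : ∀ y y', (∀ i, D i y = D i y') → y = y') {F : κ → X → Y}
    (hF : ∀ i x₀, ∀ ε > 0, ∀ᶠ x in 𝓝 x₀, ∀ n, |D i (F n x) - D i (F n x₀)| ≤ ε) :
    Equicontinuous F := by
  intro x₀
  rw [Metric.equicontinuousAt_iff_right]
  intro ε hε
  set K : Set (Y × Y) := {q | ε ≤ dist q.1 q.2} with hK
  have hKc : IsCompact K := (isClosed_le continuous_const continuous_dist).isCompact
  set U : ι × ℕ → Set (Y × Y) := fun k => {q | 1 / ((k.2 : ℝ) + 1) < |D k.1 q.2 - D k.1 q.1|} with hU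
  have hUo : ∀ k, IsOpen (U k) := fun k => isOpen_lt continuous_const
    ((((hD k.1).comp continuous_snd).sub ((hD k.1).comp continuous_fst)).abs)
  have hcov : K ⊆ ⋃ k, U k := by
    rintro ⟨y, y'⟩ hq
    have hne : ∃ i, D i y ≠ D i y' := by
      by_contra! h
      have := hsep y y' h
      rw [this] at hq
      simp only [hK, mem_ofPred_eq, dist_self] at hq
      linarith
    obtain ⟨i, hi⟩ := hne
    have hpos : 0 < |D i y' - D i y| := abs_pos.2 (sub_ne_zero.2 hi.symm)
    obtain ⟨N, hN⟩ := exists_nat_one_div_lt hpos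
    exact mem_iUnion.2 ⟨(i, N), hN⟩
  obtain ⟨t, ht⟩ := hKc.elim_finite_subcover U hUo hcov
  have hev : ∀ᶠ x in 𝓝 x₀, ∀ k ∈ t, ∀ n,
      |D k.1 (F n x) - D k.1 (F n x₀)| ≤ 1 / ((k.2 : ℝ) + 1) :=
    (eventually_all_finset t).2 fun k _ => hF k.1 x₀ _ (by positivity)
  filter_upwards [hev] with x hx n
  by_contra! hlt
  obtain ⟨k, hk, hk'⟩ := mem_iUnion₂.1 (ht (show (F n x₀, F n x) ∈ K from hlt))
  exact absurd (hx k hk n) (not_le.2 hk')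

theorem exists_subseq_tendsto_of_equicontinuous {X Y : Type*} [TopologicalSpace X]
    [CompactSpace X] [MetricSpace Y] [CompactSpace Y] {F : ℕ → C(X, Y)}
    (hF : Equicontinuous fun n => (F n : X → Y)) :
    ∃ k : ℕ → ℕ, StrictMono k ∧ ∃ f : C(X, Y), Tendsto (fun n => F (k n)) atTop (𝓝 f) := by
  set G : ℕ → X →ᵇ Y := fun n => BoundedContinuousFunction.mkOfCompact (F n) with hG
  have hA : Equicontinuous ((↑) : range G → X → Y) := by
    intro x₀ U hU
    filter_upwards [hF x₀ U hU] with x hx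
    rintro ⟨_, n, rfl⟩
    exact hx n
  have hc : IsCompact (closure (range G)) :=
    BoundedContinuousFunction.arzela_ascoli univ isCompact_univ (range G)
      (fun _ _ _ => mem_univ _) hA
  obtain ⟨g, -, k, hk, hlim⟩ := hc.tendsto_subseq (x := G) fun n => subset_closure ⟨n, rfl⟩
  refine ⟨k, hk, g.toContinuousMap, ?_⟩
  rw [ContinuousMap.tendsto_iff_tendstoUniformly]
  exact BoundedContinuousFunction.tendsto_iff_tendstoUniformly.1 hlim

theorem exists_subseq_tendsto_of_separating {X Y ι : Type*} [TopologicalSpace X] [CompactSpace X]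
    [TopologicalSpace Y] [CompactSpace Y] [TopologicalSpace.MetrizableSpace Y] {D : ι → Y → ℝ}
    (hD : ∀ i, Continuous (D i)) (hsep : ∀ y y', (∀ i, D i y = D i y') → y = y')
    {F : ℕ → C(X, Y)}
    (hF : ∀ i x₀, ∀ ε > 0, ∀ᶠ x in 𝓝 x₀, ∀ n, |D i (F n x) - D i (F n x₀)| ≤ ε) :
    ∃ k : ℕ → ℕ, StrictMono k ∧ ∃ f : C(X, Y), Tendsto (fun n => F (k n)) atTop (𝓝 f) := by
  let := TopologicalSpace.metrizableSpaceMetric Y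
  exact exists_subseq_tendsto_of_equicontinuous (equicontinuous_of_separating hD hsep hF)

end Ascoli

/-! ### Compactness of the densities -/

section Density

open InformationTheory

variable {T : ℝ}

theorem integral_density (σ : Curve T) (t : Icc (0 : ℝ) T) {ψ : Torus → ℝ} (hψ : Continuous ψ) :
    ∫ x, ψ x ∂(density σ t : Measure Torus) = ∫ q, ψ q.1 ∂(σ t : Measure Phase) :=
  integral_map measurable_fst.aemeasurable hψ.aestronglyMeasurable

/-- Functions of `x` alone have zero velocity gradient, so the Hamiltonian is linear in them.
Testing with `l ψ` and letting `l → ∞` removes the Lagrangian, which does not scale with `l`. -/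
theorem integral_density_sub_le_setIntegral {α V : ℝ} (hα : 0 < α) {σ : Curve T} {j : Flux T}
    (h : IsCE σ j) (hfin : ∫⁻ r, lagrangian α V (σ (toIcc r)) (j r) ∂(lebOn (Ioo 0 T)) ≠ ∞)
    {ψ ψ' : Torus → ℝ} (hψ : Continuous ψ) (hd : HasTorusDeriv ψ ψ') (hψ' : Continuous ψ')
    {s t : Icc (0 : ℝ) T} (hst : s ≤ t) :
    (∫ x, ψ x ∂(density σ t : Measure Torus)) - ∫ x, ψ x ∂(density σ s : Measure Torus) ≤
      ∫ r in between s t, ∫ q, V * q.2.toReal * ψ' q.1 ∂(σ (toIcc r) : Measure Phase)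
        ∂(lebOn (Ioo 0 T)) := by
  rw [integral_density σ t hψ, integral_density σ s hψ]
  set L := (∫⁻ r in between s t, lagrangian α V (σ (toIcc r)) (j r) ∂(lebOn (Ioo 0 T))).toReal
  set d := (∫ q, ψ q.1 ∂(σ t : Measure Phase)) - ∫ q, ψ q.1 ∂(σ s : Measure Phase) with hd_def
  set I := ∫ r in between s t, ∫ q, V * q.2.toReal * ψ' q.1 ∂(σ (toIcc r) : Measure Phase)
        ∂(lebOn (Ioo 0 T)) with hI
  have hL : 0 ≤ L := ENNReal.toReal_nonneg
  have key : ∀ l : ℝ, 0 < l → l * d ≤ L + l * I := by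
    intro l hl
    have := integral_sub_integral_le hα h hfin (ψ := fun _ x => l * ψ x) (ψ' := fun _ x => l * ψ' x)
      (fun _ => continuous_const.mul hψ) (fun _ y => (hd y).const_mul l)
      (fun _ => continuous_const.mul hψ') hst
    have hh : ∀ r, hamiltonian α V (σ (toIcc r)) (fun p => l * ψ' p.1) (dv fun p => l * ψ p.1) =
        l * ∫ q, V * q.2.toReal * ψ' q.1 ∂(σ (toIcc r) : Measure Phase) := by
      intro r
      simp only [hamiltonian, dv, flipVel, sub_self, Real.exp_zero, integral_zero, mul_zero,
        add_zero]
      rw [← integral_const_mul]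
      congr 1
      ext q
      ring
    simp only [hh, integral_const_mul] at this
    rw [hd_def, mul_sub]
    exact this
  by_contra! hlt
  have h1 : 0 < d - I := sub_pos.2 hlt
  -- This `l` makes `l (d - I) = L + 1`, which exceeds the permitted `L`.
  have := key ((L + 1) / (d - I)) (by positivity)
  have e : (L + 1) / (d - I) * d = (L + 1) / (d - I) * I + (L + 1) := by
    field_simp
    ring
  linarith

/-- The spatial integral is at most `M` times the flux bound, whose `L²` control in time gives a
modulus of continuity after optimizing `l`. -/
theorem integral_density_sub_le {α V : ℝ} (hT : 0 < T) (hα : 0 < α) (hV : 0 ≤ V) {σ : Curve T}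
    {j : Flux T} (h : IsCE σ j) {C : ℝ≥0}
    (hC : klDiv (σ ⟨0, left_mem_Icc.2 hT.le⟩ : Measure Phase) stat +
      ∫⁻ r, lagrangian α V (σ (toIcc r)) (j r) ∂(lebOn (Ioo 0 T)) ≤ C)
    {ψ ψ' : Torus → ℝ} (hψ : Continuous ψ) (hd : HasTorusDeriv ψ ψ') (hψ' : Continuous ψ')
    {M : ℝ} (hM0 : 0 < M) (hM : ∀ x, |ψ' x| ≤ M) {s t : Icc (0 : ℝ) T} (hst : s ≤ t)
    {l : ℝ≥0} (hl : l ≠ 0) :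
    (∫ x, ψ x ∂(density σ t : Measure Torus)) - ∫ x, ψ x ∂(density σ s : Measure Torus) ≤
      M * (8 * α * C / l + l * (t - s)) := by
  have hfin := ne_top_of_le_ne_top ENNReal.coe_ne_top (le_add_self.trans hC)
  have hl0 : (0 : ℝ) < l := lt_of_le_of_ne l.2 fun h => hl (NNReal.eq h.symm)
  have hts : 0 ≤ (t : ℝ) - s := sub_nonneg.2 hst
  refine (integral_density_sub_le_setIntegral hα h hfin hψ hd hψ' hst).trans ?_
  set f : Icc (0 : ℝ) T → ℝ := fun r => ∫ q, V * q.2.toReal * ψ' q.1 ∂(σ r : Measure Phase) with hf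
  have hfc : Continuous f := continuous_integral_curve σ
    ((continuous_const.mul (continuous_toReal.comp continuous_snd)).mul
      (hψ'.comp continuous_fst))
  have hbound : ∀ r, ENNReal.ofReal (f r) ≤ ENNReal.ofReal M * fluxBound V (σ r) := by
    intro r
    have h1 := ofReal_integral_le_fluxBound hV (σ r) (g := fun x => M⁻¹ * ψ' x)
      (continuous_const.mul hψ') fun x => by
        rw [abs_mul, abs_inv, abs_of_pos hM0]
        exact inv_mul_le_one_of_le₀ (hM x) hM0.le
    have e : f r = M * ∫ q, V * q.2.toReal * (M⁻¹ * ψ' q.1) ∂(σ r : Measure Phase) := by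
      rw [← integral_const_mul]
      refine integral_congr_ae (Eventually.of_forall fun q => ?_)
      field_simp
    rw [e, ENNReal.ofReal_mul hM0.le]
    gcongr
  have hsq : ∫⁻ r, fluxBound V (σ (toIcc r)) ^ 2 ∂(lebOn (Ioo 0 T)) ≤
      ENNReal.ofReal (8 * α * C) := by
    have h := lintegral_fluxBound_sq_le hT hα hV h hC
    rwa [← map_toIcc, lintegral_map ((measurable_fluxBound V σ).pow_const 2)
      continuous_toIcc.measurable] at h
  have hle : ∫⁻ r in between s t, ENNReal.ofReal M * fluxBound V (σ (toIcc r))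
      ∂(lebOn (Ioo 0 T)) ≤ ENNReal.ofReal (M * (8 * α * C / l + l * (t - s))) := by
    rw [lintegral_const_mul' _ _ ENNReal.ofReal_ne_top, ENNReal.ofReal_mul hM0.le,
      ENNReal.ofReal_add (by positivity) (by positivity), ENNReal.ofReal_div_of_pos hl0,
      ENNReal.ofReal_mul hl0.le, ENNReal.ofReal_coe_nnreal, ← lebOn_between]
    gcongr
    exact setLIntegral_le_of_lintegral_sq_le hsq hl
  have h2 := integral_le_toReal_lintegral (integrable_comp_toIcc hfc).integrableOn
    (fun r => hbound (toIcc r)) (ne_top_of_le_ne_top ENNReal.ofReal_ne_top hle)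
  refine h2.trans ?_
  rw [← ENNReal.toReal_ofReal (r := M * (8 * α * C / l + l * (t - s))) (by positivity)]
  exact ENNReal.toReal_mono ENNReal.ofReal_ne_top hle

theorem abs_integral_density_sub_le {α V : ℝ} (hT : 0 < T) (hα : 0 < α) (hV : 0 ≤ V) {σ : Curve T}
    {j : Flux T} (h : IsCE σ j) {C : ℝ≥0}
    (hC : klDiv (σ ⟨0, left_mem_Icc.2 hT.le⟩ : Measure Phase) stat +
      ∫⁻ r, lagrangian α V (σ (toIcc r)) (j r) ∂(lebOn (Ioo 0 T)) ≤ C)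
    {ψ ψ' : Torus → ℝ} (hψ : Continuous ψ) (hd : HasTorusDeriv ψ ψ') (hψ' : Continuous ψ')
    {M : ℝ} (hM0 : 0 < M) (hM : ∀ x, |ψ' x| ≤ M) (s t : Icc (0 : ℝ) T) {l : ℝ≥0} (hl : l ≠ 0) :
    |(∫ x, ψ x ∂(density σ t : Measure Torus)) - ∫ x, ψ x ∂(density σ s : Measure Torus)| ≤
      M * (8 * α * C / l + l * |(t : ℝ) - s|) := by
  wlog hst : s ≤ t generalizing s t
  · rw [abs_sub_comm, abs_sub_comm (t : ℝ)]
    exact this t s (le_of_not_ge hst)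
  rw [abs_of_nonneg (sub_nonneg.2 (show (s : ℝ) ≤ t from hst)), abs_le]
  constructor
  · have := integral_density_sub_le hT hα hV h hC (ψ := fun x => -ψ x) (ψ' := fun x => -ψ' x)
      hψ.neg (fun y => (hd y).neg) hψ'.neg hM0 (fun x => by rw [abs_neg]; exact hM x) hst hl
    simp only [integral_neg] at this
    linarith
  · exact integral_density_sub_le hT hα hV h hC hψ hd hψ' hM0 hM hst hl

variable {α : ℝ} {V : ℕ → ℝ} {σ : ℕ → Curve T} {j : ℕ → Flux T} {C : ℝ≥0}

theorem exists_subseq_density (hT : 0 < T) (hα : 0 < α) (hV : ∀ n, 1 ≤ V n)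
    (hCE : ∀ n, IsCE (σ n) (j n))
    (hC : ∀ n, klDiv (σ n ⟨0, left_mem_Icc.2 hT.le⟩ : Measure Phase) stat +
      ∫⁻ r, lagrangian α (V n) (σ n (toIcc r)) (j n r) ∂(lebOn (Ioo 0 T)) ≤ C) :
    ∃ k : ℕ → ℕ, StrictMono k ∧ ∃ ρ : C(Icc (0 : ℝ) T, ProbabilityMeasure Torus),
      Tendsto (fun n => density (σ (k n))) atTop (𝓝 ρ) := by
  have hc : ∀ N (w : C(Torus, ℝ)), Continuous (conv (bump N) w volume) := fun N w =>
    continuous_conv (isMollifier_bump N).continuous w.continuous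
  have hint : ∀ {g : Torus → ℝ}, Continuous g →
      Continuous fun μ : ProbabilityMeasure Torus => ∫ x, g x ∂(μ : Measure Torus) := fun {g} hg =>
    ProbabilityMeasure.continuous_integral_boundedContinuousFunction
      (BoundedContinuousFunction.mkOfCompact (⟨g, hg⟩ : C(Torus, ℝ)))
  -- Mollified continuous functions serve as tests: they are `C¹`, as the continuity equation
  -- requires, and separate measures because the mollifiers form an approximate identity.
  refine exists_subseq_tendsto_of_separating (X := Icc (0 : ℝ) T) (Y := ProbabilityMeasure Torus)
    (F := fun n => density (σ n)) (D := fun (i : ℕ × C(Torus, ℝ)) (μ : ProbabilityMeasure Torus) =>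
      ∫ x, conv (bump i.1) i.2 volume x ∂(μ : Measure Torus)) (fun i => hint (hc i.1 i.2)) ?_ ?_
  · intro μ ν hμν
    refine Subtype.ext (ext_of_forall_integral_eq_of_IsFiniteMeasure (μ := (μ : Measure Torus))
      (ν := (ν : Measure Torus)) fun f => ?_)
    obtain ⟨M, hM0, hM⟩ := exists_abs_le_of_continuous (X := Torus) (f := f) f.continuous
    have hlim : ∀ μ : ProbabilityMeasure Torus,
        Tendsto (fun N => ∫ x, conv (bump N) f volume x ∂(μ : Measure Torus)) atTop
          (𝓝 (∫ x, f x ∂(μ : Measure Torus))) := fun μ =>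
      tendsto_integral_of_dominated_convergence (fun _ => M)
        (fun N => (hc N f.toContinuousMap).aestronglyMeasurable) (integrable_const _)
        (fun N => Eventually.of_forall fun x =>
          (isMollifier_bump N).abs_conv_le hM f.continuous x)
        (Eventually.of_forall fun x => tendsto_conv_bump f.continuous x)
    exact tendsto_nhds_unique (hlim μ)
      ((hlim ν).congr fun N => (hμν (N, f.toContinuousMap)).symm)
  · rintro ⟨N, w⟩ s ε hε
    have hN := isMollifier_bump N
    obtain ⟨M, hM0, hM⟩ := exists_abs_le_of_continuous
      (continuous_conv (μ := volume) hN.continuous_deriv w.continuous)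
    have hM1 : 0 < M + 1 := by positivity
    -- Large enough that the term with `1 / l` is at most `ε / 2`; the time window is then chosen
    -- for this `l`, the same for all `n`.
    set l : ℝ≥0 := ⟨(8 * α * C + 1) * (M + 1) * (2 / ε), by positivity⟩ with hl
    have hl0 : (0 : ℝ) < l := by
      change 0 < (8 * α * C + 1) * (M + 1) * (2 / ε)
      positivity
    have hl' : l ≠ 0 := fun h => by rw [h] at hl0; simp at hl0
    have hnhds : ∀ᶠ t : Icc (0 : ℝ) T in 𝓝 s, dist t s < ε / (2 * (M + 1) * l) :=
      Metric.ball_mem_nhds s (by positivity)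
    filter_upwards [hnhds] with t ht n
    have h1 := abs_integral_density_sub_le hT hα (zero_le_one.trans (hV n)) (hCE n) (hC n)
      (hc N w) (hasTorusDeriv_conv hN.continuous hN.continuous_deriv hN.hasTorusDeriv w.continuous)
      (continuous_conv hN.continuous_deriv w.continuous) hM1 (fun x => (hM x).trans (by linarith))
      s t hl'
    refine h1.trans ?_
    have h2 : |(t : ℝ) - s| ≤ ε / (2 * (M + 1) * l) := ht.le
    have h3 : (M + 1) * (8 * α * C / l) ≤ ε / 2 := by
      rw [mul_div_assoc', div_le_iff₀ hl0]
      change _ ≤ ε / 2 * ((8 * α * C + 1) * (M + 1) * (2 / ε))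
      have : ε / 2 * ((8 * α * C + 1) * (M + 1) * (2 / ε)) = (8 * α * C + 1) * (M + 1) := by
        field_simp
      rw [this]
      nlinarith
    have h4 : (M + 1) * (l * |(t : ℝ) - s|) ≤ ε / 2 := by
      have : (M + 1) * (l * (ε / (2 * (M + 1) * l))) = ε / 2 := by field_simp
      rw [← this]
      gcongr
    rw [mul_add]
    linarith

/-- Fenchel-Young for `u log u - u + 1` at each velocity. Nonnegativity of `ψ` allows `den` to be
replaced by the larger `denShift`. -/
theorem IsMollifier.integral_conv_density_le {p p' : Torus → ℝ} (hp : IsMollifier p p')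
    (s : ProbabilityMeasure Phase) {ψ : Torus → ℝ} (hψ : Continuous ψ) (hψ0 : ∀ x, 0 ≤ ψ x) :
    ∫ q, conv p ψ volume q.1 ∂(s : Measure Phase) ≤
      entropy p s + 2 * ∫ x, (Real.exp (ψ x) - 1) := by
  have hi : ∀ {f : Torus → ℝ}, Continuous f → Integrable f volume :=
    fun hf => hf.integrable_of_compactSpace _
  rw [integral_eq_sum_velMeasure (s : Measure Phase) (f := fun _ x => conv p ψ volume x)
    (fun _ => continuous_conv hp.continuous hψ)]
  have h1 : ∀ v, ∫ x, conv p ψ volume x ∂(velMeasure s v) ≤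
      (∫ x, denShift p s v x * logDen p s v x) - ((∫ x, denShift p s v x) - 1) +
        ∫ x, (Real.exp (ψ x) - 1) := by
    intro v
    have c1 := hp.continuous_logDen s v
    have c2 := hp.continuous_denShift s v
    have c3 : Continuous (den p s v) := continuous_den hp.continuous s v
    rw [← hp.integral_mul_conv hψ]
    change (∫ x, ψ x * den p s v x) ≤ _
    have h5 : (∫ x, denShift p s v x) - 1 = ∫ x, (denShift p s v x - 1) := by
      rw [MeasureTheory.integral_sub (hi c2) (integrable_const _)]
      simp
    rw [h5, ← MeasureTheory.integral_sub (hi (by fun_prop)) (hi (by fun_prop)),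
      ← integral_add (hi (by fun_prop)) (hi (by fun_prop))]
    refine integral_mono (hi (by fun_prop)) (hi (by fun_prop)) fun x => ?_
    have hpos := hp.denShift_pos s v x
    have h2 := Real.add_one_le_exp (ψ x - logDen p s v x)
    rw [Real.exp_sub, logDen, Real.exp_log hpos, le_div_iff₀ hpos] at h2
    have h3 : ψ x * den p s v x ≤ ψ x * denShift p s v x :=
      mul_le_mul_of_nonneg_left (by simp [denShift]) (hψ0 x)
    simp only [logDen]
    linarith
  have h4 := hp.sum_integral_denShift s
  rw [entropy]
  rw [sum_vel] at h4 ⊢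
  rw [sum_vel]
  linarith [h1 1, h1 (-1)]

/-- The dissipation estimate gives `entropy ≤ 2 C` at every time; its dual form involves only
continuous `ψ`, so it passes to the limit in the mollifier and later in `n`. -/
theorem integral_density_le {α V : ℝ} (hT : 0 < T) (hα : 0 < α) (hV : 0 ≤ V) {σ : Curve T}
    {j : Flux T} (h : IsCE σ j) {C : ℝ≥0}
    (hC : klDiv (σ ⟨0, left_mem_Icc.2 hT.le⟩ : Measure Phase) stat +
      ∫⁻ r, lagrangian α V (σ (toIcc r)) (j r) ∂(lebOn (Ioo 0 T)) ≤ C)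
    {ψ : Torus → ℝ} (hψ : Continuous ψ) (hψ0 : ∀ x, 0 ≤ ψ x) (t : Icc (0 : ℝ) T) :
    ∫ x, ψ x ∂(density σ t : Measure Torus) ≤ 2 * C + 2 * ∫ x, (Real.exp (ψ x) - 1) := by
  obtain ⟨M, hM0, hM⟩ := exists_abs_le_of_continuous hψ
  have hc : ∀ N, Continuous (conv (bump N) ψ volume) := fun N =>
    continuous_conv (isMollifier_bump N).continuous hψ
  have hlim : Tendsto (fun N => ∫ q, conv (bump N) ψ volume q.1 ∂(σ t : Measure Phase)) atTop
      (𝓝 (∫ q, ψ q.1 ∂(σ t : Measure Phase))) :=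
    tendsto_integral_of_dominated_convergence (fun _ => M)
      (fun N => ((hc N).measurable.comp measurable_fst).aestronglyMeasurable) (integrable_const _)
      (fun N => Eventually.of_forall fun q => (isMollifier_bump N).abs_conv_le hM hψ q.1)
      (Eventually.of_forall fun q => tendsto_conv_bump hψ q.1)
  rw [integral_density σ t hψ]
  refine le_of_tendsto hlim (Eventually.of_forall fun N => ?_)
  have hN := isMollifier_bump N
  refine (hN.integral_conv_density_le (σ t) hψ hψ0).trans ?_
  have h1 := hN.entropy_add_fisher_le_of_bound hT.le hα hV h hC t
  have h2 : 0 ≤ V ^ 2 / (2 * α) * ∫ r in between ⟨0, left_mem_Icc.2 hT.le⟩ t,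
      fisher (bump N) (σ (toIcc r)) ∂(lebOn (Ioo 0 T)) :=
    mul_nonneg (by positivity) (integral_nonneg fun _ => fisher_nonneg _ _)
  linarith

/-- A measure satisfying an entropic duality bound is absolutely continuous. -/
theorem absolutelyContinuous_of_integral_le {X : Type*} [TopologicalSpace X] [CompactSpace X]
    [T2Space X] [MeasurableSpace X] [BorelSpace X] {μ ν : Measure X} [IsFiniteMeasure μ]
    [μ.Regular] [IsFiniteMeasure ν] [ν.Regular] {K : ℝ}
    (h : ∀ ψ : X → ℝ, Continuous ψ → (∀ x, 0 ≤ ψ x) →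
      ∫ x, ψ x ∂μ ≤ K + 2 * ∫ x, (Real.exp (ψ x) - 1) ∂ν) : μ ≪ ν := by
  refine Measure.AbsolutelyContinuous.mk fun A hA hA0 => ?_
  by_contra hpos
  obtain ⟨F, hFA, hF, hF0⟩ := hA.exists_lt_isCompact (μ := μ) (pos_iff_ne_zero.2 hpos)
  have hνF : ν F = 0 := measure_mono_null hFA hA0
  have hμF : 0 < μ.real F := ENNReal.toReal_pos hF0.ne' (measure_ne_top _ _)
  have key : ∀ l : ℝ, 0 < l → l * μ.real F ≤ K + 2 := by
    intro l hl
    -- With `ν U < exp (-l)`, a cutoff of height `l` supported in `U` has exponential cost at most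
    -- `1`, while its `μ`-integral is at least `l μ(F)`.
    obtain ⟨U, hFU, hU, hUlt⟩ := F.exists_isOpen_lt_of_lt (μ := ν)
      (ENNReal.ofReal (Real.exp (-l))) (by rw [hνF]; simp [Real.exp_pos])
    obtain ⟨f, hf0, hf1, hf⟩ := exists_continuous_zero_one_of_isClosed hU.isClosed_compl
      hF.isClosed (disjoint_compl_left_iff_subset.2 hFU)
    have hfc := f.continuous
    have h1 := h (fun x => l * f x) (by fun_prop) fun x => mul_nonneg hl.le (hf x).1
    have h2 : l * μ.real F ≤ ∫ x, l * f x ∂μ := by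
      rw [integral_const_mul]
      refine mul_le_mul_of_nonneg_left ?_ hl.le
      rw [← integral_indicator_one hF.measurableSet]
      refine integral_mono ((integrable_const (1 : ℝ)).indicator hF.measurableSet)
        (hfc.integrable_of_compactSpace _) fun x => ?_
      by_cases hx : x ∈ F
      · simp [hx, hf1 hx]
      · simpa [hx] using (hf x).1
    have h3 : ∫ x, (Real.exp (l * f x) - 1) ∂ν ≤ Real.exp l * ν.real U := by
      have e : Real.exp l * ν.real U = ∫ x, U.indicator (fun _ => Real.exp l) x ∂ν := by
        rw [integral_indicator_const _ hU.measurableSet, smul_eq_mul, mul_comm]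
      rw [e]
      refine integral_mono (Continuous.integrable_of_compactSpace (by fun_prop) _)
        ((integrable_const _).indicator hU.measurableSet) fun x => ?_
      by_cases hx : x ∈ U
      · have : l * f x ≤ l := mul_le_of_le_one_right hl.le (hf x).2
        simp only [hx, indicator_of_mem]
        linarith [Real.exp_le_exp.2 this]
      · simp [hx, hf0 hx]
    have h4 : ν.real U ≤ Real.exp (-l) := ENNReal.toReal_le_of_le_ofReal (Real.exp_pos _).le hUlt.le
    have h5 : Real.exp l * ν.real U ≤ 1 := by
      calc _ ≤ Real.exp l * Real.exp (-l) := by gcongr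
        _ = 1 := by rw [← Real.exp_add]; simp
    linarith
  have hK := key 1 one_pos
  -- For this `l` the product `l μ(F)` is `K + 3`, a contradiction; the previous line ensures `K + 3
  -- > 0`.
  have h1 := key ((K + 3) / μ.real F) (div_pos (by linarith) hμF)
  rw [div_mul_cancel₀ _ hμF.ne'] at h1
  linarith

theorem absolutelyContinuous_of_tendsto_density (hT : 0 < T) (hα : 0 < α) (hV : ∀ n, 1 ≤ V n)
    (hCE : ∀ n, IsCE (σ n) (j n))
    (hC : ∀ n, klDiv (σ n ⟨0, left_mem_Icc.2 hT.le⟩ : Measure Phase) stat +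
      ∫⁻ r, lagrangian α (V n) (σ n (toIcc r)) (j n r) ∂(lebOn (Ioo 0 T)) ≤ C)
    {k : ℕ → ℕ} {ρ : C(Icc (0 : ℝ) T, ProbabilityMeasure Torus)}
    (hρ : Tendsto (fun n => density (σ (k n))) atTop (𝓝 ρ)) (t : Icc (0 : ℝ) T) :
    (ρ t : Measure Torus) ≪ volume := by
  refine absolutelyContinuous_of_integral_le (K := 2 * C) fun ψ hψ hψ0 => ?_
  have hlim := ProbabilityMeasure.tendsto_iff_forall_integral_tendsto.1
    (((continuous_eval_const t).tendsto ρ).comp hρ)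
    (BoundedContinuousFunction.mkOfCompact ⟨ψ, hψ⟩)
  exact le_of_tendsto hlim (Eventually.of_forall fun n =>
    integral_density_le hT hα (zero_le_one.trans (hV _)) (hCE _) (hC _) hψ hψ0 t)

end Density

theorem NarrowTendsto.comp_strictMono {X : Type*} [MeasurableSpace X] [TopologicalSpace X]
    {μ : ℕ → SignedMeasure X} {ν : SignedMeasure X} (h : NarrowTendsto μ ν) {k : ℕ → ℕ}
    (hk : StrictMono k) : NarrowTendsto (fun n => μ (k n)) ν :=
  fun f => (h f).comp hk.tendsto_atTop

end
end KacDiffusive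

open KacDiffusive in
theorem proposition4p4 (T : ℝ) (hT : 0 < T) (α : ℝ) (hα : 0 < α)
    (V : ℕ → ℝ) (hV : ∀ n, 1 ≤ V n)
    (σ : ℕ → Curve T) (j : ℕ → Flux T) (hCE : ∀ n, IsCE (σ n) (j n))
    (C : ℝ≥0)
    (hC : ∀ n, InformationTheory.klDiv
        (σ n ⟨0, left_mem_Icc.2 hT.le⟩ : Measure Phase) stat + rate α (V n) (σ n) (j n) ≤ C) :
    ∃ k : ℕ → ℕ, StrictMono k ∧
      ∃ (ρbar : C(Icc (0 : ℝ) T, ProbabilityMeasure Torus))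
        (ωbar : SignedMeasure (Icc (0 : ℝ) T × Torus))
        (Jbar : SignedMeasure (Ioo (0 : ℝ) T × Torus)),
        Tendsto (fun n => density (σ (k n))) atTop (𝓝 ρbar) ∧
        NarrowTendsto (fun n => omega (V (k n)) (σ (k n))) ωbar ∧
        NarrowTendsto (fun n => derivedFlux (V (k n)) (j (k n))) Jbar ∧
        (∀ t, (ρbar t : Measure Torus) ≪ volume) ∧
        (∃ ωt : Icc (0 : ℝ) T → SignedMeasure Torus,
          IsIntegrableFamily (lebOn (Icc 0 T)) ωt ∧
            ωbar = spaceTime (lebOn (Icc 0 T)) ωt) ∧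
        ∃ Jt : Ioo (0 : ℝ) T → SignedMeasure Torus,
          IsIntegrableFamily (lebOn (Ioo 0 T)) Jt ∧
            Jbar = spaceTime (lebOn (Ioo 0 T)) Jt := by
  have hC' : ∀ n, InformationTheory.klDiv
      (σ n ⟨0, left_mem_Icc.2 hT.le⟩ : Measure Phase) stat +
      ∫⁻ r, lagrangian α (V n) (σ n (toIcc r)) (j n r) ∂(lebOn (Ioo 0 T)) ≤ C := by
    intro n
    have := hC n
    rwa [rate, if_pos (hCE n)] at this
  -- The three extractions are nested, since the bounds hold along every subsequence.
  obtain ⟨k₁, hk₁, ρbar, hρ⟩ := exists_subseq_density hT hα hV hCE hC'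
  obtain ⟨k₂, hk₂, ωt, hωt, hω⟩ := exists_subseq_omega (V := fun n => V (k₁ n))
    (σ := fun n => σ (k₁ n)) hT hα (fun n => hV _) (fun n => hCE _) fun n => hC' _
  obtain ⟨k₃, hk₃, Jt, hJt, hJ⟩ := exists_subseq_derivedFlux (V := fun n => V (k₁ (k₂ n)))
    (σ := fun n => σ (k₁ (k₂ n))) hT hα (fun n => hV _) (fun n => hCE _) fun n => hC' _
  exact ⟨fun n => k₁ (k₂ (k₃ n)), hk₁.comp (hk₂.comp hk₃), ρbar, _, _,
    hρ.comp (hk₂.comp hk₃).tendsto_atTop, hω.comp_strictMono hk₃, hJ,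
    absolutelyContinuous_of_tendsto_density hT hα hV hCE hC' hρ, ⟨ωt, hωt, rfl⟩, ⟨Jt, hJt, rfl⟩⟩
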